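/- **Setting.** Let $(Y_i,w_i,x_i,z_i)_{i\ge 1}$ be independent and identically distributed random vectors with values in $\mathbb R\times\mathbb R^q\times\mathbb R^d\times\mathbb R^r$, satisfying the partially linear varying coefficient model $$Y_i=w_i'\gamma+x_i'\beta(z_i)+u_i,\qquad E(u_i\mid w_i,x_i,z_i)=0,$$ with $\gamma\in\mathbb R^q$ and a measurable function $\beta=(\beta_1,\dots,\beta_d)'$ on $\mathbb R^r$. Assume that $E[Y_1^2]<\infty$, that the support of $(w_1,x_1,z_1)$ is compact, and that $E[w_1\mid x_1,z_1]$ and $\operatorname{var}[Y_1\mid w_1,x_1,z_1]$ are bounded. Let $\mathcal S$ be the support of $(x_1,z_1)$. Let $\mathcal G$ be the class of functions $g(x,z)=\sum_{l=1}^d x_lh_l(z)$ with each $h_l$ continuous and $E[x_{1l}^2h_l(z_1)^2]<\infty$. Assume that $w_1$ has an $L^2$-projection $m(x_1,z_1)=E_{\mathcal G}(w_1)$ onto $\mathcal G$: the components $m_j$ of $m$ belong to $\mathcal G$, and $$E[(w_1-m(x_1,z_1))(w_1-m(x_1,z_1))']\le E[(w_1-g(x_1,z_1))(w_1-g(x_1,z_1))']$$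 in the positive semidefinite order for every $g$ with components in $\mathcal G$. Put $\varepsilon_i=w_i-m(x_i,z_i)$, $\Phi=E[\varepsilon_i\varepsilon_i']$, $\sigma^2(w_i,x_i,z_i)=E[u_i^2\mid w_i,x_i,z_i]$, and $\Omega=E[\sigma^2(w_i,x_i,z_i)\,\varepsilon_i\varepsilon_i']$. For each $l=1,\dots,d$ and each $k$ let $p_l^{k}(z)$ be a $k$-vector of measurable basis functions on $\mathbb R^r$. Let $k_l=k_l(n)$ and $K=K_n=\sum_l k_l$, and put $p^K(x,z)=(x_1p_1^{k_1}(z)',\dots,x_dp_d^{k_d}(z)')'$. Assume the following. * For every $n$ there is a nonsingular matrix $B=B_n$ such that, with $P^K(x,z)=Bp^K(x,z)$, the smallest eigenvalue of $E[P^K(x_1,z_1)P^K(x_1,z_1)']$ is bounded away from zero uniformly in $n$. There are constants $\zeta_0(K)$ with $\sup_{(x,z)\in\mathcal S}\|P^K(x,z)\|\le\zeta_0(K)$ and $\zeta_0(K)^2K/n\to0$. * There are $\delta_1,\dots,\delta_d>0$ such that, for $f(x,z)=x'\beta(z)$ and for $f=m_j$ ($j=1,\dots,q$), there are coefficient vectors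 $\alpha_{f}=\alpha_{fK}$ with $\sup_{(x,z)\in\mathcal S}|f(x,z)-P^K(x,z)'\alpha_f|=O(\sum_{l}k_l^{-\delta_l})$. Moreover $\min_l k_l\to\infty$ and $\sqrt n\sum_l k_l^{-2\delta_l}\to0$ as $n\to\infty$. **Estimators.** Let $W=(w_1,\dots,w_n)'$ and $P=(p^K(x_1,z_1),\dots,p^K(x_n,z_n))'$. Let $(\hat\gamma,\hat\alpha)$ be least squares coefficients in the regression of $(Y_1,\dots,Y_n)'$ on $(W,P)$, with $\hat\gamma$ measurable. Let $M=P(P'P)^-P'$, where $(P'P)^-$ is any symmetric generalized inverse of $P'P$. Let $\tilde w_i'$ be the $i$-th row of $MW$ and $\hat u_i=Y_i-w_i'\hat\gamma-p^K(x_i,z_i)'\hat\alpha$. Put $$\hat\Phi=\frac1n\sum_{i=1}^n(w_i-\tilde w_i)(w_i-\tilde w_i)',\qquad \hat\Omega=\frac1n\sum_{i=1}^n\hat u_i^2(w_i-\tilde w_i)(w_i-\tilde w_i)'.$$ **Theorem 2.1.** If $\Phi$ is positive definite, then, as $n\to\infty$: (i) $\sqrt n(\hat\gamma-\gamma)\to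 N(0,\Sigma)$ in distribution, where $\Sigma=\Phi^{-1}\Omega\Phi^{-1}$; (ii) $\hat\Phi$ is nonsingular with probability tending to one, and $\hat\Sigma=\hat\Phi^{-1}\hat\Omega\hat\Phi^{-1}\to\Sigma$ in probability (entrywise). -/

import Mathlib

open MeasureTheory ProbabilityTheory Filter Topology Matrix

/-! ### Partially linear varying coefficient model and its series least squares estimator -/

namespace PLVC

/-- `ℝⁿ` with the Euclidean norm. -/
abbrev Vec (n : ℕ) : Type := EuclideanSpace ℝ (Fin n)

section Population

variable {Ω : Type*} [MeasurableSpace Ω] {q d r : ℕ}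

/-- The varying coefficient class `𝒢` relative to the law of `(X, Z)`: functions
`g(x, z) = ∑ₗ xₗ hₗ(z)` with every `hₗ` continuous and `E[Xₗ² hₗ(Z)²] < ∞`. -/
def VaryingCoefClass (μ : Measure Ω) (X : Ω → Vec d) (Z : Ω → Vec r) :
    Set (Vec d → Vec r → ℝ) :=
  {g | ∃ h : Fin d → Vec r → ℝ, (∀ l, Continuous (h l)) ∧
    (∀ x z, g x z = ∑ l, x l * h l z) ∧
    ∀ l, Integrable (fun ω => (X ω l) ^ 2 * (h l (Z ω)) ^ 2) μ}

/-- The second moment matrix `E[F F']` of a random vector. -/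
noncomputable def momentMatrix (μ : Measure Ω) (F : Ω → Vec q) : Matrix (Fin q) (Fin q) ℝ :=
  Matrix.of fun a b => ∫ ω, F ω a * F ω b ∂μ

/-- The second moment matrix `E[s F F']` with scalar random weight `s`. -/
noncomputable def weightedMomentMatrix (μ : Measure Ω) (s : Ω → ℝ) (F : Ω → Vec q) :
    Matrix (Fin q) (Fin q) ℝ :=
  Matrix.of fun a b => ∫ ω, s ω * (F ω a * F ω b) ∂μ

/-- `m = E_𝒢(F)`: the components of `m` belong to `𝒢`, and among all vector functions `g` with
components in `𝒢`, `m` minimizes the matrix `E[(F - g(X,Z)) (F - g(X,Z))']` in the order of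
positive semidefinite matrices. -/
def IsVaryingCoefProjection (μ : Measure Ω) (X : Ω → Vec d) (Z : Ω → Vec r) (F : Ω → Vec q)
    (m : Vec d → Vec r → Vec q) : Prop :=
  (∀ j, (fun x z => m x z j) ∈ VaryingCoefClass μ X Z) ∧
  ∀ g : Vec d → Vec r → Vec q, (∀ j, (fun x z => g x z j) ∈ VaryingCoefClass μ X Z) →
    (momentMatrix μ (fun ω => F ω - g (X ω) (Z ω)) -
      momentMatrix μ (fun ω => F ω - m (X ω) (Z ω))).PosSemidef

end Population

section Series

variable {d r : ℕ}

/-- Index set of the `K = k₁ + ⋯ + k_d` series terms. -/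
abbrev SeriesIdx (k : Fin d → ℕ) : Type := Σ l : Fin d, Fin (k l)

/-- The stacked vector `p^K(x, z) = (x₁ p₁^{k₁}(z)', …, x_d p_d^{k_d}(z)')'`, where
`p l κ j` is the `j`-th of the `κ` basis functions used for the `l`-th coefficient function. -/
def seriesVec (p : (l : Fin d) → (κ : ℕ) → Fin κ → Vec r → ℝ) (k : Fin d → ℕ)
    (x : Vec d) (z : Vec r) : SeriesIdx k → ℝ :=
  fun a => x a.1 * p a.1 (k a.1) a.2 z

/-- Uniform approximation of `f` on `S` by linear combinations `P^K(x, z)' α` of the normalized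
series terms `P^K = B p^K`, with error `O(∑ₗ kₗ^{-δₗ})` as `n → ∞`. -/
def HasSeriesApprox (S : Set (Vec d × Vec r))
    (p : (l : Fin d) → (κ : ℕ) → Fin κ → Vec r → ℝ) (k : ℕ → Fin d → ℕ)
    (B : (n : ℕ) → Matrix (SeriesIdx (k n)) (SeriesIdx (k n)) ℝ) (δ : Fin d → ℝ)
    (f : Vec d → Vec r → ℝ) : Prop :=
  ∃ (α : (n : ℕ) → SeriesIdx (k n) → ℝ) (C : ℝ), ∀ᶠ n in atTop, ∀ xz ∈ S,
    |f xz.1 xz.2 - (B n *ᵥ seriesVec p (k n) xz.1 xz.2) ⬝ᵥ α n| ≤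
      C * ∑ l, (k n l : ℝ) ^ (-δ l)

end Series

section Estimators

variable {q d r : ℕ}

/-- The `n × q` matrix `W = (w₁, …, wₙ)'`. -/
def linearDesign (n : ℕ) (w : ℕ → Vec q) : Matrix (Fin n) (Fin q) ℝ :=
  Matrix.of fun i j => w i j

/-- The `n × K` matrix `P = (p^K(x₁, z₁), …, p^K(xₙ, zₙ))'`. -/
def seriesDesign (n : ℕ) (p : (l : Fin d) → (κ : ℕ) → Fin κ → Vec r → ℝ) (k : Fin d → ℕ)
    (x : ℕ → Vec d) (z : ℕ → Vec r) : Matrix (Fin n) (SeriesIdx k) ℝ :=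
  Matrix.of fun i => seriesVec p k (x i) (z i)

variable {n : ℕ} {κ : Type*} [Fintype κ]

/-- The residual vector `Y - W g - P a`. -/
def lsResidual (Y : Fin n → ℝ) (W : Matrix (Fin n) (Fin q) ℝ) (P : Matrix (Fin n) κ ℝ)
    (g : Vec q) (a : κ → ℝ) : Fin n → ℝ :=
  fun i => Y i - (∑ j, W i j * g j) - (P *ᵥ a) i

/-- `(g, a)` is a pair of least squares coefficients in the regression of `Y` on `(W, P)`. -/
def IsLeastSquares (Y : Fin n → ℝ) (W : Matrix (Fin n) (Fin q) ℝ) (P : Matrix (Fin n) κ ℝ)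
    (g : Vec q) (a : κ → ℝ) : Prop :=
  ∀ (g' : Vec q) (a' : κ → ℝ),
    ∑ i, (lsResidual Y W P g a i) ^ 2 ≤ ∑ i, (lsResidual Y W P g' a' i) ^ 2

/-- `G` is a symmetric generalized inverse of `A`. -/
def IsSymmGenInverse (A G : Matrix κ κ ℝ) : Prop :=
  G.IsSymm ∧ A * G * A = A

/-- `W - M W` with `M = P G P'`; here `G` stands for a generalized inverse of `P'P`, so that `M`
is the orthogonal projection onto the column space of `P`. -/
def partialledOut (W : Matrix (Fin n) (Fin q) ℝ) (P : Matrix (Fin n) κ ℝ) (G : Matrix κ κ ℝ) :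
    Matrix (Fin n) (Fin q) ℝ :=
  W - P * G * Pᵀ * W

/-- `n⁻¹ ∑ᵢ Rᵢ Rᵢ'`, where `Rᵢ` is the `i`-th row of `R`. -/
noncomputable def PhiHat (R : Matrix (Fin n) (Fin q) ℝ) : Matrix (Fin q) (Fin q) ℝ :=
  (n : ℝ)⁻¹ • ∑ i, vecMulVec (R i) (R i)

/-- `n⁻¹ ∑ᵢ eᵢ² Rᵢ Rᵢ'`, where `Rᵢ` is the `i`-th row of `R`. -/
noncomputable def OmegaHat (e : Fin n → ℝ) (R : Matrix (Fin n) (Fin q) ℝ) :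
    Matrix (Fin q) (Fin q) ℝ :=
  (n : ℝ)⁻¹ • ∑ i, (e i) ^ 2 • vecMulVec (R i) (R i)

/-- The sandwich estimator `Φ̂⁻¹ Ω̂ Φ̂⁻¹`. -/
noncomputable def SigmaHat (e : Fin n → ℝ) (R : Matrix (Fin n) (Fin q) ℝ) :
    Matrix (Fin q) (Fin q) ℝ :=
  (PhiHat R)⁻¹ * OmegaHat e R * (PhiHat R)⁻¹

end Estimators

end PLVC

open PLVC

/-! On the support, `w = ε + v + (series terms)` and `x'β = g + (series terms)`, where the
approximation errors `v` and `g` are at most `b n = O(∑ k_l^{-δ_l})`, so that `√n b² → 0`. Let `M`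
be the projection onto the series regressors. Partialling them out leaves regressors `r_j = (I -
M)(ε_j + v_j)` and the normal equations `∑_k (r_j · r_k) h_k = r_j · (u + g)` for `h = γ̂ - γ`
(`IsLeastSquares.partialled_out`). Everything reduces to replacing `r_j` by `ε_j` and `u + g` by
`u`. The law of large numbers then gives `Φ`, and the central limit theorem applied to `Φ⁻¹ ε u`
gives the normal limit with covariance `Φ⁻¹ΩΦ⁻¹`.

Size of the projected parts: a nonsingular change of series terms does not affect `M`, so the terms
may be taken orthonormal in `L²`, with squared length at most `Z = ζ²/c` (`exists_normalization`).
Taking the trace, `K ≤ Z`, so `ZK/n → 0` forces `K = o(√n)`. The sample Gram matrix is close to the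
identity with probability tending to one, and then `‖Mt‖² ≤ 2‖Ψ't‖²/n` (`exists_coeff`). For `t =
ε_j` or `t = u`, both orthogonal in mean to the series terms, the right side has mean `O(K) =
o(√n)`. The sums `ε_j · g` and `v_j · u` are centered with variance `O(n b²)`, hence `o(√n)` in
probability, and all products of approximation errors are `O(n b²) = o(√n)`.

Orthogonality of `ε` needs care: `m` is optimal only among continuous coefficient functions, while
the basis functions and `β` are merely measurable. Optimality gives orthogonality to `x_l h(z)` for
bounded continuous `h`; since such functions determine finite measures, it extends to measurable `h`
(`integral_mul_comp_eq_zero`), and by uniform approximation to `x'β` and to the remainders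
(`integral_mul_remainder_eq_zero`).

For the sandwich estimator, `û r_j` is compared with `u ε_j` in mean square over the sample. The
error `u` is only multiplied by uniformly small factors or by series terms, so a bounded conditional
variance suffices and no fourth moment of `u` enters (`sum_sq_mul_sub_mul_le`). Cauchy–Schwarz and
the law of large numbers for `u² ε ε'` finish.

Convergence in probability is convergence along `probFilter`, so once the stochastic inputs are
gathered in `PartialledLimits`, the rest is calculus along an arbitrary filter. -/

namespace PLVC

/-! ### Convergence in probability as convergence along a filter -/

section ProbFilter

variable {Ω : Type*} [MeasurableSpace Ω] {μ : Measure Ω}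

/-- The filter on `ℕ × Ω` of the events that hold with probability tending to one. Convergence
in probability is convergence along this filter. -/
def probFilter (μ : Measure Ω) : Filter (ℕ × Ω) where
  sets := {A | Tendsto (fun n => μ {ω | (n, ω) ∉ A}) atTop (𝓝 0)}
  univ_sets := by simp
  sets_of_superset := by
    intro A B hA hAB
    refine tendsto_of_tendsto_of_tendsto_of_le_of_le tendsto_const_nhds hA (fun _ => zero_le) ?_
    exact fun n => measure_mono fun ω hω h => hω (hAB h)
  inter_sets := by
    intro A B hA hB
    have h := Tendsto.add (Set.mem_ofPred.1 hA) (Set.mem_ofPred.1 hB)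
    rw [add_zero] at h
    refine tendsto_of_tendsto_of_tendsto_of_le_of_le tendsto_const_nhds h (fun _ => zero_le) ?_
    intro n
    refine (measure_mono ?_).trans (measure_union_le _ _)
    intro ω hω
    by_cases h : (n, ω) ∈ A
    · exact Or.inr fun h' => hω ⟨h, h'⟩
    · exact Or.inl h

lemma eventually_probFilter {p : ℕ × Ω → Prop} :
    (∀ᶠ a in probFilter μ, p a) ↔ Tendsto (fun n => μ {ω | ¬ p (n, ω)}) atTop (𝓝 0) := Iff.rfl

/-- Composing with this turns deterministic rates in `n` into limits in probability. -/
lemma tendsto_fst_probFilter : Tendsto Prod.fst (probFilter μ) atTop := by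
  intro s hs
  rw [mem_map]
  refine tendsto_const_nhds.congr' ?_
  filter_upwards [mem_atTop_sets.2 (mem_atTop_sets.1 hs)] with n hn
  simp [hn]

lemma eventually_probFilter_of_ae {p : ℕ → Ω → Prop} (h : ∀ᶠ n in atTop, ∀ᵐ ω ∂μ, p n ω) :
    ∀ᶠ a in probFilter μ, p a.1 a.2 := by
  rw [eventually_probFilter]
  refine tendsto_const_nhds.congr' ?_
  filter_upwards [h] with n hn
  exact (ae_iff.1 hn).symm

lemma TendstoInMeasure.of_tendsto_probFilter {E : Type*} [PseudoMetricSpace E] {X : ℕ → Ω → E}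
    {c : E} (h : Tendsto (fun a : ℕ × Ω => X a.1 a.2) (probFilter μ) (𝓝 c)) :
    TendstoInMeasure μ X atTop (fun _ => c) := by
  rw [tendstoInMeasure_iff_dist]
  intro ε hε
  have := eventually_probFilter.1 ((Metric.tendsto_nhds.1 h) ε hε)
  simpa using this

lemma tendsto_probFilter_of_tendstoInMeasure {E : Type*} [PseudoMetricSpace E] {X : ℕ → Ω → E}
    {c : E} (h : TendstoInMeasure μ X atTop (fun _ => c)) :
    Tendsto (fun a : ℕ × Ω => X a.1 a.2) (probFilter μ) (𝓝 c) := by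
  rw [tendstoInMeasure_iff_dist] at h
  refine Metric.tendsto_nhds.2 fun ε hε => eventually_probFilter.2 ?_
  simpa using h ε hε

/-- Markov's inequality: convergence to zero in mean implies convergence in probability. -/
lemma tendsto_probFilter_of_integral {X : ℕ → Ω → ℝ} (h0 : ∀ n, 0 ≤ᵐ[μ] X n)
    (hX : ∀ n, Integrable (X n) μ) (h : Tendsto (fun n => ∫ ω, X n ω ∂μ) atTop (𝓝 0)) :
    Tendsto (fun a : ℕ × Ω => X a.1 a.2) (probFilter μ) (𝓝 0) := by
  refine tendsto_probFilter_of_tendstoInMeasure ?_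
  refine tendstoInMeasure_of_tendsto_eLpNorm (p := 1) one_ne_zero
    (fun n => (hX n).aestronglyMeasurable) aestronglyMeasurable_const ?_
  have : ∀ n, eLpNorm (X n - fun _ => (0 : ℝ)) 1 μ = ENNReal.ofReal (∫ ω, X n ω ∂μ) := by
    intro n
    rw [ofReal_integral_eq_lintegral_ofReal (hX n) (h0 n), eLpNorm_one_eq_lintegral_enorm]
    refine lintegral_congr_ae ?_
    filter_upwards [h0 n] with ω hω
    simp [Real.enorm_eq_ofReal hω]
  simp_rw [this]
  simpa using ENNReal.tendsto_ofReal h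

/-- A sequence bounded in `L²`, multiplied by a null sequence in probability, is null in
probability. -/
lemma tendsto_probFilter_mul_of_integral_sq_le [IsFiniteMeasure μ] {S : ℕ → Ω → ℝ} {C : ℝ}
    (hS : ∀ n, MemLp (S n) 2 μ) (hC : ∀ n, ∫ ω, S n ω ^ 2 ∂μ ≤ C) {A : ℕ × Ω → ℝ}
    (hA : Tendsto A (probFilter μ) (𝓝 0)) :
    Tendsto (fun a => A a * S a.1 a.2) (probFilter μ) (𝓝 0) := by
  have hC0 : 0 ≤ C := (integral_nonneg fun ω => sq_nonneg _).trans (hC 0)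
  rw [Metric.tendsto_nhds]
  intro ε hε
  rw [eventually_probFilter, ENNReal.tendsto_nhds_zero]
  intro η hη
  -- The tolerance `η` is an extended real and may be `⊤`; `η'` is a finite positive substitute for
  -- half of it.
  obtain ⟨η', hη'0, hη'⟩ : ∃ η' : ℝ, 0 < η' ∧ ENNReal.ofReal η' ≤ η / 2 := by
    rcases eq_or_ne η ⊤ with rfl | h
    · exact ⟨1, one_pos, by simp [ENNReal.top_div]⟩
    · refine ⟨(η / 2).toReal, ENNReal.toReal_pos (by simpa using hη.ne') ?_, ?_⟩
      · exact ENNReal.div_ne_top h (by simp)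
      · rw [ENNReal.ofReal_toReal (ENNReal.div_ne_top h (by simp))]
  -- a level exceeded with probability at most `η'`
  obtain ⟨b, hb0, hb⟩ : ∃ b : ℝ, 0 < b ∧ C / b ^ 2 ≤ η' := by
    -- Chebyshev needs `b² ≥ C / η'`; the summand `1` keeps `b` positive when `C = 0`.
    refine ⟨√(C / η') + 1, by positivity, ?_⟩
    rw [div_le_iff₀ (by positivity)]
    have h1 : √(C / η') ^ 2 = C / η' := Real.sq_sqrt (by positivity)
    have h2 : 0 ≤ √(C / η') := Real.sqrt_nonneg _
    have h3 : C / η' ≤ (√(C / η') + 1) ^ 2 := by nlinarith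
    rw [div_le_iff₀ hη'0] at h3
    linarith
  have hSb : ∀ n, μ {ω | b ≤ |S n ω|} ≤ ENNReal.ofReal η' := by
    intro n
    have h1 : {ω | b ≤ |S n ω|} = {ω | b ^ 2 ≤ S n ω ^ 2} := by
      ext ω
      simp only [Set.mem_ofPred_eq]
      rw [sq_le_sq, abs_of_pos hb0]
    have h2 := mul_meas_ge_le_integral_of_nonneg (μ := μ) (f := fun ω => S n ω ^ 2)
      (ae_of_all _ fun ω => sq_nonneg _) (hS n).integrable_sq (b ^ 2)
    rw [h1]
    refine (ENNReal.le_ofReal_iff_toReal_le (measure_ne_top _ _) hη'0.le).2 ?_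
    refine le_trans ?_ hb
    rw [le_div_iff₀ (by positivity), mul_comm]
    exact h2.trans (hC n)
  have hA' := (ENNReal.tendsto_nhds_zero.1
    (eventually_probFilter.1 (Metric.tendsto_nhds.1 hA (ε / b) (by positivity)))) (η / 2)
      (by simpa using hη.ne')
  filter_upwards [hA'] with n hn
  refine (measure_mono (t := {ω | ¬ dist (A (n, ω)) 0 < ε / b} ∪ {ω | b ≤ |S n ω|}) ?_).trans
    ((measure_union_le _ _).trans ((add_le_add hn ((hSb n).trans hη')).trans
      (ENNReal.add_halves _).le))
  intro ω hω
  by_contra hcon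
  simp only [Set.mem_union, Set.mem_ofPred_eq, not_or, not_not, not_le, Real.dist_eq, sub_zero,
    abs_mul] at hcon hω
  refine hω ?_
  calc |A (n, ω)| * |S n ω| ≤ |A (n, ω)| * b := by gcongr; exact hcon.2.le
    _ < ε / b * b := by gcongr; exact hcon.1
    _ = ε := by field_simp

end ProbFilter

/-! ### Moments and weak laws for i.i.d. samples -/

section Sample

variable {Ω : Type*} [MeasurableSpace Ω] {μ : Measure Ω} 
  {E : Type*} [MeasurableSpace E] {ξ : ℕ → Ω → E}

/-- Weak law of large numbers for a function of an i.i.d. sample. -/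
lemma tendsto_probFilter_average [IsProbabilityMeasure μ] (hindep : iIndepFun ξ μ)
    (hident : ∀ i, IdentDistrib (ξ i) (ξ 0) μ μ) {T : E → ℝ} (hT : Measurable T)
    (hint : Integrable (fun ω => T (ξ 0 ω)) μ) :
    Tendsto (fun a : ℕ × Ω => (∑ i : Fin a.1, T (ξ i a.2)) / (a.1 : ℝ)) (probFilter μ)
      (𝓝 (∫ ω, T (ξ 0 ω) ∂μ)) := by
  have hid : ∀ i, IdentDistrib (fun ω => T (ξ i ω)) (fun ω => T (ξ 0 ω)) μ μ :=
    fun i => (hident i).comp hT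
  have hpair : Pairwise (Function.onFun (fun f g : Ω → ℝ => IndepFun f g μ)
      (fun i ω => T (ξ i ω))) := fun i j hij => (hindep.indepFun hij).comp hT hT
  have h := strong_law_ae_real (fun i ω => T (ξ i ω)) hint hpair hid
  have hm : ∀ i, AEStronglyMeasurable (fun ω => T (ξ i ω)) μ :=
    fun i => (hid i).aemeasurable_fst.aestronglyMeasurable
  refine tendsto_probFilter_of_tendstoInMeasure
    (X := fun n ω => (∑ i : Fin n, T (ξ i ω)) / (n : ℝ)) ?_
  refine tendstoInMeasure_of_tendsto_ae (fun n => ?_) ?_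
  · have : AEStronglyMeasurable (fun ω => ∑ i : Fin n, T (ξ i ω)) μ :=
      Finset.aestronglyMeasurable_fun_sum _ fun i _ => hm i
    simpa only [div_eq_mul_inv] using this.mul_const _
  · filter_upwards [h] with ω hω
    refine hω.congr fun n => ?_
    rw [Finset.sum_range]

/-- The variance of a sum of centered functions of an i.i.d. sample. -/
lemma integral_sum_sq [IsProbabilityMeasure μ] (hindep : iIndepFun ξ μ)
    (hident : ∀ i, IdentDistrib (ξ i) (ξ 0) μ μ) {T : E → ℝ} (hT : Measurable T)
    (hL2 : MemLp (fun ω => T (ξ 0 ω)) 2 μ) (hmean : ∫ ω, T (ξ 0 ω) ∂μ = 0) (n : ℕ) :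
    MemLp (fun ω => ∑ i : Fin n, T (ξ i ω)) 2 μ ∧
    ∫ ω, (∑ i : Fin n, T (ξ i ω)) ^ 2 ∂μ = n * ∫ ω, T (ξ 0 ω) ^ 2 ∂μ := by
  have hid : ∀ i, IdentDistrib (fun ω => T (ξ i ω)) (fun ω => T (ξ 0 ω)) μ μ :=
    fun i => (hident i).comp hT
  have hL : ∀ i, MemLp (fun ω => T (ξ i ω)) 2 μ := fun i => (hid i).memLp_iff.2 hL2
  have hm : ∀ i, ∫ ω, T (ξ i ω) ∂μ = 0 := fun i => (hid i).integral_eq.trans hmean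
  have hsum : MemLp (fun ω => ∑ i : Fin n, T (ξ i ω)) 2 μ :=
    memLp_finsetSum _ fun i _ => hL i
  refine ⟨hsum, ?_⟩
  have hvar : ∀ i, Var[fun ω => T (ξ i ω); μ] = ∫ ω, T (ξ 0 ω) ^ 2 ∂μ := by
    intro i
    rw [(hid i).variance_eq, variance_of_integral_eq_zero (hid 0).aemeasurable_fst hmean]
  have hmsum : ∫ ω, ∑ i : Fin n, T (ξ i ω) ∂μ = 0 := by
    rw [integral_finsetSum _ fun (i : Fin n) _ => (hL i).integrable (by norm_num)]
    simp [hm]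
  have h := IndepFun.variance_sum (μ := μ) (X := fun (i : Fin n) ω => T (ξ i ω))
    (s := Finset.univ) (fun i _ => hL i)
    (fun i _ j _ hij => (hindep.indepFun (fun h => hij (Fin.ext h))).comp hT hT)
  have h2 : (∑ i : Fin n, fun ω => T (ξ i ω)) = fun ω => ∑ i : Fin n, T (ξ i ω) := by
    ext ω; simp
  rw [h2, variance_of_integral_eq_zero hsum.aestronglyMeasurable.aemeasurable hmsum] at h
  rw [h]
  simp [hvar]

/-- A weighted sum of squares of centered sample sums vanishes in probability as soon as the sum
of the variances does. -/
lemma tendsto_probFilter_sum_sq [IsProbabilityMeasure μ] (hindep : iIndepFun ξ μ)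
    (hident : ∀ i, IdentDistrib (ξ i) (ξ 0) μ μ) {ι : ℕ → Type*} [∀ n, Fintype (ι n)]
    {T : (n : ℕ) → ι n → E → ℝ} (hT : ∀ n a, Measurable (T n a))
    (hL2 : ∀ n a, MemLp (fun ω => T n a (ξ 0 ω)) 2 μ)
    (hmean : ∀ n a, ∫ ω, T n a (ξ 0 ω) ∂μ = 0) {c : ℕ → ℝ} (hc : ∀ n, 0 ≤ c n) {ρ : ℕ → ℝ}
    (hρ : ∀ n, c n * ∑ a, ∫ ω, T n a (ξ 0 ω) ^ 2 ∂μ ≤ ρ n) (hρ0 : Tendsto ρ atTop (𝓝 0)) :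
    Tendsto (fun a : ℕ × Ω => c a.1 *
      ((∑ b, (∑ i : Fin a.1, T a.1 b (ξ i a.2)) ^ 2) / (a.1 : ℝ))) (probFilter μ) (𝓝 0) := by
  refine tendsto_probFilter_of_integral
    (X := fun n ω => c n * ((∑ b, (∑ i : Fin n, T n b (ξ i ω)) ^ 2) / (n : ℝ)))
    (fun n => ae_of_all _ fun ω => ?_) (fun n => ?_) ?_
  · exact mul_nonneg (hc n) (by positivity)
  · refine ((integrable_finsetSum _ fun b _ => ?_).div_const _).const_mul _
    exact (integral_sum_sq hindep hident (hT n b) (hL2 n b) (hmean n b) n).1.integrable_sq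
  · have hI0 : ∀ n, 0 ≤ ∑ a, ∫ ω, T n a (ξ 0 ω) ^ 2 ∂μ :=
      fun n => Finset.sum_nonneg fun a _ => integral_nonneg fun ω => sq_nonneg _
    have hI : ∀ n, ∫ ω, c n * ((∑ b, (∑ i : Fin n, T n b (ξ i ω)) ^ 2) / (n : ℝ)) ∂μ ≤ ρ n := by
      intro n
      refine le_trans ?_ (hρ n)
      rw [integral_const_mul, integral_div, integral_finsetSum _ fun b _ =>
        (integral_sum_sq hindep hident (hT n b) (hL2 n b) (hmean n b) n).1.integrable_sq]
      simp_rw [fun b => (integral_sum_sq hindep hident (hT n b) (hL2 n b) (hmean n b) n).2]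
      rw [← Finset.mul_sum]
      refine mul_le_mul_of_nonneg_left ?_ (hc n)
      -- For `n = 0` the quotient by `n` is `0` by convention, and the bound holds because the right
      -- side is nonnegative.
      rcases eq_or_ne (n : ℝ) 0 with h0 | h0
      · simpa [h0] using hI0 n
      · rw [mul_div_cancel_left₀ _ h0]
    refine tendsto_of_tendsto_of_tendsto_of_le_of_le tendsto_const_nhds hρ0 (fun n => ?_) hI
    exact integral_nonneg fun ω => mul_nonneg (hc n) (by positivity)

/-- A weighted sample average of nonnegative functions vanishes in probability as soon as the
weighted mean does. -/
lemma tendsto_probFilter_mul_average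
    (hident : ∀ i, IdentDistrib (ξ i) (ξ 0) μ μ)
    {T : ℕ → E → ℝ} (hT : ∀ n, Measurable (T n)) (hT0 : ∀ n e, 0 ≤ T n e)
    (hint : ∀ n, Integrable (fun ω => T n (ξ 0 ω)) μ) {c : ℕ → ℝ} (hc : ∀ n, 0 ≤ c n)
    {ρ : ℕ → ℝ} (hρ : ∀ n, c n * ∫ ω, T n (ξ 0 ω) ∂μ ≤ ρ n) (hρ0 : Tendsto ρ atTop (𝓝 0)) :
    Tendsto (fun a : ℕ × Ω => c a.1 * ((∑ i : Fin a.1, T a.1 (ξ i a.2)) / (a.1 : ℝ)))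
      (probFilter μ) (𝓝 0) := by
  have hid : ∀ n i, IdentDistrib (fun ω => T n (ξ i ω)) (fun ω => T n (ξ 0 ω)) μ μ :=
    fun n i => (hident i).comp (hT n)
  have hi : ∀ n i, Integrable (fun ω => T n (ξ i ω)) μ :=
    fun n i => (hid n i).integrable_iff.2 (hint n)
  refine tendsto_probFilter_of_integral
    (X := fun n ω => c n * ((∑ i : Fin n, T n (ξ i ω)) / (n : ℝ)))
    (fun n => ae_of_all _ fun ω => ?_) (fun n => ?_) ?_
  · exact mul_nonneg (hc n) (div_nonneg (Finset.sum_nonneg fun i _ => hT0 n _) (Nat.cast_nonneg n))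
  · exact ((integrable_finsetSum _ fun i _ => hi n _).div_const _).const_mul _
  · have hI : ∀ n, ∫ ω, c n * ((∑ i : Fin n, T n (ξ i ω)) / (n : ℝ)) ∂μ ≤ ρ n := by
      intro n
      refine le_trans ?_ (hρ n)
      rw [integral_const_mul, integral_div, integral_finsetSum _ fun i _ => hi n _]
      simp_rw [fun i => (hid n i).integral_eq]
      refine mul_le_mul_of_nonneg_left ?_ (hc n)
      rcases eq_or_ne (n : ℝ) 0 with h0 | h0
      · simpa [h0] using integral_nonneg (fun ω => hT0 n _)
      · simp [mul_div_cancel_left₀ _ h0]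
    refine tendsto_of_tendsto_of_tendsto_of_le_of_le tendsto_const_nhds hρ0 (fun n => ?_) hI
    exact integral_nonneg fun ω => mul_nonneg (hc n)
      (div_nonneg (Finset.sum_nonneg fun i _ => hT0 n _) (Nat.cast_nonneg n))

end Sample


/-! ### Deterministic geometry of the projection onto the regressors -/

section Projection

variable {n : ℕ} {κ : Type*} [Fintype κ]

/-- `M` is the orthogonal projection onto the column space of `P`. -/
structure IsProjOnto (M : Matrix (Fin n) (Fin n) ℝ) (P : Matrix (Fin n) κ ℝ) : Prop where
  symm : Mᵀ = M
  transpose_mul : Pᵀ * M = Pᵀ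
  exists_eq_mul : ∃ N : Matrix κ (Fin n) ℝ, M = P * N

namespace IsProjOnto

variable {M : Matrix (Fin n) (Fin n) ℝ} {P : Matrix (Fin n) κ ℝ}

lemma mul_self (h : IsProjOnto M P) : M * M = M := by
  obtain ⟨N, hN⟩ := h.exists_eq_mul
  calc M * M = Mᵀ * M := by rw [h.symm]
    _ = Nᵀ * (Pᵀ * M) := by rw [← Matrix.mul_assoc, ← Matrix.transpose_mul, ← hN]
    _ = Mᵀ := by rw [h.transpose_mul, ← Matrix.transpose_mul, ← hN]
    _ = M := h.symm

lemma mul_eq (h : IsProjOnto M P) : M * P = P := by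
  have := congrArg Matrix.transpose h.transpose_mul
  rwa [Matrix.transpose_mul, h.symm, Matrix.transpose_transpose] at this

lemma mulVec_mulVec_self (h : IsProjOnto M P) (c : κ → ℝ) : M *ᵥ (P *ᵥ c) = P *ᵥ c := by
  rw [Matrix.mulVec_mulVec, h.mul_eq]

lemma dotProduct_mulVec_comm (h : IsProjOnto M P) (a b : Fin n → ℝ) :
    (M *ᵥ a) ⬝ᵥ b = a ⬝ᵥ (M *ᵥ b) := by
  rw [Matrix.dotProduct_mulVec, ← Matrix.mulVec_transpose, h.symm]

lemma mulVec_dotProduct_mulVec (h : IsProjOnto M P) (a b : Fin n → ℝ) :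
    (M *ᵥ a) ⬝ᵥ (M *ᵥ b) = a ⬝ᵥ (M *ᵥ b) := by
  rw [h.dotProduct_mulVec_comm, Matrix.mulVec_mulVec, h.mul_self]

lemma resid_dotProduct (h : IsProjOnto M P) (a b : Fin n → ℝ) :
    (a - M *ᵥ a) ⬝ᵥ b = a ⬝ᵥ b - (M *ᵥ a) ⬝ᵥ (M *ᵥ b) := by
  rw [sub_dotProduct, h.mulVec_dotProduct_mulVec, h.dotProduct_mulVec_comm]

lemma resid_dotProduct_resid (h : IsProjOnto M P) (a b : Fin n → ℝ) :
    (a - M *ᵥ a) ⬝ᵥ (b - M *ᵥ b) = (a - M *ᵥ a) ⬝ᵥ b := by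
  rw [dotProduct_sub, sub_dotProduct a _ (M *ᵥ b), h.mulVec_dotProduct_mulVec]
  ring

lemma mulVec_dotProduct_self_le (h : IsProjOnto M P) (a : Fin n → ℝ) :
    (M *ᵥ a) ⬝ᵥ (M *ᵥ a) ≤ a ⬝ᵥ a := by
  have h1 := h.resid_dotProduct a a
  rw [← h.resid_dotProduct_resid] at h1
  have h2 : 0 ≤ (a - M *ᵥ a) ⬝ᵥ (a - M *ᵥ a) := Finset.sum_nonneg fun i _ => mul_self_nonneg _
  linarith

lemma resid_dotProduct_self_le (h : IsProjOnto M P) (a : Fin n → ℝ) :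
    (a - M *ᵥ a) ⬝ᵥ (a - M *ᵥ a) ≤ a ⬝ᵥ a := by
  rw [h.resid_dotProduct_resid, h.resid_dotProduct]
  have h2 : 0 ≤ (M *ᵥ a) ⬝ᵥ (M *ᵥ a) := Finset.sum_nonneg fun i _ => mul_self_nonneg _
  linarith

/-- The column space does not change under a nonsingular change of regressors. This is what permits
replacing `p^K` by normalized series terms. -/
lemma mul_isUnit [DecidableEq κ] (h : IsProjOnto M P) {A : Matrix κ κ ℝ} (hA : IsUnit A.det) :
    IsProjOnto M (P * A) where
  symm := h.symm
  transpose_mul := by rw [Matrix.transpose_mul, Matrix.mul_assoc, h.transpose_mul]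
  exists_eq_mul := by
    obtain ⟨N, hN⟩ := h.exists_eq_mul
    exact ⟨A⁻¹ * N, by
      rw [Matrix.mul_assoc, ← Matrix.mul_assoc A, Matrix.mul_nonsing_inv _ hA, Matrix.one_mul, hN]⟩

end IsProjOnto

/-- The defect `D = P G P'P - P` satisfies `P'D = 0` by the generalized inverse identity. Since `D`
is itself `P` times a matrix, `D'D = 0`, hence `D = 0`. -/
lemma IsSymmGenInverse.isProjOnto {P : Matrix (Fin n) κ ℝ} {G : Matrix κ κ ℝ}
    (hG : IsSymmGenInverse (Pᵀ * P) G) : IsProjOnto (P * G * Pᵀ) P := by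
  obtain ⟨hs, hg⟩ := hG
  have hs' : Gᵀ = G := hs
  have hkey : P * (G * (Pᵀ * P)) - P = 0 := by
    have h0 : Pᵀ * (P * (G * (Pᵀ * P)) - P) = 0 := by
      rw [Matrix.mul_sub, ← Matrix.mul_assoc, ← Matrix.mul_assoc, hg, sub_self]
    have h1 : (P * (G * (Pᵀ * P)) - P)ᴴ * (P * (G * (Pᵀ * P)) - P) = 0 := by
      nth_rw 1 [Matrix.conjTranspose_sub, Matrix.conjTranspose_mul]
      rw [Matrix.sub_mul, Matrix.mul_assoc, Matrix.conjTranspose_eq_transpose_of_trivial P, h0,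
        Matrix.mul_zero, sub_zero]
    exact Matrix.conjTranspose_mul_self_eq_zero.1 h1
  refine ⟨?_, ?_, G * Pᵀ, Matrix.mul_assoc _ _ _⟩
  · rw [Matrix.transpose_mul, Matrix.transpose_mul, Matrix.transpose_transpose, hs',
      Matrix.mul_assoc]
  · have h2 := congrArg Matrix.transpose (sub_eq_zero.1 hkey)
    rw [Matrix.transpose_mul, Matrix.transpose_mul, Matrix.transpose_mul,
      Matrix.transpose_transpose, hs'] at h2
    rw [← Matrix.mul_assoc, ← Matrix.mul_assoc, h2]

lemma dotProduct_sq_le {ι : Type*} [Fintype ι] (a b : ι → ℝ) :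
    (a ⬝ᵥ b) ^ 2 ≤ (a ⬝ᵥ a) * (b ⬝ᵥ b) := by
  have := Finset.sum_mul_sq_le_sq_mul_sq Finset.univ a b
  simpa only [dotProduct, sq] using this

lemma abs_dotProduct_le {ι : Type*} [Fintype ι] (a b : ι → ℝ) :
    |a ⬝ᵥ b| ≤ (a ⬝ᵥ a + b ⬝ᵥ b) / 2 := by
  have h1 : 0 ≤ (a - b) ⬝ᵥ (a - b) := Finset.sum_nonneg fun i _ => mul_self_nonneg _
  have h2 : 0 ≤ (a + b) ⬝ᵥ (a + b) := Finset.sum_nonneg fun i _ => mul_self_nonneg _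
  simp only [sub_dotProduct, dotProduct_sub, add_dotProduct, dotProduct_add,
    dotProduct_comm b a] at h1 h2
  rw [abs_le]
  constructor <;> linarith

lemma add_dotProduct_self_le {ι : Type*} [Fintype ι] (a b : ι → ℝ) :
    (a + b) ⬝ᵥ (a + b) ≤ 2 * (a ⬝ᵥ a) + 2 * (b ⬝ᵥ b) := by
  have h1 : 0 ≤ (a - b) ⬝ᵥ (a - b) := Finset.sum_nonneg fun i _ => mul_self_nonneg _
  simp only [sub_dotProduct, dotProduct_sub, add_dotProduct, dotProduct_add,
    dotProduct_comm b a] at h1 ⊢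
  linarith

/-- Cauchy–Schwarz on the index pairs: the Frobenius norm dominates the quadratic form, so that no
operator norm of the Gram error is needed. -/
lemma dotProduct_mulVec_sq_le {ι : Type*} [Fintype ι] (D : Matrix ι ι ℝ) (c : ι → ℝ) :
    (c ⬝ᵥ D *ᵥ c) ^ 2 ≤ (∑ a, ∑ b, D a b ^ 2) * (c ⬝ᵥ c) ^ 2 := by
  have h := Finset.sum_mul_sq_le_sq_mul_sq (Finset.univ : Finset (ι × ι))
    (fun x => D x.1 x.2) (fun x => c x.1 * c x.2)
  simp only [Fintype.sum_prod_type] at h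
  have h1 : c ⬝ᵥ D *ᵥ c = ∑ a, ∑ b, D a b * (c a * c b) := by
    simp only [dotProduct, mulVec, Finset.mul_sum]
    exact Finset.sum_congr rfl fun a _ => Finset.sum_congr rfl fun b _ => by ring
  have h2 : (c ⬝ᵥ c) ^ 2 = ∑ a, ∑ b, (c a * c b) ^ 2 := by
    rw [sq, dotProduct, Finset.sum_mul_sum]
    exact Finset.sum_congr rfl fun a _ => Finset.sum_congr rfl fun b _ => by ring
  rwa [h1, h2]

variable [DecidableEq κ]

/-- Squared Frobenius distance of the sample second moment matrix of the regressors from the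
identity. -/
noncomputable def gramError (Ψ : Matrix (Fin n) κ ℝ) : ℝ :=
  ∑ a, ∑ b, ((Ψᵀ * Ψ) a b / n - (1 : Matrix κ κ ℝ) a b) ^ 2

/-- `n⁻¹ ‖Ψ' t‖²`. -/
noncomputable def scoreSq (Ψ : Matrix (Fin n) κ ℝ) (t : Fin n → ℝ) : ℝ :=
  ((Ψᵀ *ᵥ t) ⬝ᵥ (Ψᵀ *ᵥ t)) / n

omit [DecidableEq κ] in
lemma scoreSq_nonneg (Ψ : Matrix (Fin n) κ ℝ) (t : Fin n → ℝ) : 0 ≤ scoreSq Ψ t :=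
  div_nonneg (Finset.sum_nonneg fun _ _ => mul_self_nonneg _) (Nat.cast_nonneg n)

/-- A Frobenius distance of at most `1/2` from the identity keeps `Ψ'Ψ/n` above half the identity.
-/
lemma le_dotProduct_of_gramError_le {Ψ : Matrix (Fin n) κ ℝ} (hn : 0 < n)
    (hg : gramError Ψ ≤ 1 / 4) (c : κ → ℝ) :
    n / 2 * (c ⬝ᵥ c) ≤ (Ψ *ᵥ c) ⬝ᵥ (Ψ *ᵥ c) := by
  have hn' : (0 : ℝ) < n := by exact_mod_cast hn
  set D : Matrix κ κ ℝ := (n : ℝ)⁻¹ • (Ψᵀ * Ψ) - 1 with hD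
  have h1 : (Ψ *ᵥ c) ⬝ᵥ (Ψ *ᵥ c) = n * (c ⬝ᵥ c + c ⬝ᵥ D *ᵥ c) := by
    rw [hD, Matrix.sub_mulVec, Matrix.smul_mulVec, Matrix.one_mulVec, dotProduct_sub,
      dotProduct_smul, ← Matrix.mulVec_mulVec, smul_eq_mul, Matrix.dotProduct_mulVec c Ψᵀ,
      Matrix.vecMul_transpose]
    field_simp
    ring
  have h2 : (c ⬝ᵥ D *ᵥ c) ^ 2 ≤ (1 / 2 * (c ⬝ᵥ c)) ^ 2 := by
    refine (dotProduct_mulVec_sq_le D c).trans ?_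
    have h3 : ∑ a, ∑ b, D a b ^ 2 = gramError Ψ := by
      simp [gramError, hD, div_eq_inv_mul]
    rw [h3, mul_pow]
    have := sq_nonneg (c ⬝ᵥ c)
    nlinarith
  have hcc : 0 ≤ c ⬝ᵥ c := Finset.sum_nonneg fun i _ => mul_self_nonneg _
  have h4 := (abs_le.1 (abs_le_of_sq_le_sq h2 (by positivity))).1
  rw [h1]
  nlinarith

namespace IsProjOnto

variable {M : Matrix (Fin n) (Fin n) ℝ} {Ψ : Matrix (Fin n) κ ℝ}

/-- Write `Mt = Ψc` and let `m = ‖Mt‖²`. Then `m = c · Ψ't`, while the lower bound on the Gram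
matrix gives `c · c ≤ 2m/n`. Cauchy–Schwarz yields `m² ≤ (2m/n)‖Ψ't‖²`, and one factor `m` cancels.
-/
lemma exists_coeff (h : IsProjOnto M Ψ) (hn : 0 < n) (hg : gramError Ψ ≤ 1 / 4)
    (t : Fin n → ℝ) : ∃ c : κ → ℝ, M *ᵥ t = Ψ *ᵥ c ∧
      (M *ᵥ t) ⬝ᵥ (M *ᵥ t) ≤ 2 * scoreSq Ψ t ∧ c ⬝ᵥ c ≤ 2 * ((M *ᵥ t) ⬝ᵥ (M *ᵥ t)) / n := by
  have hn' : (0 : ℝ) < n := by exact_mod_cast hn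
  obtain ⟨N, hN⟩ := h.exists_eq_mul
  set c := N *ᵥ t with hc
  have h1 : M *ᵥ t = Ψ *ᵥ c := by rw [hc, Matrix.mulVec_mulVec, ← hN]
  have hlow := le_dotProduct_of_gramError_le hn hg c
  rw [← h1] at hlow
  set m := (M *ᵥ t) ⬝ᵥ (M *ᵥ t) with hm
  have h2 : m = c ⬝ᵥ (Ψᵀ *ᵥ t) := by
    rw [hm, h.mulVec_dotProduct_mulVec, ← h.dotProduct_mulVec_comm, h1,
      Matrix.dotProduct_mulVec, Matrix.vecMul_transpose]
  have h3 := dotProduct_sq_le c (Ψᵀ *ᵥ t)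
  rw [← h2] at h3
  have hm0 : 0 ≤ m := Finset.sum_nonneg fun i _ => mul_self_nonneg _
  have hb0 : 0 ≤ (Ψᵀ *ᵥ t) ⬝ᵥ (Ψᵀ *ᵥ t) := Finset.sum_nonneg fun i _ => mul_self_nonneg _
  have hcm : c ⬝ᵥ c ≤ 2 * m / n := by
    rw [le_div_iff₀ hn']; linarith
  refine ⟨c, h1, ?_, hcm⟩
  rw [scoreSq]
  set b := (Ψᵀ *ᵥ t) ⬝ᵥ (Ψᵀ *ᵥ t)
  rcases hm0.eq_or_lt with h0 | h0
  · rw [← h0]; positivity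
  · have h4 : m * m ≤ m * (2 * (b / n)) := by
      calc m * m = m ^ 2 := by ring
        _ ≤ (c ⬝ᵥ c) * b := h3
        _ ≤ 2 * m / n * b := by gcongr
        _ = m * (2 * (b / n)) := by ring
    exact le_of_mul_le_mul_left h4 h0

lemma mulVec_dotProduct_self_le_scoreSq (h : IsProjOnto M Ψ) (hn : 0 < n)
    (hg : gramError Ψ ≤ 1 / 4) (t : Fin n → ℝ) :
    (M *ᵥ t) ⬝ᵥ (M *ᵥ t) ≤ 2 * scoreSq Ψ t :=
  let ⟨_, _, h2, _⟩ := h.exists_coeff hn hg t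
  h2

lemma mulVec_apply_sq_le_scoreSq (h : IsProjOnto M Ψ) (hn : 0 < n)
    (hg : gramError Ψ ≤ 1 / 4) (t : Fin n → ℝ) (i : Fin n) :
    (M *ᵥ t) i ^ 2 ≤ (Ψ i ⬝ᵥ Ψ i) * (4 * scoreSq Ψ t / n) := by
  obtain ⟨c, h1, h2, h3⟩ := h.exists_coeff hn hg t
  have hp : 0 ≤ Ψ i ⬝ᵥ Ψ i := Finset.sum_nonneg fun i _ => mul_self_nonneg _
  have h4 := dotProduct_sq_le (Ψ i) c
  rw [h1]
  refine h4.trans (mul_le_mul_of_nonneg_left (h3.trans ?_) hp)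
  exact div_le_div_of_nonneg_right (by linarith) (Nat.cast_nonneg n)

/-- Pointwise bound for approximation errors, of which only the length is known.
`mulVec_apply_sq_le_scoreSq` is the counterpart for `ε` and `u`, whose score against the regressors
is small. -/
lemma mulVec_apply_sq_le (h : IsProjOnto M Ψ) (hn : 0 < n)
    (hg : gramError Ψ ≤ 1 / 4) {t : Fin n → ℝ} {s : ℝ} (ht : t ⬝ᵥ t ≤ n * s) (i : Fin n) :
    (M *ᵥ t) i ^ 2 ≤ 2 * (Ψ i ⬝ᵥ Ψ i) * s := by
  have hn' : (0 : ℝ) < n := by exact_mod_cast hn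
  obtain ⟨c, h1, h2, h3⟩ := h.exists_coeff hn hg t
  have hp : 0 ≤ Ψ i ⬝ᵥ Ψ i := Finset.sum_nonneg fun i _ => mul_self_nonneg _
  have h4 := dotProduct_sq_le (Ψ i) c
  have h5 : c ⬝ᵥ c ≤ 2 * s := by
    refine h3.trans ?_
    rw [div_le_iff₀ hn']
    linarith [h.mulVec_dotProduct_self_le t]
  rw [h1]
  calc (Ψ *ᵥ c) i ^ 2 ≤ (Ψ i ⬝ᵥ Ψ i) * (c ⬝ᵥ c) := h4
    _ ≤ (Ψ i ⬝ᵥ Ψ i) * (2 * s) := by gcongr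
    _ = _ := by ring

/-- Partialling out the regressors changes the inner product of `a` and `b`, up to the
approximation errors `v` and `g`, by little. -/
lemma abs_resid_dotProduct_sub_le (h : IsProjOnto M Ψ) (hn : 0 < n)
    (hg : gramError Ψ ≤ 1 / 4) {a b v g : Fin n → ℝ} {s : ℝ} (hv : v ⬝ᵥ v ≤ s)
    (hgs : g ⬝ᵥ g ≤ s) :
    |((a + v) - M *ᵥ (a + v)) ⬝ᵥ (b + g) - a ⬝ᵥ b| ≤
      |a ⬝ᵥ g| + |v ⬝ᵥ b| + 3 * s + 2 * scoreSq Ψ a + 2 * scoreSq Ψ b := by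
  rw [h.resid_dotProduct]
  -- The constant `3` in `3 * s` collects `s` from `v · g`, `s` from `‖Mv‖²` and `s` from `‖Mg‖²`;
  -- the score terms bound `‖Ma‖²` and `‖Mb‖²`.
  have h1 := abs_dotProduct_le (M *ᵥ (a + v)) (M *ᵥ (b + g))
  have h2 := add_dotProduct_self_le (M *ᵥ a) (M *ᵥ v)
  have h3 := add_dotProduct_self_le (M *ᵥ b) (M *ᵥ g)
  rw [← Matrix.mulVec_add] at h2 h3
  have h4 := h.mulVec_dotProduct_self_le v
  have h5 := h.mulVec_dotProduct_self_le g
  have h6 := h.mulVec_dotProduct_self_le_scoreSq hn hg a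
  have h7 := h.mulVec_dotProduct_self_le_scoreSq hn hg b
  have h8 := abs_dotProduct_le v g
  set X := M *ᵥ (a + v) ⬝ᵥ M *ᵥ (b + g)
  have h9 : (a + v) ⬝ᵥ (b + g) - X - a ⬝ᵥ b = a ⬝ᵥ g + v ⬝ᵥ b + v ⬝ᵥ g - X := by
    simp only [add_dotProduct, dotProduct_add]; ring
  rw [h9]
  have h10 : |a ⬝ᵥ g + v ⬝ᵥ b + v ⬝ᵥ g - X| ≤ |a ⬝ᵥ g| + |v ⬝ᵥ b| + |v ⬝ᵥ g| + |X| :=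
    (abs_sub _ _).trans (add_le_add_left (abs_add_three _ _ _) _)
  linarith

end IsProjOnto

end Projection

/-! ### Normal equations and residuals of least squares -/

section LeastSquares

lemma eq_zero_of_forall_quadratic_nonneg {A b : ℝ} (hA : 0 ≤ A)
    (h : ∀ t : ℝ, 0 ≤ t * t * A - 2 * t * b) : b = 0 := by
  -- The minimizer of the quadratic would be `b / A`; the denominator `A + 1` also serves when `A =
  -- 0`.
  have h5 := h (b / (A + 1))
  have h6 : b / (A + 1) * (b / (A + 1)) * A - 2 * (b / (A + 1)) * b =
      -(b ^ 2 * (A + 2)) / (A + 1) ^ 2 := by field_simp; ring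
  rw [h6, le_div_iff₀ (by positivity), zero_mul] at h5
  have h7 : b ^ 2 ≤ 0 := by nlinarith [mul_nonneg (sq_nonneg b) hA, sq_nonneg b]
  exact pow_eq_zero_iff two_ne_zero |>.1 (le_antisymm h7 (sq_nonneg b))

variable {n q : ℕ} {κ : Type*} [Fintype κ] {Y : Fin n → ℝ} {W : Matrix (Fin n) (Fin q) ℝ}
  {P : Matrix (Fin n) κ ℝ} {g : Vec q} {a : κ → ℝ}

/-- First-order condition: along the line in direction `(g', a')` the sum of squares is a quadratic
in `t` minimal at `t = 0`, so its linear coefficient vanishes. -/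
lemma IsLeastSquares.dotProduct_eq_zero (h : IsLeastSquares Y W P g a) (g' : Vec q)
    (a' : κ → ℝ) :
    lsResidual Y W P g a ⬝ᵥ (fun i => (∑ j, W i j * g' j) + (P *ᵥ a') i) = 0 := by
  set e := lsResidual Y W P g a with he
  set D : Fin n → ℝ := fun i => (∑ j, W i j * g' j) + (P *ᵥ a') i with hD
  have h1 : ∀ t : ℝ, 0 ≤ t * t * (D ⬝ᵥ D) - 2 * t * (e ⬝ᵥ D) := by
    intro t
    have h2 := h (g + t • g') (a + t • a')
    have h3 : ∀ i, lsResidual Y W P (g + t • g') (a + t • a') i = e i - t * D i := by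
      intro i
      simp only [lsResidual, he, hD, PiLp.add_apply, PiLp.smul_apply, smul_eq_mul, mul_add,
        Finset.sum_add_distrib, Matrix.mulVec_add, Matrix.mulVec_smul, Pi.add_apply,
        Pi.smul_apply, Finset.mul_sum]
      have : ∑ x, W i x * (t * g' x) = ∑ x, t * (W i x * g' x) :=
        Finset.sum_congr rfl fun x _ => by ring
      rw [this]; ring
    simp_rw [h3] at h2
    have h4 : ∑ i, (e i - t * D i) ^ 2 =
        ∑ i, e i ^ 2 + (t * t * (D ⬝ᵥ D) - 2 * t * (e ⬝ᵥ D)) := by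
      simp only [dotProduct, Finset.mul_sum, ← Finset.sum_sub_distrib, ← Finset.sum_add_distrib]
      exact Finset.sum_congr rfl fun i _ => by ring
    rw [h4] at h2
    linarith
  exact eq_zero_of_forall_quadratic_nonneg (Finset.sum_nonneg fun i _ => mul_self_nonneg _) h1

/-- The test direction `a' = P'û` turns the first-order condition into `‖P'û‖² = 0`. -/
lemma IsLeastSquares.transpose_mulVec_eq_zero (h : IsLeastSquares Y W P g a) :
    Pᵀ *ᵥ lsResidual Y W P g a = 0 := by
  have h1 := h.dotProduct_eq_zero 0 (Pᵀ *ᵥ lsResidual Y W P g a)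
  have h2 : (fun i => (∑ j, W i j * (0 : Vec q) j) +
      (P *ᵥ (Pᵀ *ᵥ lsResidual Y W P g a)) i) = P *ᵥ (Pᵀ *ᵥ lsResidual Y W P g a) := by
    ext i; simp
  rw [h2, Matrix.dotProduct_mulVec, ← Matrix.mulVec_transpose] at h1
  exact dotProduct_self_eq_zero.1 h1

lemma IsLeastSquares.col_dotProduct_eq_zero (h : IsLeastSquares Y W P g a) (j : Fin q) :
    (fun i => W i j) ⬝ᵥ lsResidual Y W P g a = 0 := by
  have h1 := h.dotProduct_eq_zero (EuclideanSpace.single j 1) 0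
  rw [dotProduct_comm]
  simpa [PiLp.single_apply] using h1

/-- Least squares in a partially linear model whose nonparametric parts equal series terms up to
the errors `v` and `s`: normal equations for the coefficients of the linear part, and the
residuals. -/
lemma IsLeastSquares.partialled_out {M : Matrix (Fin n) (Fin n) ℝ} (hM : IsProjOnto M P)
    (h : IsLeastSquares Y W P g a) {γ : Vec q} {e : Fin q → Fin n → ℝ} {f s : Fin n → ℝ}
    (hY : ∀ i, Y i = (∑ j, W i j * γ j) + f i + s i)
    (hf : ∃ c, f = P *ᵥ c) (hW : ∀ j, ∃ c, (fun i => W i j) = e j + P *ᵥ c) :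
    (∀ j, (fun i => (W - M * W) i j) = e j - M *ᵥ e j) ∧
    (∀ i, lsResidual Y W P g a i =
      (s - M *ᵥ s) i - ∑ j, (g j - γ j) * (e j - M *ᵥ e j) i) ∧
    ∀ j, ∑ k, ((e j - M *ᵥ e j) ⬝ᵥ (e k - M *ᵥ e k)) * (g k - γ k) =
      (e j - M *ᵥ e j) ⬝ᵥ s := by
  obtain ⟨cf, hcf⟩ := hf
  choose cw hcw using hW
  set û := lsResidual Y W P g a with hu
  -- By symmetry `M` factors through `P'`, and `P'û = 0`.
  have hMu : M *ᵥ û = 0 := by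
    obtain ⟨N, hN⟩ := hM.exists_eq_mul
    have : M = Nᵀ * Pᵀ := by rw [← Matrix.transpose_mul, ← hN, hM.symm]
    rw [this, ← Matrix.mulVec_mulVec, h.transpose_mulVec_eq_zero, Matrix.mulVec_zero]
  have hcol : ∀ j, (fun i => (W - M * W) i j) = e j - M *ᵥ e j := by
    intro j
    have h1 : (fun i => (W - M * W) i j) = (fun i => W i j) - M *ᵥ (fun i => W i j) := by
      ext i; simp [Matrix.mul_apply, Matrix.mulVec, dotProduct]
    rw [h1, hcw j, Matrix.mulVec_add, hM.mulVec_mulVec_self]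
    abel
  have hures : û = (s - M *ᵥ s) - ∑ j, (g j - γ j) • (e j - M *ᵥ e j) := by
    have h1 : û = s - (∑ j, (g j - γ j) • e j) +
        P *ᵥ (cf - a - ∑ j, (g j - γ j) • cw j) := by
      ext i
      have hwi : ∀ j, W i j = e j i + (P *ᵥ cw j) i := fun j => congrFun (hcw j) i
      have hsum : P *ᵥ (∑ j, (g j - γ j) • cw j) = ∑ j, (g j - γ j) • (P *ᵥ cw j) := by
        rw [← Matrix.mulVecLin_apply, map_sum]
        simp
      simp only [hu, lsResidual, hY, hcf, Matrix.mulVec_sub, hsum, Pi.add_apply, Pi.sub_apply,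
        Finset.sum_apply, Pi.smul_apply, smul_eq_mul]
      have h2 : ∑ j, W i j * γ j - ∑ j, W i j * g j =
          -(∑ j, (g j - γ j) * e j i) - ∑ j, (g j - γ j) * (P *ᵥ cw j) i := by
        rw [← Finset.sum_neg_distrib, ← Finset.sum_sub_distrib, ← Finset.sum_sub_distrib]
        exact Finset.sum_congr rfl fun j _ => by rw [hwi j]; ring
      linarith
    -- Applying `I - M` to `û` costs nothing and removes every series term, including the unknown
    -- `α̂`.
    have h2 : û = û - M *ᵥ û := by rw [hMu, sub_zero]
    rw [h2, h1, Matrix.mulVec_add, hM.mulVec_mulVec_self, Matrix.mulVec_sub M]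
    have h3 : M *ᵥ (∑ j, (g j - γ j) • e j) = ∑ j, (g j - γ j) • (M *ᵥ e j) := by
      rw [← Matrix.mulVecLin_apply, map_sum]
      simp
    rw [h3]
    simp only [smul_sub, Finset.sum_sub_distrib]
    abel
  refine ⟨hcol, fun i => ?_, fun j => ?_⟩
  · rw [hures]
    simp [Finset.sum_apply]
  · have h1 : (e j - M *ᵥ e j) ⬝ᵥ û = 0 := by
      have h2 : e j - M *ᵥ e j = (fun i => W i j) - M *ᵥ (fun i => W i j) := by
        rw [hcw j, Matrix.mulVec_add, hM.mulVec_mulVec_self]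
        abel
      rw [h2, sub_dotProduct, h.col_dotProduct_eq_zero, hM.dotProduct_mulVec_comm, hMu,
        dotProduct_zero, sub_zero]
    rw [hures, dotProduct_sub, hM.resid_dotProduct_resid, dotProduct_sum] at h1
    rw [sub_eq_zero.1 h1]
    exact Finset.sum_congr rfl fun k _ => by rw [dotProduct_smul, smul_eq_mul, mul_comm]

/-- The decomposition is `û r - u ε = u (r - ε) + (û - u) r`. In the first product `u²` meets only
uniform bounds and the weight `ψ`, so second moments of `u` suffice. In the second, `r` is bounded
uniformly where it meets `mg`, which is controlled only in quadratic mean; the other parts of `û -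
u` are bounded uniformly and meet `∑ r²`. -/
lemma sum_sq_mul_sub_mul_le {u g mu mg rh ε v me mv ψ û r : Fin n → ℝ} {C κ a b Z H : ℝ}
    (hû : ∀ i, û i = u i + g i - mu i - mg i - rh i) (hr : ∀ i, r i = ε i + v i - me i - mv i)
    (hε : ∀ i, ε i ^ 2 ≤ C ^ 2) (hv : ∀ i, v i ^ 2 ≤ κ ^ 2) (hg : ∀ i, g i ^ 2 ≤ κ ^ 2)
    (hme : ∀ i, me i ^ 2 ≤ a) (hmu : ∀ i, mu i ^ 2 ≤ b) (hmv : ∀ i, mv i ^ 2 ≤ 2 * ψ i * κ ^ 2)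
    (hψ : ∀ i, ψ i ≤ Z) (hmg : ∑ i, mg i ^ 2 ≤ n * κ ^ 2)
    (hrr : ∑ i, r i ^ 2 ≤ 2 * n * (C ^ 2 + κ ^ 2)) (hrh : ∀ i, rh i ^ 2 ≤ H)
    (ha : 0 ≤ a) (hb : 0 ≤ b) (hZ : 0 ≤ Z) (hH : 0 ≤ H) :
    (∀ i, r i ^ 2 ≤ 4 * (C ^ 2 + κ ^ 2 + a + 2 * Z * κ ^ 2)) ∧
    ∑ i, (û i * r i - u i * ε i) ^ 2 ≤
      6 * (κ ^ 2 + a) * ∑ i, u i ^ 2 + 12 * κ ^ 2 * ∑ i, u i ^ 2 * ψ i +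
      8 * ((κ ^ 2 + b + H) * (2 * n * (C ^ 2 + κ ^ 2)) +
        4 * (C ^ 2 + κ ^ 2 + a + 2 * Z * κ ^ 2) * (n * κ ^ 2)) := by
  set T := C ^ 2 + κ ^ 2 + a + 2 * Z * κ ^ 2 with hT
  have hT0 : 0 ≤ T := by positivity
  have hrT : ∀ i, r i ^ 2 ≤ 4 * T := by
    intro i
    have h1 : r i ^ 2 ≤ 4 * (ε i ^ 2 + v i ^ 2 + me i ^ 2 + mv i ^ 2) := by
      rw [hr]
      nlinarith [sq_nonneg (ε i - v i), sq_nonneg (ε i + me i), sq_nonneg (ε i + mv i),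
        sq_nonneg (v i + me i), sq_nonneg (v i + mv i), sq_nonneg (me i - mv i)]
    have h2 : 2 * ψ i * κ ^ 2 ≤ 2 * Z * κ ^ 2 := by
      have := hψ i
      gcongr
    linarith [hε i, hv i, hme i, hmv i]
  refine ⟨hrT, ?_⟩
  -- The coefficients `6` and `8` are `2 · 3` and `2 · 4`: squaring a sum of two products, then sums
  -- of the three terms of `r - ε` and the four of `û - u`.
  have hpt : ∀ i, (û i * r i - u i * ε i) ^ 2 ≤
      6 * (κ ^ 2 + a) * u i ^ 2 + 12 * κ ^ 2 * (u i ^ 2 * ψ i) +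
        8 * ((κ ^ 2 + b + H) * r i ^ 2 + 4 * T * mg i ^ 2) := by
    intro i
    have h1 : (û i * r i - u i * ε i) ^ 2 ≤
        2 * (u i ^ 2 * (r i - ε i) ^ 2) + 2 * ((û i - u i) ^ 2 * r i ^ 2) := by
      have : û i * r i - u i * ε i = u i * (r i - ε i) + (û i - u i) * r i := by ring
      rw [this]
      nlinarith [sq_nonneg (u i * (r i - ε i) - (û i - u i) * r i)]
    have h2 : (r i - ε i) ^ 2 ≤ 3 * (κ ^ 2 + a + 2 * ψ i * κ ^ 2) := by
      have : (r i - ε i) ^ 2 ≤ 3 * (v i ^ 2 + me i ^ 2 + mv i ^ 2) := by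
        rw [hr]
        nlinarith [sq_nonneg (v i + me i), sq_nonneg (v i + mv i), sq_nonneg (me i - mv i)]
      linarith [hv i, hme i, hmv i]
    have h3 : (û i - u i) ^ 2 ≤ 4 * ((κ ^ 2 + b + H) + mg i ^ 2) := by
      have : (û i - u i) ^ 2 ≤ 4 * (g i ^ 2 + mu i ^ 2 + mg i ^ 2 + rh i ^ 2) := by
        rw [hû]
        nlinarith [sq_nonneg (g i + mu i), sq_nonneg (g i + mg i), sq_nonneg (g i + rh i),
          sq_nonneg (mu i - mg i), sq_nonneg (mu i - rh i), sq_nonneg (mg i - rh i)]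
      linarith [hg i, hmu i, hrh i]
    have h4 := mul_le_mul_of_nonneg_left h2 (sq_nonneg (u i))
    have h5 := mul_le_mul_of_nonneg_right h3 (sq_nonneg (r i))
    have h6 := mul_le_mul_of_nonneg_left (hrT i) (sq_nonneg (mg i))
    nlinarith
  refine (Finset.sum_le_sum fun i _ => hpt i).trans ?_
  simp only [Finset.sum_add_distrib, ← Finset.mul_sum]
  have h1 : (κ ^ 2 + b + H) * ∑ i, r i ^ 2 ≤ (κ ^ 2 + b + H) * (2 * n * (C ^ 2 + κ ^ 2)) := by
    gcongr
  have h2 : 4 * T * ∑ i, mg i ^ 2 ≤ 4 * T * (n * κ ^ 2) := by gcongr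
  linarith

end LeastSquares


/-! ### Finite-sample bounds for a partialled-out regression -/

/-- Data of a partialled-out regression: linear regressors `ε + v`, error `u` and remainder `g` of
the nonparametric part, all modulo the columns of `Ψ`, the projection `M` onto these columns, and
the estimation error `h` of the linear coefficients. -/
structure Partialled (n q : ℕ) (κ : Type*) where
  (ε v : Fin q → Fin n → ℝ)
  (u g : Fin n → ℝ)
  (Ψ : Matrix (Fin n) κ ℝ)
  (M : Matrix (Fin n) (Fin n) ℝ)
  (h : Fin q → ℝ)

namespace Partialled

variable {n q : ℕ} {κ : Type*}

/-- The partialled-out regressors. -/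
def r (X : Partialled n q κ) (j : Fin q) : Fin n → ℝ :=
  (X.ε j + X.v j) - X.M *ᵥ (X.ε j + X.v j)

/-- The regression residuals. -/
def uhat (X : Partialled n q κ) (i : Fin n) : ℝ :=
  ((X.u + X.g) - X.M *ᵥ (X.u + X.g)) i - ∑ j, X.h j * X.r j i

/-- Deterministic bounds and the normal equations. -/
structure Good [Fintype κ] [DecidableEq κ] (X : Partialled n q κ) (C b Z : ℝ) : Prop where
  pos : 0 < n
  proj : IsProjOnto X.M X.Ψ
  gram : gramError X.Ψ ≤ 1 / 4
  eps_le : ∀ j i, |X.ε j i| ≤ C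
  v_le : ∀ j i, |X.v j i| ≤ b
  g_le : ∀ i, |X.g i| ≤ b
  psi_le : ∀ i, X.Ψ i ⬝ᵥ X.Ψ i ≤ Z
  normal : ∀ j, ∑ k, (X.r j ⬝ᵥ X.r k) * X.h k = X.r j ⬝ᵥ (X.u + X.g)

lemma abs_dotProduct_le_of_abs_le {a c : Fin n → ℝ} {A B : ℝ} (ha : ∀ i, |a i| ≤ A)
    (hc : ∀ i, |c i| ≤ B) (hA : 0 ≤ A) : |a ⬝ᵥ c| ≤ n * (A * B) := by
  refine (Finset.abs_sum_le_sum_abs _ _).trans ?_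
  refine (Finset.sum_le_card_nsmul _ _ (A * B) fun i _ => ?_).trans (by simp)
  rw [abs_mul]
  exact mul_le_mul (ha i) (hc i) (abs_nonneg _) hA

variable [Fintype κ] [DecidableEq κ] {X : Partialled n q κ} {C b Z : ℝ}

namespace Good

lemma b_nonneg (hX : X.Good C b Z) : 0 ≤ b := (abs_nonneg _).trans (hX.g_le ⟨0, hX.pos⟩)

lemma Z_nonneg (hX : X.Good C b Z) : 0 ≤ Z :=
  (Finset.sum_nonneg fun _ _ => mul_self_nonneg _ : 0 ≤ X.Ψ ⟨0, hX.pos⟩ ⬝ᵥ X.Ψ ⟨0, hX.pos⟩).trans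
    (hX.psi_le _)

lemma v_dotProduct_le (hX : X.Good C b Z) (j : Fin q) : X.v j ⬝ᵥ X.v j ≤ n * b ^ 2 := by
  rw [sq]
  exact (le_abs_self _).trans (abs_dotProduct_le_of_abs_le (hX.v_le j) (hX.v_le j) hX.b_nonneg)

lemma g_dotProduct_le (hX : X.Good C b Z) : X.g ⬝ᵥ X.g ≤ n * b ^ 2 := by
  rw [sq]
  exact (le_abs_self _).trans (abs_dotProduct_le_of_abs_le hX.g_le hX.g_le hX.b_nonneg)

lemma abs_gram_sub_le (hX : X.Good C b Z) (hC : 0 ≤ C) (j k : Fin q) :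
    |X.r j ⬝ᵥ X.r k - X.ε j ⬝ᵥ X.ε k| ≤
      2 * (n * (C * b)) + 3 * (n * b ^ 2) + 2 * scoreSq X.Ψ (X.ε j) +
        2 * scoreSq X.Ψ (X.ε k) := by
  have h := hX.proj.abs_resid_dotProduct_sub_le hX.pos hX.gram (a := X.ε j) (b := X.ε k)
    (hX.v_dotProduct_le j) (hX.v_dotProduct_le k)
  rw [r, r, hX.proj.resid_dotProduct_resid]
  have h1 := abs_dotProduct_le_of_abs_le (hX.eps_le j) (hX.v_le k) hC
  have h2 := abs_dotProduct_le_of_abs_le (hX.eps_le k) (hX.v_le j) hC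
  rw [dotProduct_comm] at h2
  linarith

lemma abs_score_sub_le (hX : X.Good C b Z) (j : Fin q) :
    |X.r j ⬝ᵥ (X.u + X.g) - X.ε j ⬝ᵥ X.u| ≤
      |X.ε j ⬝ᵥ X.g| + |X.v j ⬝ᵥ X.u| + 3 * (n * b ^ 2) + 2 * scoreSq X.Ψ (X.ε j) +
        2 * scoreSq X.Ψ X.u :=
  hX.proj.abs_resid_dotProduct_sub_le hX.pos hX.gram (hX.v_dotProduct_le j) hX.g_dotProduct_le

/-- Uniform bound on the squares of the partialled-out regressors. -/
noncomputable def rBound (X : Partialled n q κ) (C b Z : ℝ) (j : Fin q) : ℝ :=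
  4 * (C ^ 2 + b ^ 2 + 4 * (Z * scoreSq X.Ψ (X.ε j) / n) + 2 * Z * b ^ 2)

omit [DecidableEq κ] in
lemma rBound_nonneg (hZ : 0 ≤ Z) (j : Fin q) : 0 ≤ rBound X C b Z j := by
  have := scoreSq_nonneg X.Ψ (X.ε j)
  unfold rBound; positivity

lemma mulVec_sq_le (hX : X.Good C b Z) (t : Fin n → ℝ) (i : Fin n) :
    (X.M *ᵥ t) i ^ 2 ≤ 4 * (Z * scoreSq X.Ψ t / n) := by
  refine (hX.proj.mulVec_apply_sq_le_scoreSq hX.pos hX.gram t i).trans ?_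
  have h0 : 0 ≤ 4 * scoreSq X.Ψ t / n :=
    div_nonneg (mul_nonneg (by norm_num) (scoreSq_nonneg _ _)) (Nat.cast_nonneg n)
  refine (mul_le_mul_of_nonneg_right (hX.psi_le i) h0).trans_eq (by ring)

lemma sum_r_sq_le (hX : X.Good C b Z) (hC : 0 ≤ C) (j : Fin q) :
    ∑ i, X.r j i ^ 2 ≤ 2 * n * (C ^ 2 + b ^ 2) := by
  have h1 := hX.proj.resid_dotProduct_self_le (X.ε j + X.v j)
  have h2 := add_dotProduct_self_le (X.ε j) (X.v j)
  have h3 := (le_abs_self _).trans (abs_dotProduct_le_of_abs_le (hX.eps_le j) (hX.eps_le j) hC)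
  have h4 := hX.v_dotProduct_le j
  have h5 : ∑ i, X.r j i ^ 2 = X.r j ⬝ᵥ X.r j := by simp [dotProduct, sq]
  rw [h5]
  unfold r
  linarith

/-- The bound `H` on the fitted part is left free because a good choice of it rests on the first
conclusion, which does not involve `H`. -/
lemma score_error_aux (hX : X.Good C b Z) (hC : 0 ≤ C) (j : Fin q) {H : ℝ} (hH : 0 ≤ H)
    (hrh : ∀ i, (∑ k, X.h k * X.r k i) ^ 2 ≤ H) :
    (∀ i, X.r j i ^ 2 ≤ rBound X C b Z j) ∧
    ∑ i, (X.uhat i * X.r j i - X.u i * X.ε j i) ^ 2 ≤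
      6 * (b ^ 2 + 4 * (Z * scoreSq X.Ψ (X.ε j) / n)) * ∑ i, X.u i ^ 2 +
      12 * b ^ 2 * ∑ i, X.u i ^ 2 * (X.Ψ i ⬝ᵥ X.Ψ i) +
      8 * ((b ^ 2 + 4 * (Z * scoreSq X.Ψ X.u / n) + H) * (2 * n * (C ^ 2 + b ^ 2)) +
        rBound X C b Z j * (n * b ^ 2)) := by
  have hn : (0 : ℝ) < n := by exact_mod_cast hX.pos
  have hZ := hX.Z_nonneg
  refine sum_sq_mul_sub_mul_le (u := X.u) (g := X.g) (mu := X.M *ᵥ X.u) (mg := X.M *ᵥ X.g)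
    (rh := fun i => ∑ k, X.h k * X.r k i) (ε := X.ε j) (v := X.v j) (me := X.M *ᵥ X.ε j)
    (mv := X.M *ᵥ X.v j) (ψ := fun i => X.Ψ i ⬝ᵥ X.Ψ i) (û := X.uhat) (r := X.r j) (Z := Z)
    (C := C) (κ := b) (b := 4 * (Z * scoreSq X.Ψ X.u / n)) (H := H)
    (a := 4 * (Z * scoreSq X.Ψ (X.ε j) / n))
    (fun i => ?_) (fun i => ?_) (fun i => ?_) (fun i => ?_) (fun i => ?_)
    (hX.mulVec_sq_le _) (hX.mulVec_sq_le _) (fun i => ?_) hX.psi_le ?_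
    (hX.sum_r_sq_le hC j) hrh ?_ ?_ hZ hH
  · simp only [uhat, Matrix.mulVec_add, Pi.sub_apply, Pi.add_apply]; ring
  · simp only [r, Matrix.mulVec_add, Pi.sub_apply, Pi.add_apply]; ring
  · exact sq_le_sq.2 ((hX.eps_le j i).trans (le_abs_self _))
  · exact sq_le_sq.2 ((hX.v_le j i).trans (le_abs_self _))
  · exact sq_le_sq.2 ((hX.g_le i).trans (le_abs_self _))
  · exact hX.proj.mulVec_apply_sq_le hX.pos hX.gram (hX.v_dotProduct_le j) i
  · have h5 : ∑ i, (X.M *ᵥ X.g) i ^ 2 = (X.M *ᵥ X.g) ⬝ᵥ (X.M *ᵥ X.g) := by simp [dotProduct, sq]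
    rw [h5]
    exact (hX.proj.mulVec_dotProduct_self_le _).trans hX.g_dotProduct_le
  · have := scoreSq_nonneg X.Ψ (X.ε j); positivity
  · have := scoreSq_nonneg X.Ψ X.u; positivity

/-- Mean square error of the estimated scores `û r` for `u ε`. -/
lemma sum_sq_score_error_le (hX : X.Good C b Z) (hC : 0 ≤ C) (j : Fin q) :
    (∑ i, (X.uhat i * X.r j i - X.u i * X.ε j i) ^ 2) / n ≤
      6 * (b ^ 2 + 4 * (Z * scoreSq X.Ψ (X.ε j) / n)) * ((∑ i, X.u i ^ 2) / n) +
      12 * (b ^ 2 * ((∑ i, X.u i ^ 2 * (X.Ψ i ⬝ᵥ X.Ψ i)) / n)) +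
      8 * ((b ^ 2 + 4 * (Z * scoreSq X.Ψ X.u / n) +
        (∑ k, X.h k ^ 2) * ∑ k, rBound X C b Z k) * (2 * (C ^ 2 + b ^ 2)) +
        rBound X C b Z j * b ^ 2) := by
  have hn : (0 : ℝ) < n := by exact_mod_cast hX.pos
  have hZ := hX.Z_nonneg
  -- A crude admissible `H`, the sum of all the squares, serves only to extract the uniform bound on
  -- the regressors; that bound then supplies the sharp `H` in `hH` through Cauchy–Schwarz.
  have hrB : ∀ k i, X.r k i ^ 2 ≤ rBound X C b Z k := fun k i =>
    (hX.score_error_aux hC k (H := ∑ i, (∑ k, X.h k * X.r k i) ^ 2)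
      (Finset.sum_nonneg fun _ _ => sq_nonneg _)
      (fun i => Finset.single_le_sum (f := fun i => (∑ k, X.h k * X.r k i) ^ 2)
        (fun _ _ => sq_nonneg _) (Finset.mem_univ i))).1 i
  have hH : ∀ i, (∑ k, X.h k * X.r k i) ^ 2 ≤ (∑ k, X.h k ^ 2) * ∑ k, rBound X C b Z k := by
    intro i
    refine (Finset.sum_mul_sq_le_sq_mul_sq _ _ _).trans ?_
    exact mul_le_mul_of_nonneg_left (Finset.sum_le_sum fun k _ => hrB k i)
      (Finset.sum_nonneg fun _ _ => sq_nonneg _)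
  have hH0 : 0 ≤ (∑ k, X.h k ^ 2) * ∑ k, rBound X C b Z k :=
    mul_nonneg (Finset.sum_nonneg fun _ _ => sq_nonneg _)
      (Finset.sum_nonneg fun k _ => rBound_nonneg hZ k)
  have h := (hX.score_error_aux hC j hH0 hH).2
  rw [div_le_iff₀ hn]
  refine h.trans_eq ?_
  field_simp

end Good

end Partialled

/-! ### Limits of partialled-out regressions along a filter -/

section Limits

open Partialled

variable {I : Type*} {L : Filter I} {q : ℕ} {N : I → ℕ} {κ : I → Type*} [∀ a, Fintype (κ a)]
  [∀ a, DecidableEq (κ a)]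

/-- Limit relations for a family of partialled-out regressions. -/
structure PartialledLimits (L : Filter I) (X : (a : I) → Partialled (N a) q (κ a)) (C : ℝ)
    (b Z : I → ℝ) (s : ℝ) (Φ Om : Matrix (Fin q) (Fin q) ℝ) : Prop where
  C_nonneg : 0 ≤ C
  size : Tendsto N L atTop
  good : ∀ᶠ a in L, (X a).Good C (b a) (Z a)
  bias : Tendsto (fun a => √(N a : ℝ) * b a ^ 2) L (𝓝 0)
  sup : Tendsto (fun a => Z a / N a) L (𝓝 0)
  score_eps : ∀ j, Tendsto (fun a => scoreSq (X a).Ψ ((X a).ε j) / √(N a : ℝ)) L (𝓝 0)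
  score_u : Tendsto (fun a => scoreSq (X a).Ψ (X a).u / √(N a : ℝ)) L (𝓝 0)
  sup_score_eps : ∀ j, Tendsto (fun a => Z a * scoreSq (X a).Ψ ((X a).ε j) / N a) L (𝓝 0)
  sup_score_u : Tendsto (fun a => Z a * scoreSq (X a).Ψ (X a).u / N a) L (𝓝 0)
  weight : Tendsto (fun a => b a ^ 2 *
    ((∑ i, (X a).u i ^ 2 * ((X a).Ψ i ⬝ᵥ (X a).Ψ i)) / N a)) L (𝓝 0)
  eps_g : ∀ j, Tendsto (fun a => ((X a).ε j ⬝ᵥ (X a).g) / √(N a : ℝ)) L (𝓝 0)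
  v_u : ∀ j, Tendsto (fun a => ((X a).v j ⬝ᵥ (X a).u) / √(N a : ℝ)) L (𝓝 0)
  u_sq : Tendsto (fun a => (∑ i, (X a).u i ^ 2) / N a) L (𝓝 s)
  eps_eps : ∀ j k, Tendsto (fun a => ((X a).ε j ⬝ᵥ (X a).ε k) / N a) L (𝓝 (Φ j k))
  score_score : ∀ j k, Tendsto (fun a => (∑ i, ((X a).u i * (X a).ε j i) *
    ((X a).u i * (X a).ε k i)) / N a) L (𝓝 (Om j k))
  -- Boundedness in probability, phrased as: multiplication by any null family gives a null family.
  tight : ∀ j (A : I → ℝ), Tendsto A L (𝓝 0) →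
    Tendsto (fun a => A a * (((X a).ε j ⬝ᵥ (X a).u) / √(N a : ℝ))) L (𝓝 0)

namespace PartialledLimits

variable {X : (a : I) → Partialled (N a) q (κ a)} {C : ℝ} {b Z : I → ℝ} {s : ℝ}
  {Φ Om : Matrix (Fin q) (Fin q) ℝ}

lemma tendsto_sqrt_size (h : PartialledLimits L X C b Z s Φ Om) :
    Tendsto (fun a => √(N a : ℝ)) L atTop :=
  Real.tendsto_sqrt_atTop.comp (tendsto_natCast_atTop_atTop.comp h.size)

lemma tendsto_inv_sqrt_size (h : PartialledLimits L X C b Z s Φ Om) :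
    Tendsto (fun a => (√(N a : ℝ))⁻¹) L (𝓝 0) := tendsto_inv_atTop_zero.comp h.tendsto_sqrt_size

lemma size_pos (h : PartialledLimits L X C b Z s Φ Om) : ∀ᶠ a in L, (0 : ℝ) < N a := by
  filter_upwards [h.good] with a ha
  exact_mod_cast ha.pos

lemma b_sq (h : PartialledLimits L X C b Z s Φ Om) : Tendsto (fun a => b a ^ 2) L (𝓝 0) := by
  have h1 := h.tendsto_inv_sqrt_size.mul h.bias
  rw [zero_mul] at h1
  refine h1.congr' ?_
  filter_upwards [h.size_pos] with a ha
  have := Real.sqrt_pos.2 ha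
  field_simp

lemma b_tendsto (h : PartialledLimits L X C b Z s Φ Om) : Tendsto b L (𝓝 0) := by
  have h1 := h.b_sq.sqrt
  rw [Real.sqrt_zero] at h1
  refine h1.congr' ?_
  filter_upwards [h.good] with a ha
  exact Real.sqrt_sq ha.b_nonneg

lemma div_size {f : I → ℝ} (h : PartialledLimits L X C b Z s Φ Om)
    (hf : Tendsto (fun a => f a / √(N a : ℝ)) L (𝓝 0)) :
    Tendsto (fun a => f a / (N a : ℝ)) L (𝓝 0) := by
  have h1 := hf.mul h.tendsto_inv_sqrt_size
  rw [zero_mul] at h1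
  refine h1.congr' ?_
  filter_upwards [h.size_pos] with a ha
  rw [← div_eq_mul_inv, div_div, Real.mul_self_sqrt ha.le]

/-- The second moment matrix of the partialled-out regressors converges. -/
theorem gram_tendsto (h : PartialledLimits L X C b Z s Φ Om) (j k : Fin q) :
    Tendsto (fun a => ((X a).r j ⬝ᵥ (X a).r k) / N a) L (𝓝 (Φ j k)) := by
  have hb : Tendsto (fun a => 2 * (C * b a) + 3 * b a ^ 2 +
      2 * (scoreSq (X a).Ψ ((X a).ε j) / N a) + 2 * (scoreSq (X a).Ψ ((X a).ε k) / N a)) L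
      (𝓝 0) := by
    have := ((((h.b_tendsto.const_mul C).const_mul 2).add (h.b_sq.const_mul 3)).add
      ((h.div_size (h.score_eps j)).const_mul 2)).add ((h.div_size (h.score_eps k)).const_mul 2)
    simpa using this
  have hd : Tendsto (fun a => ((X a).r j ⬝ᵥ (X a).r k) / N a -
      ((X a).ε j ⬝ᵥ (X a).ε k) / N a) L (𝓝 0) := by
    refine squeeze_zero_norm' ?_ hb
    filter_upwards [h.good, h.size_pos] with a ha hn
    rw [← sub_div, Real.norm_eq_abs, abs_div, abs_of_pos hn, div_le_iff₀ hn]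
    refine (ha.abs_gram_sub_le h.C_nonneg j k).trans_eq ?_
    field_simp
  simpa using hd.add (h.eps_eps j k)

/-- All errors are of order `o(√N)`. The terms `ε · g` and `v · u` enter as centered sums; bounding
them by their sizes would give only `O(√N b)` after scaling, whereas the hypothesis controls `√N
b²`. -/
lemma score_tendsto (h : PartialledLimits L X C b Z s Φ Om) (j : Fin q) :
    Tendsto (fun a => ((X a).r j ⬝ᵥ ((X a).u + (X a).g)) / √(N a : ℝ) -
      ((X a).ε j ⬝ᵥ (X a).u) / √(N a : ℝ)) L (𝓝 0) := by
  have hb : Tendsto (fun a => |((X a).ε j ⬝ᵥ (X a).g) / √(N a : ℝ)| +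
      |((X a).v j ⬝ᵥ (X a).u) / √(N a : ℝ)| + 3 * (√(N a : ℝ) * b a ^ 2) +
      2 * (scoreSq (X a).Ψ ((X a).ε j) / √(N a : ℝ)) +
      2 * (scoreSq (X a).Ψ (X a).u / √(N a : ℝ))) L (𝓝 0) := by
    have := ((((h.eps_g j).abs.add (h.v_u j).abs).add (h.bias.const_mul 3)).add
      ((h.score_eps j).const_mul 2)).add (h.score_u.const_mul 2)
    simpa using this
  refine squeeze_zero_norm' ?_ hb
  filter_upwards [h.good, h.size_pos] with a ha hn
  have hs := Real.sqrt_pos.2 hn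
  rw [← sub_div, Real.norm_eq_abs, abs_div, abs_of_pos hs, div_le_iff₀ hs]
  refine (ha.abs_score_sub_le j).trans_eq ?_
  rw [abs_div, abs_div, abs_of_pos hs]
  have h2 : (N a : ℝ) = √(N a : ℝ) * √(N a : ℝ) := (Real.mul_self_sqrt hn.le).symm
  have h3 : 3 * ((N a : ℝ) * b a ^ 2) = 3 * (√(N a : ℝ) * b a ^ 2) * √(N a : ℝ) := by
    nth_rw 1 [h2]; ring
  rw [h3]
  field_simp

/-- The second moment matrix of the partialled-out regressors. -/
noncomputable def gramMatrix {n : ℕ} {κ : Type*} (X : Partialled n q κ) :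
    Matrix (Fin q) (Fin q) ℝ :=
  Matrix.of fun j k => (X.r j ⬝ᵥ X.r k) / n

lemma gramMatrix_tendsto (h : PartialledLimits L X C b Z s Φ Om) :
    Tendsto (fun a => gramMatrix (X a)) L (𝓝 Φ) :=
  tendsto_pi_nhds.2 fun j => tendsto_pi_nhds.2 fun k => h.gram_tendsto j k

/-- Determinant and adjugate are polynomial in the entries, and the limiting determinant is nonzero.
-/
lemma _root_.PLVC.tendsto_matrix_inv {A : I → Matrix (Fin q) (Fin q) ℝ}
    (hA : Tendsto A L (𝓝 Φ)) (hΦ : IsUnit Φ.det) :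
    (∀ᶠ a in L, IsUnit (A a).det) ∧ Tendsto (fun a => (A a)⁻¹) L (𝓝 Φ⁻¹) := by
  have hdet : Tendsto (fun a => (A a).det) L (𝓝 Φ.det) :=
    (Continuous.matrix_det continuous_id).tendsto Φ |>.comp hA
  have hadj : Tendsto (fun a => (A a).adjugate) L (𝓝 Φ.adjugate) :=
    (Continuous.matrix_adjugate continuous_id).tendsto Φ |>.comp hA
  have h0 : Φ.det ≠ 0 := hΦ.ne_zero
  refine ⟨?_, ?_⟩
  · filter_upwards [hdet.eventually_ne h0] with a ha
    exact isUnit_iff_ne_zero.2 ha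
  · simp only [Matrix.inv_def, Ring.inverse_eq_inv']
    exact (hdet.inv₀ h0).smul hadj

/-- Asymptotic linearity of the least squares coefficients. -/
theorem linear_tendsto (h : PartialledLimits L X C b Z s Φ Om) (hΦ : IsUnit Φ.det) (j : Fin q) :
    Tendsto (fun a => √(N a : ℝ) * (X a).h j -
      ∑ k, Φ⁻¹ j k * (((X a).ε k ⬝ᵥ (X a).u) / √(N a : ℝ))) L (𝓝 0) := by
  obtain ⟨hu, hinv⟩ := tendsto_matrix_inv h.gramMatrix_tendsto hΦ
  have hent : ∀ k, Tendsto (fun a => (gramMatrix (X a))⁻¹ j k) L (𝓝 (Φ⁻¹ j k)) := fun k =>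
    tendsto_pi_nhds.1 (tendsto_pi_nhds.1 hinv j) k
  -- Replacing the random inverse by `Φ⁻¹` costs a null factor times a tight score.
  have h1 : ∀ k, Tendsto (fun a => ((gramMatrix (X a))⁻¹ j k - Φ⁻¹ j k) *
      (((X a).ε k ⬝ᵥ (X a).u) / √(N a : ℝ))) L (𝓝 0) := fun k =>
    h.tight k _ (by simpa using (hent k).sub_const (Φ⁻¹ j k))
  have h2 : ∀ k, Tendsto (fun a => (gramMatrix (X a))⁻¹ j k *
      (((X a).r k ⬝ᵥ ((X a).u + (X a).g)) / √(N a : ℝ) -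
      ((X a).ε k ⬝ᵥ (X a).u) / √(N a : ℝ))) L (𝓝 0) := fun k => by
    simpa using (hent k).mul (h.score_tendsto k)
  have h3 := tendsto_finsetSum Finset.univ fun k _ => (h1 k).add (h2 k)
  simp only [add_zero, Finset.sum_const_zero] at h3
  refine h3.congr' ?_
  filter_upwards [h.good, h.size_pos, hu] with a ha hn hdet
  have hs := Real.sqrt_pos.2 hn
  have hsol : gramMatrix (X a) *ᵥ (fun k => √(N a : ℝ) * (X a).h k) =
      fun k => ((X a).r k ⬝ᵥ ((X a).u + (X a).g)) / √(N a : ℝ) := by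
    ext k
    rw [← ha.normal k, Finset.sum_div]
    simp only [Matrix.mulVec, dotProduct, gramMatrix, Matrix.of_apply]
    refine Finset.sum_congr rfl fun l _ => ?_
    have h2 : (N a : ℝ) = √(N a : ℝ) * √(N a : ℝ) := (Real.mul_self_sqrt hn.le).symm
    nth_rw 1 [h2]
    field_simp
  have hsol' := congrArg (fun t => ((gramMatrix (X a))⁻¹ *ᵥ t) j) hsol
  simp only [Matrix.mulVec_mulVec, Matrix.nonsing_inv_mul _ hdet, Matrix.one_mulVec] at hsol'
  rw [hsol']
  simp only [Matrix.mulVec, dotProduct]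
  rw [← Finset.sum_sub_distrib]
  refine Finset.sum_congr rfl fun k _ => ?_
  ring

/-- `√N h` inherits tightness from the scores by asymptotic linearity; hence `h² = O(1/N)` in
probability. -/
lemma tight_h (h : PartialledLimits L X C b Z s Φ Om) (hΦ : IsUnit Φ.det) (j : Fin q)
    {A : I → ℝ} (hA : Tendsto A L (𝓝 0)) :
    Tendsto (fun a => A a * (√(N a : ℝ) * (X a).h j)) L (𝓝 0) := by
  have h1 := hA.mul (h.linear_tendsto hΦ j)
  have h2 := tendsto_finsetSum Finset.univ fun k _ => (h.tight k A hA).const_mul (Φ⁻¹ j k)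
  have h3 := h1.add h2
  simp only [mul_zero, Finset.sum_const_zero, add_zero] at h3
  refine h3.congr fun a => ?_
  rw [mul_sub, Finset.mul_sum, add_comm_sub, add_eq_left, sub_eq_zero]
  exact Finset.sum_congr rfl fun k _ => by ring

/-- The summand `2 Z b²` of `rBound` has no useful bound of its own. It is absorbed by `h² =
O(1/N)`: tightness of `√N h` is used with the null factor `√(Z b² / N)` and the product is squared.
-/
lemma rBound_tendsto_mul (h : PartialledLimits L X C b Z s Φ Om) (hΦ : IsUnit Φ.det) :
    Tendsto (fun a => (∑ k, (X a).h k ^ 2) * ∑ k, Good.rBound (X a) C (b a) (Z a) k) L (𝓝 0) := by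
  have h0 : ∀ k, Tendsto (fun a => (X a).h k ^ 2) L (𝓝 0) := by
    intro k
    have := (h.tight_h hΦ k h.tendsto_inv_sqrt_size).pow 2
    simp only [ne_eq, OfNat.ofNat_ne_zero, not_false_eq_true, zero_pow] at this
    refine this.congr' ?_
    filter_upwards [h.size_pos] with a hn
    have := Real.sqrt_pos.2 hn
    rw [inv_mul_cancel_left₀ this.ne']
  have hZ : Tendsto (fun a => √(Z a * b a ^ 2 / N a)) L (𝓝 0) := by
    have := (h.sup.mul h.b_sq).sqrt
    rw [mul_zero, Real.sqrt_zero] at this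
    refine this.congr fun a => ?_
    congr 1; ring
  have h1 : ∀ k, Tendsto (fun a => (X a).h k ^ 2 * (Z a * b a ^ 2)) L (𝓝 0) := by
    intro k
    have := (h.tight_h hΦ k hZ).pow 2
    simp only [ne_eq, OfNat.ofNat_ne_zero, not_false_eq_true, zero_pow] at this
    refine this.congr' ?_
    filter_upwards [h.size_pos, h.good] with a hn ha
    have hZ0 := ha.Z_nonneg
    rw [mul_pow, mul_pow, Real.sq_sqrt (by positivity), Real.sq_sqrt hn.le]
    field_simp
  have h2 : ∀ k l, Tendsto (fun a => (X a).h k ^ 2 * Good.rBound (X a) C (b a) (Z a) l) L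
      (𝓝 0) := by
    intro k l
    have h3 := ((h0 k).mul ((h.b_sq.const_add (C ^ 2)).add
      ((h.sup_score_eps l).const_mul 4))).add ((h1 k).const_mul 2)
    have h4 := h3.const_mul 4
    simp only [zero_mul, mul_zero, add_zero] at h4
    refine h4.congr fun a => ?_
    unfold Good.rBound
    ring
  have h3 := tendsto_finsetSum Finset.univ fun k _ =>
    tendsto_finsetSum (Finset.univ : Finset (Fin q)) fun l _ => h2 k l
  simp only [Finset.sum_const_zero] at h3
  refine h3.congr fun a => ?_
  rw [Finset.sum_mul_sum]

lemma score_error_tendsto (h : PartialledLimits L X C b Z s Φ Om) (hΦ : IsUnit Φ.det)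
    (j : Fin q) :
    Tendsto (fun a => (∑ i, ((X a).uhat i * (X a).r j i - (X a).u i * (X a).ε j i) ^ 2) / N a) L
      (𝓝 0) := by
  -- The rates combine as `Z b⁴ = (Z/N)(√N b²)²`.
  have hZb : Tendsto (fun a => Z a * b a ^ 2 * b a ^ 2) L (𝓝 0) := by
    have := h.sup.mul (h.bias.pow 2)
    simp only [ne_eq, OfNat.ofNat_ne_zero, not_false_eq_true, zero_pow, mul_zero] at this
    refine this.congr' ?_
    filter_upwards [h.size_pos] with a hn
    rw [mul_pow, Real.sq_sqrt hn.le]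
    field_simp
  have hrb : Tendsto (fun a => Good.rBound (X a) C (b a) (Z a) j * b a ^ 2) L (𝓝 0) := by
    have h3 := (((h.b_sq.const_add (C ^ 2)).add
      ((h.sup_score_eps j).const_mul 4)).mul h.b_sq).add (hZb.const_mul 2)
    have h4 := h3.const_mul 4
    simp only [mul_zero, add_zero] at h4
    refine h4.congr fun a => ?_
    unfold Good.rBound
    ring
  have hlim := ((((h.b_sq.add ((h.sup_score_eps j).const_mul 4)).const_mul 6).mul h.u_sq).add
    (h.weight.const_mul 12)).add (((((h.b_sq.add (h.sup_score_u.const_mul 4)).add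
      (h.rBound_tendsto_mul hΦ)).mul ((h.b_sq.const_add (C ^ 2)).const_mul 2)).add
      hrb).const_mul 8)
  simp only [mul_zero, add_zero, zero_mul] at hlim
  refine squeeze_zero' (Eventually.of_forall fun a => by positivity) ?_ hlim
  filter_upwards [h.good] with a ha
  exact ha.sum_sq_score_error_le h.C_nonneg j

/-- The estimated second moment matrix of the scores converges. -/
theorem omega_tendsto (h : PartialledLimits L X C b Z s Φ Om) (hΦ : IsUnit Φ.det)
    (j k : Fin q) :
    Tendsto (fun a => (∑ i, (X a).uhat i ^ 2 * ((X a).r j i * (X a).r k i)) / N a) L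
      (𝓝 (Om j k)) := by
  set B : (a : I) → Fin q → Fin (N a) → ℝ := fun a j i => (X a).u i * (X a).ε j i with hB
  set D : (a : I) → Fin q → Fin (N a) → ℝ :=
    fun a j i => (X a).uhat i * (X a).r j i - B a j i with hD
  have hDD : ∀ l, Tendsto (fun a => (D a l ⬝ᵥ D a l) / N a) L (𝓝 0) := fun l =>
    (h.score_error_tendsto hΦ l).congr fun a => by simp [dotProduct, hD, hB, sq]
  have hBB : ∀ l, Tendsto (fun a => (B a l ⬝ᵥ B a l) / N a) L (𝓝 (Om l l)) := fun l =>
    (h.score_score l l).congr fun a => by simp [dotProduct, hB]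
  -- Cauchy–Schwarz: a part with vanishing mean square is negligible against a part with convergent
  -- mean square. It disposes of the cross terms of `(B_j + D_j)(B_k + D_k)`.
  have hcross : ∀ {S T : (a : I) → Fin (N a) → ℝ} {c : ℝ},
      Tendsto (fun a => (S a ⬝ᵥ S a) / N a) L (𝓝 0) →
      Tendsto (fun a => (T a ⬝ᵥ T a) / N a) L (𝓝 c) →
      Tendsto (fun a => (S a ⬝ᵥ T a) / N a) L (𝓝 0) := by
    intro S T c hS hT
    have h1 := (hS.mul hT).sqrt
    rw [zero_mul, Real.sqrt_zero] at h1
    refine squeeze_zero_norm (fun a => ?_) h1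
    rw [Real.norm_eq_abs]
    refine Real.abs_le_sqrt ?_
    rw [div_pow, div_mul_div_comm, ← sq (N a : ℝ)]
    exact div_le_div_of_nonneg_right (dotProduct_sq_le _ _) (sq_nonneg _)
  have h1 := ((hcross (hDD j) (hDD k)).add (hcross (hDD j) (hBB k))).add
    ((hcross (hDD k) (hBB j)).add (h.score_score j k))
  simp only [zero_add] at h1
  refine h1.congr fun a => ?_
  rw [← add_div, ← add_div, ← add_div]
  congr 1
  simp only [dotProduct, ← Finset.sum_add_distrib]
  refine Finset.sum_congr rfl fun i _ => ?_
  simp only [hD, hB]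
  ring

end PartialledLimits

end Limits


/-! ### Stochastic inputs: sample regressions satisfy the limit relations -/

section SampleLimits

open Partialled

variable {Ω : Type*} [MeasurableSpace Ω] {μ : Measure Ω} [IsProbabilityMeasure μ]
  {E : Type*} [MeasurableSpace E] {q : ℕ} {κ : ℕ → Type*}

/-- Population quantities of a partialled-out regression: linear regressors `eps`, error `u`,
approximation errors `v` and `g`, series terms `ψ`. -/
structure SeriesPopulation (E : Type*) (q : ℕ) (κ : ℕ → Type*) where
  eps : Fin q → E → ℝ
  u : E → ℝ
  v : ℕ → Fin q → E → ℝ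
  g : ℕ → E → ℝ
  ψ : (n : ℕ) → κ n → E → ℝ

/-- The partialled-out regression of a sample. -/
def SeriesPopulation.sample (D : SeriesPopulation E q κ) (ξ : ℕ → Ω → E)
    (M : (n : ℕ) → Ω → Matrix (Fin n) (Fin n) ℝ) (h : ℕ → Ω → Fin q → ℝ) (a : ℕ × Ω) :
    Partialled a.1 q (κ a.1) where
  ε j i := D.eps j (ξ i a.2)
  v j i := D.v a.1 j (ξ i a.2)
  u i := D.u (ξ i a.2)
  g i := D.g a.1 (ξ i a.2)
  Ψ := Matrix.of fun i l => D.ψ a.1 l (ξ i a.2)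
  M := M a.1 a.2
  h := h a.1 a.2

variable [∀ n, Fintype (κ n)] [∀ n, DecidableEq (κ n)]

/-- Moment conditions and rates under which the sample regressions satisfy `PartialledLimits`. -/
structure SeriesPopulation.Regular (D : SeriesPopulation E q κ) (μ : Measure Ω) (ξ₀ : Ω → E)
    (S : Set E) (C Cσ : ℝ) (b Z : ℕ → ℝ) : Prop where
  C_nonneg : 0 ≤ C
  Cσ_nonneg : 0 ≤ Cσ
  Z_nonneg : ∀ n, 0 ≤ Z n
  mem_ae : ∀ᵐ ω ∂μ, ξ₀ ω ∈ S
  eps_meas : ∀ j, Measurable (D.eps j)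
  u_meas : Measurable D.u
  v_meas : ∀ n j, Measurable (D.v n j)
  g_meas : ∀ n, Measurable (D.g n)
  ψ_meas : ∀ n a, Measurable (D.ψ n a)
  u_memLp : MemLp (fun ω => D.u (ξ₀ ω)) 2 μ
  eps_le : ∀ j, ∀ e ∈ S, |D.eps j e| ≤ C
  v_le : ∀ n j, ∀ e ∈ S, |D.v n j e| ≤ b n
  g_le : ∀ n, ∀ e ∈ S, |D.g n e| ≤ b n
  ψ_le : ∀ n, ∀ e ∈ S, ∑ a, D.ψ n a e ^ 2 ≤ Z n
  eps_ψ : ∀ n j a, ∫ ω, D.ψ n a (ξ₀ ω) * D.eps j (ξ₀ ω) ∂μ = 0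
  u_ψ : ∀ n a, ∫ ω, D.ψ n a (ξ₀ ω) * D.u (ξ₀ ω) ∂μ = 0
  eps_g : ∀ n j, ∫ ω, D.eps j (ξ₀ ω) * D.g n (ξ₀ ω) ∂μ = 0
  v_u : ∀ n j, ∫ ω, D.v n j (ξ₀ ω) * D.u (ξ₀ ω) ∂μ = 0
  eps_u : ∀ j, ∫ ω, D.eps j (ξ₀ ω) * D.u (ξ₀ ω) ∂μ = 0
  ψ_ψ : ∀ n a l, ∫ ω, D.ψ n a (ξ₀ ω) * D.ψ n l (ξ₀ ω) ∂μ = (1 : Matrix (κ n) (κ n) ℝ) a l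
  ψ_u_sq : ∀ n a, ∫ ω, (D.ψ n a (ξ₀ ω) * D.u (ξ₀ ω)) ^ 2 ∂μ ≤
    Cσ * ∫ ω, D.ψ n a (ξ₀ ω) ^ 2 ∂μ
  v_u_sq : ∀ n j, ∫ ω, (D.v n j (ξ₀ ω) * D.u (ξ₀ ω)) ^ 2 ∂μ ≤
    Cσ * ∫ ω, D.v n j (ξ₀ ω) ^ 2 ∂μ
  bias : Tendsto (fun n : ℕ => √(n : ℝ) * b n ^ 2) atTop (𝓝 0)
  sup : Tendsto (fun n : ℕ => Z n / n) atTop (𝓝 0)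
  dim : Tendsto (fun n : ℕ => (Fintype.card (κ n) : ℝ) / √(n : ℝ)) atTop (𝓝 0)
  sup_dim : Tendsto (fun n : ℕ => Z n * Fintype.card (κ n) / n) atTop (𝓝 0)

namespace SeriesPopulation.Regular

variable {D : SeriesPopulation E q κ} {ξ : ℕ → Ω → E} {S : Set E} {C Cσ : ℝ} {b Z : ℕ → ℝ}

omit [IsProbabilityMeasure μ] in
lemma ψ_sq_le (h : D.Regular μ (ξ 0) S C Cσ b Z) (n : ℕ) (a : κ n) {e : E} (he : e ∈ S) :
    D.ψ n a e ^ 2 ≤ Z n :=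
  (Finset.single_le_sum (f := fun a => D.ψ n a e ^ 2) (fun _ _ => sq_nonneg _)
    (Finset.mem_univ a)).trans (h.ψ_le n e he)

lemma memLp_ψ (h : D.Regular μ (ξ 0) S C Cσ b Z) (hξ : Measurable (ξ 0)) (n : ℕ) (a : κ n)
    (p : ENNReal) : MemLp (fun ω => D.ψ n a (ξ 0 ω)) p μ := by
  refine MemLp.of_bound ((h.ψ_meas n a).comp hξ).aestronglyMeasurable (√(Z n)) ?_
  filter_upwards [h.mem_ae] with ω hω
  exact Real.abs_le_sqrt (h.ψ_sq_le n a hω)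

omit [IsProbabilityMeasure μ] in
lemma integral_ψ_sq (h : D.Regular μ (ξ 0) S C Cσ b Z) (n : ℕ) (a : κ n) :
    ∫ ω, D.ψ n a (ξ 0 ω) ^ 2 ∂μ = 1 := by
  simp_rw [sq, h.ψ_ψ n a a, Matrix.one_apply_eq]

omit [IsProbabilityMeasure μ] in
lemma memLp_bdd_mul {T : E → ℝ} (hT : Measurable T) (hξ : Measurable (ξ 0)) {B : ℝ}
    (hS : ∀ᵐ ω ∂μ, ξ 0 ω ∈ S) (hB : ∀ e ∈ S, |T e| ≤ B) {U : E → ℝ}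
    (hU : MemLp (fun ω => U (ξ 0 ω)) 2 μ) : MemLp (fun ω => T (ξ 0 ω) * U (ξ 0 ω)) 2 μ := by
  refine hU.of_le_mul (c := B) ((hT.comp hξ).aestronglyMeasurable.mul hU.1) ?_
  filter_upwards [hS] with ω hω
  rw [norm_mul]
  exact mul_le_mul_of_nonneg_right (hB _ hω) (norm_nonneg _)

omit [IsProbabilityMeasure μ] in
lemma memLp_ψ_mul (h : D.Regular μ (ξ 0) S C Cσ b Z) (hξ : Measurable (ξ 0)) (n : ℕ) (a : κ n)
    {U : E → ℝ} (hU : MemLp (fun ω => U (ξ 0 ω)) 2 μ) :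
    MemLp (fun ω => D.ψ n a (ξ 0 ω) * U (ξ 0 ω)) 2 μ :=
  memLp_bdd_mul (h.ψ_meas n a) hξ h.mem_ae
    (fun _ he => Real.abs_le_sqrt (h.ψ_sq_le n a he)) hU

lemma memLp_eps (h : D.Regular μ (ξ 0) S C Cσ b Z) (hξ : Measurable (ξ 0)) (j : Fin q)
    (p : ENNReal) : MemLp (fun ω => D.eps j (ξ 0 ω)) p μ := by
  refine MemLp.of_bound ((h.eps_meas j).comp hξ).aestronglyMeasurable C ?_
  filter_upwards [h.mem_ae] with ω hω
  exact h.eps_le j _ hω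

omit [IsProbabilityMeasure μ] in
lemma memLp_eps_u (h : D.Regular μ (ξ 0) S C Cσ b Z) (hξ : Measurable (ξ 0)) (j : Fin q) :
    MemLp (fun ω => D.eps j (ξ 0 ω) * D.u (ξ 0 ω)) 2 μ :=
  memLp_bdd_mul (h.eps_meas j) hξ h.mem_ae (h.eps_le j) h.u_memLp

lemma sum_integral_ψ_eps_le (h : D.Regular μ (ξ 0) S C Cσ b Z) (hξ : Measurable (ξ 0)) (n : ℕ)
    (j : Fin q) : ∑ a, ∫ ω, (D.ψ n a (ξ 0 ω) * D.eps j (ξ 0 ω)) ^ 2 ∂μ ≤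
      C ^ 2 * Fintype.card (κ n) := by
  refine (Finset.sum_le_card_nsmul _ _ (C ^ 2) fun a _ => ?_).trans (by simp [mul_comm])
  calc ∫ ω, (D.ψ n a (ξ 0 ω) * D.eps j (ξ 0 ω)) ^ 2 ∂μ
      ≤ ∫ ω, C ^ 2 * D.ψ n a (ξ 0 ω) ^ 2 ∂μ := by
        refine integral_mono_ae (h.memLp_ψ_mul hξ n a (h.memLp_eps hξ j 2)).integrable_sq
          ((h.memLp_ψ hξ n a 2).integrable_sq.const_mul _) ?_
        filter_upwards [h.mem_ae] with ω hω
        rw [mul_pow, mul_comm]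
        refine mul_le_mul_of_nonneg_right ?_ (sq_nonneg _)
        exact sq_le_sq.2 ((h.eps_le j _ hω).trans (le_abs_self _))
    _ = C ^ 2 := by rw [integral_const_mul, h.integral_ψ_sq, mul_one]

omit [IsProbabilityMeasure μ] in
lemma sum_integral_ψ_u_le (h : D.Regular μ (ξ 0) S C Cσ b Z) (n : ℕ) :
    ∑ a, ∫ ω, (D.ψ n a (ξ 0 ω) * D.u (ξ 0 ω)) ^ 2 ∂μ ≤ Cσ * Fintype.card (κ n) := by
  refine (Finset.sum_le_card_nsmul _ _ Cσ fun a _ => ?_).trans (by simp [mul_comm])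
  simpa [h.integral_ψ_sq n a] using h.ψ_u_sq n a

omit [MeasurableSpace Ω] [MeasurableSpace E] [∀ n, DecidableEq (κ n)] in
lemma scoreSq_sample (M : (n : ℕ) → Ω → Matrix (Fin n) (Fin n) ℝ) (hh : ℕ → Ω → Fin q → ℝ)
    (a : ℕ × Ω) (T : E → ℝ) :
    scoreSq (D.sample ξ M hh a).Ψ (fun i => T (ξ i a.2)) =
      (∑ l, (∑ i : Fin a.1, D.ψ a.1 l (ξ i a.2) * T (ξ i a.2)) ^ 2) / (a.1 : ℝ) := by
  simp [scoreSq, SeriesPopulation.sample, Matrix.mulVec, dotProduct, sq]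

lemma tendsto_sqrt_inv_mul {K : ℕ → ℝ} {B : ℝ}
    (hK : Tendsto (fun n : ℕ => K n / √(n : ℝ)) atTop (𝓝 0)) :
    Tendsto (fun n : ℕ => (√(n : ℝ))⁻¹ * (B * K n)) atTop (𝓝 0) := by
  have := hK.const_mul B
  rw [mul_zero] at this
  exact this.congr fun n => by ring

omit [IsProbabilityMeasure μ] in
lemma b_sq (h : D.Regular μ (ξ 0) S C Cσ b Z) : Tendsto (fun n => b n ^ 2) atTop (𝓝 0) := by
  have h0 : Tendsto (fun n : ℕ => (√(n : ℝ))⁻¹) atTop (𝓝 0) :=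
    tendsto_inv_atTop_zero.comp (Real.tendsto_sqrt_atTop.comp tendsto_natCast_atTop_atTop)
  have h1 := h0.mul h.bias
  rw [zero_mul] at h1
  refine h1.congr' ?_
  filter_upwards [eventually_gt_atTop 0] with n hn
  have : 0 < √(n : ℝ) := Real.sqrt_pos.2 (by exact_mod_cast hn)
  field_simp

omit [IsProbabilityMeasure μ] in
lemma b_sq_dim (h : D.Regular μ (ξ 0) S C Cσ b Z) :
    Tendsto (fun n => b n ^ 2 * Fintype.card (κ n)) atTop (𝓝 0) := by
  have h1 := h.bias.mul h.dim
  rw [zero_mul] at h1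
  refine h1.congr' ?_
  filter_upwards [eventually_gt_atTop 0] with n hn
  have : 0 < √(n : ℝ) := Real.sqrt_pos.2 (by exact_mod_cast hn)
  field_simp

/-- The entries are centered averages, so the mean of `gramError` is at most `n⁻¹ ∑ E[ψ_a² ψ_l²] =
n⁻¹ E[(∑ ψ_a²)²]`. One factor `∑ ψ_a²` is at most `Z`, and the other has mean `K`, which gives
`ZK/n`. -/
lemma gramError_tendsto (h : D.Regular μ (ξ 0) S C Cσ b Z) (hindep : iIndepFun ξ μ)
    (hident : ∀ i, IdentDistrib (ξ i) (ξ 0) μ μ) (hξ : Measurable (ξ 0))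
    (M : (n : ℕ) → Ω → Matrix (Fin n) (Fin n) ℝ) (hh : ℕ → Ω → Fin q → ℝ) :
    Tendsto (fun a => gramError (D.sample ξ M hh a).Ψ) (probFilter μ) (𝓝 0) := by
  have hT := tendsto_probFilter_sum_sq hindep hident (ι := fun n => κ n × κ n)
    (T := fun n x e => D.ψ n x.1 e * D.ψ n x.2 e - (1 : Matrix (κ n) (κ n) ℝ) x.1 x.2)
    (fun n x => ((h.ψ_meas n x.1).mul (h.ψ_meas n x.2)).sub_const _)
    (fun n x => (h.memLp_ψ_mul hξ n x.1 (h.memLp_ψ hξ n x.2 2)).sub (memLp_const _))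
    (fun n x => ?_) (c := fun n => (n : ℝ)⁻¹) (fun n => by positivity)
    (ρ := fun n => Z n * Fintype.card (κ n) / n) (fun n => ?_) h.sup_dim
  · refine hT.congr' ?_
    filter_upwards [tendsto_fst_probFilter.eventually (eventually_gt_atTop 0)] with a ha
    have ha' : (0 : ℝ) < a.1 := by exact_mod_cast ha
    rw [gramError, Fintype.sum_prod_type, Finset.sum_div, Finset.mul_sum]
    refine Finset.sum_congr rfl fun k _ => ?_
    rw [Finset.sum_div, Finset.mul_sum]
    refine Finset.sum_congr rfl fun l _ => ?_
    simp only [SeriesPopulation.sample, Matrix.mul_apply, Matrix.transpose_apply, Matrix.of_apply,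
      Finset.sum_sub_distrib, Finset.sum_const, Finset.card_univ, Fintype.card_fin, nsmul_eq_mul]
    field_simp
  · rw [integral_sub ((h.memLp_ψ_mul hξ n x.1 (h.memLp_ψ hξ n x.2 2)).integrable (by norm_num))
      (integrable_const _), h.ψ_ψ]
    simp
  · have hle : ∀ x : κ n × κ n, ∫ ω, (D.ψ n x.1 (ξ 0 ω) * D.ψ n x.2 (ξ 0 ω) -
        (1 : Matrix (κ n) (κ n) ℝ) x.1 x.2) ^ 2 ∂μ ≤
        ∫ ω, (D.ψ n x.1 (ξ 0 ω) * D.ψ n x.2 (ξ 0 ω)) ^ 2 ∂μ := by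
      intro x
      have hL := h.memLp_ψ_mul hξ n x.1 (h.memLp_ψ hξ n x.2 2)
      rw [← h.ψ_ψ n x.1 x.2, ← variance_eq_integral hL.1.aemeasurable]
      exact variance_le_expectation_sq hL.1
    have hsum : ∑ x : κ n × κ n, ∫ ω, (D.ψ n x.1 (ξ 0 ω) * D.ψ n x.2 (ξ 0 ω)) ^ 2 ∂μ ≤
        Z n * Fintype.card (κ n) := by
      rw [← integral_finsetSum _ fun x _ =>
        (h.memLp_ψ_mul hξ n x.1 (h.memLp_ψ hξ n x.2 2)).integrable_sq]
      calc ∫ ω, ∑ x : κ n × κ n, (D.ψ n x.1 (ξ 0 ω) * D.ψ n x.2 (ξ 0 ω)) ^ 2 ∂μ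
          ≤ ∫ ω, Z n * ∑ l, D.ψ n l (ξ 0 ω) ^ 2 ∂μ := by
            refine integral_mono_ae (integrable_finsetSum _ fun x _ =>
              (h.memLp_ψ_mul hξ n x.1 (h.memLp_ψ hξ n x.2 2)).integrable_sq)
              ((integrable_finsetSum _ fun l _ =>
                (h.memLp_ψ hξ n l 2).integrable_sq).const_mul _) ?_
            filter_upwards [h.mem_ae] with ω hω
            simp only [mul_pow, Fintype.sum_prod_type]
            rw [← Finset.sum_mul_sum]
            exact mul_le_mul_of_nonneg_right (h.ψ_le n _ hω)
              (Finset.sum_nonneg fun _ _ => sq_nonneg _)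
        _ = Z n * Fintype.card (κ n) := by
            rw [integral_const_mul, integral_finsetSum _ fun l _ =>
              (h.memLp_ψ hξ n l 2).integrable_sq]
            simp [h.integral_ψ_sq]
    rw [div_eq_inv_mul]
    exact mul_le_mul_of_nonneg_left ((Finset.sum_le_sum fun x _ => hle x).trans hsum)
      (by positivity)

lemma tendsto_sum_div_sqrt (hindep : iIndepFun ξ μ)
    (hident : ∀ i, IdentDistrib (ξ i) (ξ 0) μ μ) {T : ℕ → E → ℝ} (hT : ∀ n, Measurable (T n))
    (hL2 : ∀ n, MemLp (fun ω => T n (ξ 0 ω)) 2 μ) (hmean : ∀ n, ∫ ω, T n (ξ 0 ω) ∂μ = 0)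
    {ρ : ℕ → ℝ} (hρ : ∀ n, ∫ ω, T n (ξ 0 ω) ^ 2 ∂μ ≤ ρ n) (hρ0 : Tendsto ρ atTop (𝓝 0)) :
    Tendsto (fun a : ℕ × Ω => (∑ i : Fin a.1, T a.1 (ξ i a.2)) / √(a.1 : ℝ)) (probFilter μ)
      (𝓝 0) := by
  have h := tendsto_probFilter_sum_sq hindep hident (ι := fun _ => Unit)
    (T := fun n _ => T n) (fun n _ => hT n) (fun n _ => hL2 n) (fun n _ => hmean n)
    (c := fun _ => 1) (fun _ => zero_le_one) (ρ := ρ) (by simpa using hρ) hρ0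
  have h2 := h.sqrt
  rw [Real.sqrt_zero] at h2
  refine squeeze_zero_norm (fun a => ?_) h2
  refine Real.abs_le_sqrt ?_
  rw [div_pow, Real.sq_sqrt (Nat.cast_nonneg _)]
  simp

/-- Because `ψ_a ε_j` has mean zero, `scoreSq` has mean `∑ E[(ψ_a ε_j)²] ≤ C² K`, and `K = o(√n)`.
-/
lemma tendsto_score_eps (h : D.Regular μ (ξ 0) S C Cσ b Z) (hindep : iIndepFun ξ μ)
    (hident : ∀ i, IdentDistrib (ξ i) (ξ 0) μ μ) (hξ : Measurable (ξ 0))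
    (M : (n : ℕ) → Ω → Matrix (Fin n) (Fin n) ℝ) (hh : ℕ → Ω → Fin q → ℝ) (j : Fin q) :
    Tendsto (fun a => scoreSq (D.sample ξ M hh a).Ψ ((D.sample ξ M hh a).ε j) / √(a.1 : ℝ))
      (probFilter μ) (𝓝 0) := by
  refine (tendsto_probFilter_sum_sq hindep hident (ι := κ)
    (T := fun n l e => D.ψ n l e * D.eps j e)
    (fun n l => (h.ψ_meas n l).mul (h.eps_meas j))
    (fun n l => h.memLp_ψ_mul hξ n l (h.memLp_eps hξ j 2)) (fun n l => h.eps_ψ n j l)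
    (c := fun n => (√(n : ℝ))⁻¹) (fun n => by positivity)
    (ρ := fun n => (√(n : ℝ))⁻¹ * (C ^ 2 * Fintype.card (κ n)))
    (fun n => mul_le_mul_of_nonneg_left (h.sum_integral_ψ_eps_le hξ n j) (by positivity))
    (tendsto_sqrt_inv_mul h.dim)).congr fun a => ?_
  rw [div_eq_inv_mul (scoreSq _ _)]
  exact congrArg _ (scoreSq_sample M hh a (D.eps j)).symm

/-- As for `ε`, with the bounded conditional variance of `u` in place of a bound on `u` itself. -/
lemma tendsto_score_u (h : D.Regular μ (ξ 0) S C Cσ b Z) (hindep : iIndepFun ξ μ)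
    (hident : ∀ i, IdentDistrib (ξ i) (ξ 0) μ μ) (hξ : Measurable (ξ 0))
    (M : (n : ℕ) → Ω → Matrix (Fin n) (Fin n) ℝ) (hh : ℕ → Ω → Fin q → ℝ)  :
    Tendsto (fun a => scoreSq (D.sample ξ M hh a).Ψ (D.sample ξ M hh a).u / √(a.1 : ℝ))
      (probFilter μ) (𝓝 0) := by
  refine (tendsto_probFilter_sum_sq hindep hident (ι := κ)
    (T := fun n l e => D.ψ n l e * D.u e)
    (fun n l => (h.ψ_meas n l).mul h.u_meas)
    (fun n l => h.memLp_ψ_mul hξ n l h.u_memLp) (fun n l => h.u_ψ n l)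
    (c := fun n => (√(n : ℝ))⁻¹) (fun n => by positivity)
    (ρ := fun n => (√(n : ℝ))⁻¹ * (Cσ * Fintype.card (κ n)))
    (fun n => mul_le_mul_of_nonneg_left (h.sum_integral_ψ_u_le n) (by positivity))
    (tendsto_sqrt_inv_mul h.dim)).congr fun a => ?_
  rw [div_eq_inv_mul (scoreSq _ _)]
  exact congrArg _ (scoreSq_sample M hh a D.u).symm

/-- The mean `O(K)` of the score is now weighted by `Z/n`, the scale of the uniform bound on the
entries of `M ε_j`. -/
lemma tendsto_sup_score_eps (h : D.Regular μ (ξ 0) S C Cσ b Z) (hindep : iIndepFun ξ μ)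
    (hident : ∀ i, IdentDistrib (ξ i) (ξ 0) μ μ) (hξ : Measurable (ξ 0))
    (M : (n : ℕ) → Ω → Matrix (Fin n) (Fin n) ℝ) (hh : ℕ → Ω → Fin q → ℝ) (j : Fin q) :
    Tendsto (fun a => Z a.1 * scoreSq (D.sample ξ M hh a).Ψ ((D.sample ξ M hh a).ε j) / a.1)
      (probFilter μ) (𝓝 0) := by
  have hlim := h.sup_dim.const_mul (C ^ 2)
  rw [mul_zero] at hlim
  refine (tendsto_probFilter_sum_sq hindep hident (ι := κ)
    (T := fun n l e => D.ψ n l e * D.eps j e)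
    (fun n l => (h.ψ_meas n l).mul (h.eps_meas j))
    (fun n l => h.memLp_ψ_mul hξ n l (h.memLp_eps hξ j 2)) (fun n l => h.eps_ψ n j l)
    (c := fun n => Z n / n) (fun n => div_nonneg (h.Z_nonneg n) (Nat.cast_nonneg n))
    (ρ := fun n => C ^ 2 * (Z n * Fintype.card (κ n) / n))
    (fun n => (mul_le_mul_of_nonneg_left (h.sum_integral_ψ_eps_le hξ n j)
      (div_nonneg (h.Z_nonneg n) (Nat.cast_nonneg n))).trans_eq (by ring))
    hlim).congr fun a => ?_
  rw [mul_div_right_comm]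
  exact congrArg _ (scoreSq_sample M hh a (D.eps j)).symm

lemma tendsto_sup_score_u (h : D.Regular μ (ξ 0) S C Cσ b Z) (hindep : iIndepFun ξ μ)
    (hident : ∀ i, IdentDistrib (ξ i) (ξ 0) μ μ) (hξ : Measurable (ξ 0))
    (M : (n : ℕ) → Ω → Matrix (Fin n) (Fin n) ℝ) (hh : ℕ → Ω → Fin q → ℝ)  :
    Tendsto (fun a => Z a.1 * scoreSq (D.sample ξ M hh a).Ψ (D.sample ξ M hh a).u / a.1)
      (probFilter μ) (𝓝 0) := by
  have hlim := h.sup_dim.const_mul Cσ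
  rw [mul_zero] at hlim
  refine (tendsto_probFilter_sum_sq hindep hident (ι := κ)
    (T := fun n l e => D.ψ n l e * D.u e)
    (fun n l => (h.ψ_meas n l).mul h.u_meas)
    (fun n l => h.memLp_ψ_mul hξ n l h.u_memLp) (fun n l => h.u_ψ n l)
    (c := fun n => Z n / n) (fun n => div_nonneg (h.Z_nonneg n) (Nat.cast_nonneg n))
    (ρ := fun n => Cσ * (Z n * Fintype.card (κ n) / n))
    (fun n => (mul_le_mul_of_nonneg_left (h.sum_integral_ψ_u_le n)
      (div_nonneg (h.Z_nonneg n) (Nat.cast_nonneg n))).trans_eq (by ring))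
    hlim).congr fun a => ?_
  rw [mul_div_right_comm]
  exact congrArg _ (scoreSq_sample M hh a D.u).symm

omit [IsProbabilityMeasure μ] in
-- The average of `u² ∑ ψ_a²` has mean at most `Cσ K`, and `b² K = (√n b²)(K/√n) → 0`.
lemma tendsto_weight (h : D.Regular μ (ξ 0) S C Cσ b Z) (hident : ∀ i, IdentDistrib (ξ i) (ξ 0) μ μ) (hξ : Measurable (ξ 0))
    (M : (n : ℕ) → Ω → Matrix (Fin n) (Fin n) ℝ) (hh : ℕ → Ω → Fin q → ℝ)  :
    Tendsto (fun a => b a.1 ^ 2 * ((∑ i, (D.sample ξ M hh a).u i ^ 2 *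
      ((D.sample ξ M hh a).Ψ i ⬝ᵥ (D.sample ξ M hh a).Ψ i)) / a.1)) (probFilter μ) (𝓝 0) := by
  have hlim := h.b_sq_dim.const_mul Cσ
  rw [mul_zero] at hlim
  have hint : ∀ n, Integrable (fun ω => ∑ l, (D.ψ n l (ξ 0 ω) * D.u (ξ 0 ω)) ^ 2) μ :=
    fun n => integrable_finsetSum _ fun l _ => (h.memLp_ψ_mul hξ n l h.u_memLp).integrable_sq
  refine (tendsto_probFilter_mul_average hident
    (T := fun n e => ∑ l, (D.ψ n l e * D.u e) ^ 2)
    (fun n => Finset.measurable_fun_sum _ fun l _ => ((h.ψ_meas n l).mul h.u_meas).pow_const 2)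
    (fun n e => Finset.sum_nonneg fun _ _ => sq_nonneg _) hint
    (c := fun n => b n ^ 2) (fun n => sq_nonneg _)
    (ρ := fun n => Cσ * (b n ^ 2 * Fintype.card (κ n))) (fun n => ?_) hlim).congr fun a => ?_
  · rw [integral_finsetSum _ fun l _ => (h.memLp_ψ_mul hξ n l h.u_memLp).integrable_sq]
    exact (mul_le_mul_of_nonneg_left (h.sum_integral_ψ_u_le n) (sq_nonneg _)).trans_eq (by ring)
  · congr 2
    refine Finset.sum_congr rfl fun i _ => ?_
    simp only [SeriesPopulation.sample, dotProduct, Matrix.of_apply, Finset.mul_sum]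
    exact Finset.sum_congr rfl fun l _ => by ring

/-- Orthogonality of `ε` to the remainder makes this a normalized centered sum of variance at most
`C² b²`. -/
lemma tendsto_eps_g (h : D.Regular μ (ξ 0) S C Cσ b Z) (hindep : iIndepFun ξ μ)
    (hident : ∀ i, IdentDistrib (ξ i) (ξ 0) μ μ) (hξ : Measurable (ξ 0)) (j : Fin q) :
    Tendsto (fun a : ℕ × Ω => (∑ i : Fin a.1, D.eps j (ξ i a.2) * D.g a.1 (ξ i a.2)) /
      √(a.1 : ℝ)) (probFilter μ) (𝓝 0) := by
  have hg : ∀ n, MemLp (fun ω => D.g n (ξ 0 ω)) 2 μ := fun n => by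
    refine MemLp.of_bound ((h.g_meas n).comp hξ).aestronglyMeasurable (b n) ?_
    filter_upwards [h.mem_ae] with ω hω using h.g_le n _ hω
  have hL : ∀ n, MemLp (fun ω => D.eps j (ξ 0 ω) * D.g n (ξ 0 ω)) 2 μ := fun n =>
    memLp_bdd_mul (h.eps_meas j) hξ h.mem_ae (h.eps_le j) (hg n)
  have hlim := h.b_sq.const_mul (C ^ 2)
  rw [mul_zero] at hlim
  refine tendsto_sum_div_sqrt hindep hident (T := fun n e => D.eps j e * D.g n e)
    (fun n => (h.eps_meas j).mul (h.g_meas n)) hL (fun n => h.eps_g n j)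
    (ρ := fun n => C ^ 2 * b n ^ 2) (fun n => ?_) hlim
  calc ∫ ω, (D.eps j (ξ 0 ω) * D.g n (ξ 0 ω)) ^ 2 ∂μ ≤ ∫ _ω, C ^ 2 * b n ^ 2 ∂μ := by
        refine integral_mono_ae (hL n).integrable_sq (integrable_const _) ?_
        filter_upwards [h.mem_ae] with ω hω
        rw [mul_pow]
        exact mul_le_mul (sq_le_sq.2 ((h.eps_le j _ hω).trans (le_abs_self _)))
          (sq_le_sq.2 ((h.g_le n _ hω).trans (le_abs_self _))) (sq_nonneg _) (sq_nonneg _)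
    _ = C ^ 2 * b n ^ 2 := by simp

lemma tendsto_v_u (h : D.Regular μ (ξ 0) S C Cσ b Z) (hindep : iIndepFun ξ μ)
    (hident : ∀ i, IdentDistrib (ξ i) (ξ 0) μ μ) (hξ : Measurable (ξ 0)) (j : Fin q) :
    Tendsto (fun a : ℕ × Ω => (∑ i : Fin a.1, D.v a.1 j (ξ i a.2) * D.u (ξ i a.2)) /
      √(a.1 : ℝ)) (probFilter μ) (𝓝 0) := by
  have hlim := h.b_sq.const_mul Cσ
  rw [mul_zero] at hlim
  refine tendsto_sum_div_sqrt hindep hident (T := fun n e => D.v n j e * D.u e)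
    (fun n => (h.v_meas n j).mul h.u_meas)
    (fun n => memLp_bdd_mul (h.v_meas n j) hξ h.mem_ae (h.v_le n j) h.u_memLp)
    (fun n => h.v_u n j) (ρ := fun n => Cσ * b n ^ 2) (fun n => ?_) hlim
  refine (h.v_u_sq n j).trans (mul_le_mul_of_nonneg_left ?_ h.Cσ_nonneg)
  have hv : MemLp (fun ω => D.v n j (ξ 0 ω)) 2 μ := by
    refine MemLp.of_bound ((h.v_meas n j).comp hξ).aestronglyMeasurable (b n) ?_
    filter_upwards [h.mem_ae] with ω hω using h.v_le n j _ hω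
  calc ∫ ω, D.v n j (ξ 0 ω) ^ 2 ∂μ ≤ ∫ _ω, b n ^ 2 ∂μ := by
        refine integral_mono_ae hv.integrable_sq (integrable_const _) ?_
        filter_upwards [h.mem_ae] with ω hω
        exact sq_le_sq.2 ((h.v_le n j _ hω).trans (le_abs_self _))
    _ = b n ^ 2 := by simp

lemma tendsto_score_score (h : D.Regular μ (ξ 0) S C Cσ b Z) (hindep : iIndepFun ξ μ)
    (hident : ∀ i, IdentDistrib (ξ i) (ξ 0) μ μ) (hξ : Measurable (ξ 0)) (j k : Fin q) :
    Tendsto (fun a : ℕ × Ω => (∑ i : Fin a.1, (D.u (ξ i a.2) * D.eps j (ξ i a.2)) *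
      (D.u (ξ i a.2) * D.eps k (ξ i a.2))) / (a.1 : ℝ)) (probFilter μ)
      (𝓝 (∫ ω, (D.u (ξ 0 ω) * D.eps j (ξ 0 ω)) * (D.u (ξ 0 ω) * D.eps k (ξ 0 ω)) ∂μ)) := by
  refine tendsto_probFilter_average hindep hident
    (T := fun e => (D.u e * D.eps j e) * (D.u e * D.eps k e))
    ((h.u_meas.mul (h.eps_meas j)).mul (h.u_meas.mul (h.eps_meas k))) ?_
  have := (h.memLp_eps_u hξ j).integrable_mul (h.memLp_eps_u hξ k)
  refine this.congr (ae_of_all _ fun ω => ?_)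
  simp only [Pi.mul_apply]
  ring

/-- The normalized scores have a second moment bounded in `n`, equal to that of one summand for `n >
0`. -/
lemma tendsto_tight (h : D.Regular μ (ξ 0) S C Cσ b Z) (hindep : iIndepFun ξ μ)
    (hident : ∀ i, IdentDistrib (ξ i) (ξ 0) μ μ) (hξ : Measurable (ξ 0)) (j : Fin q) (A : ℕ × Ω → ℝ)
    (hA : Tendsto A (probFilter μ) (𝓝 0)) :
    Tendsto (fun a : ℕ × Ω => A a * ((∑ i : Fin a.1, D.eps j (ξ i a.2) * D.u (ξ i a.2)) /
      √(a.1 : ℝ))) (probFilter μ) (𝓝 0) := by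
  have hs := integral_sum_sq hindep hident (T := fun e => D.eps j e * D.u e)
    ((h.eps_meas j).mul h.u_meas) (h.memLp_eps_u hξ j) (h.eps_u j)
  refine tendsto_probFilter_mul_of_integral_sq_le
    (S := fun n ω => (∑ i : Fin n, D.eps j (ξ i ω) * D.u (ξ i ω)) / √(n : ℝ))
    (C := ∫ ω, (D.eps j (ξ 0 ω) * D.u (ξ 0 ω)) ^ 2 ∂μ) (fun n => ?_) (fun n => ?_) hA
  · simpa only [div_eq_mul_inv] using (hs n).1.mul_const (√(n : ℝ))⁻¹
  · simp_rw [div_pow, Real.sq_sqrt (Nat.cast_nonneg n)]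
    rw [integral_div, (hs n).2]
    rcases eq_or_ne (n : ℝ) 0 with h0 | h0
    · simpa [h0] using integral_nonneg (μ := μ)
        (fun ω => sq_nonneg (D.eps j (ξ 0 ω) * D.u (ξ 0 ω)))
    · rw [mul_div_cancel_left₀ _ h0]


/-- A regular series regression sample satisfies the limit relations of partialled-out
regressions. -/
theorem partialledLimits (h : D.Regular μ (ξ 0) S C Cσ b Z) (hindep : iIndepFun ξ μ)
    (hident : ∀ i, IdentDistrib (ξ i) (ξ 0) μ μ) (hξ : Measurable (ξ 0))
    (hS : ∀ᵐ ω ∂μ, ∀ i, ξ i ω ∈ S)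
    {M : (n : ℕ) → Ω → Matrix (Fin n) (Fin n) ℝ} {hh : ℕ → Ω → Fin q → ℝ}
    (hM : ∀ a, IsProjOnto (M a.1 a.2) (D.sample ξ M hh a).Ψ)
    (hnormal : ∀ᶠ n in atTop, ∀ ω j, ∑ k, ((D.sample ξ M hh (n, ω)).r j ⬝ᵥ
      (D.sample ξ M hh (n, ω)).r k) * hh n ω k = (D.sample ξ M hh (n, ω)).r j ⬝ᵥ
        ((D.sample ξ M hh (n, ω)).u + (D.sample ξ M hh (n, ω)).g)) :
    PartialledLimits (N := fun a => a.1) (κ := fun a => κ a.1) (probFilter μ)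
      (fun a => D.sample ξ M hh a) C (fun a => b a.1) (fun a => Z a.1)
      (∫ ω, D.u (ξ 0 ω) ^ 2 ∂μ)
      (Matrix.of fun j k => ∫ ω, D.eps j (ξ 0 ω) * D.eps k (ξ 0 ω) ∂μ)
      (Matrix.of fun j k => ∫ ω, (D.u (ξ 0 ω) * D.eps j (ξ 0 ω)) *
        (D.u (ξ 0 ω) * D.eps k (ξ 0 ω)) ∂μ) where
  C_nonneg := h.C_nonneg
  size := tendsto_fst_probFilter
  good := by
    have h1 : ∀ᶠ a : ℕ × Ω in probFilter μ, ∀ i, ξ i a.2 ∈ S :=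
      eventually_probFilter_of_ae (p := fun _ ω => ∀ i, ξ i ω ∈ S) (Eventually.of_forall fun _ => hS)
    have h2 := (h.gramError_tendsto hindep hident hξ M hh).eventually_le_const
      (show (0 : ℝ) < 1 / 4 by norm_num)
    filter_upwards [h1, h2, tendsto_fst_probFilter.eventually (eventually_gt_atTop 0),
      tendsto_fst_probFilter.eventually hnormal] with a ha hg hn hno
    exact
      { pos := hn
        proj := hM a
        gram := hg
        eps_le := fun j i => h.eps_le j _ (ha i)
        v_le := fun j i => h.v_le a.1 j _ (ha i)
        g_le := fun i => h.g_le a.1 _ (ha i)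
        psi_le := fun i => by
          refine le_trans (le_of_eq ?_) (h.ψ_le a.1 _ (ha i))
          simp [SeriesPopulation.sample, dotProduct, sq]
        normal := hno a.2 }
  bias := h.bias.comp tendsto_fst_probFilter
  sup := h.sup.comp tendsto_fst_probFilter
  score_eps := h.tendsto_score_eps hindep hident hξ M hh
  score_u := h.tendsto_score_u hindep hident hξ M hh
  sup_score_eps := h.tendsto_sup_score_eps hindep hident hξ M hh
  sup_score_u := h.tendsto_sup_score_u hindep hident hξ M hh
  weight := h.tendsto_weight hident hξ M hh
  eps_g := h.tendsto_eps_g hindep hident hξ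
  v_u := h.tendsto_v_u hindep hident hξ
  u_sq := tendsto_probFilter_average hindep hident (T := fun e => D.u e ^ 2)
    (h.u_meas.pow_const 2) h.u_memLp.integrable_sq
  eps_eps j k := tendsto_probFilter_average hindep hident
    (T := fun e => D.eps j e * D.eps k e) ((h.eps_meas j).mul (h.eps_meas k))
    ((memLp_bdd_mul (h.eps_meas j) hξ h.mem_ae (h.eps_le j) (h.memLp_eps hξ k 2)).integrable
      (by norm_num))
  score_score := h.tendsto_score_score hindep hident hξ
  tight := h.tendsto_tight hindep hident hξ

end SeriesPopulation.Regular

end SampleLimits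


/-! ### Normalizing a second moment matrix to the identity -/

section Normalization

variable {ι : Type*} [Fintype ι] [DecidableEq ι]

/-- A symmetric matrix with eigenvalues at least `c > 0` can be transformed to the identity by a
congruence that increases squared lengths at most by the factor `c⁻¹`. -/
lemma exists_normalization {V : Matrix ι ι ℝ} (hV : V.IsHermitian) {c : ℝ} (hc : 0 < c)
    (heig : ∀ t, Module.End.HasEigenvalue (Matrix.toLin' V) t → c ≤ t) :
    ∃ A : Matrix ι ι ℝ, IsUnit A.det ∧ A * V * Aᵀ = 1 ∧
      ∀ y, (A *ᵥ y) ⬝ᵥ (A *ᵥ y) ≤ (y ⬝ᵥ y) / c := by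
  set lam := hV.eigenvalues with hlam
  have hl : ∀ i, c ≤ lam i := by
    intro i
    refine heig _ (Module.End.hasEigenvalue_of_hasEigenvector
      (x := (hV.eigenvectorBasis i).ofLp) ⟨?_, ?_⟩)
    · rw [Module.End.mem_eigenspace_iff, Matrix.toLin'_apply]
      exact hV.mulVec_eigenvectorBasis i
    · intro h
      exact hV.eigenvectorBasis.orthonormal.ne_zero i (by ext j; exact congrFun h j)
  have hl0 : ∀ i, 0 < lam i := fun i => hc.trans_le (hl i)
  set U : Matrix ι ι ℝ := (hV.eigenvectorUnitary : Matrix ι ι ℝ) with hU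
  have hUU : Uᵀ * U = 1 := by
    have := Unitary.coe_star_mul_self hV.eigenvectorUnitary
    rwa [Matrix.star_eq_conjTranspose, Matrix.conjTranspose_eq_transpose_of_trivial] at this
  have hUU' : U * Uᵀ = 1 := mul_eq_one_comm.1 hUU
  have hspec : V = U * Matrix.diagonal lam * Uᵀ := by
    have := hV.spectral_theorem
    rw [Unitary.conjStarAlgAut_apply, Matrix.star_eq_conjTranspose,
      Matrix.conjTranspose_eq_transpose_of_trivial] at this
    exact this
  set s : ι → ℝ := fun i => (√(lam i))⁻¹ with hs
  have hs2 : ∀ i, s i * s i = (lam i)⁻¹ := fun i => by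
    rw [hs, ← mul_inv, Real.mul_self_sqrt (hl0 i).le]
  -- With `V = U Λ U'`, the witness is `Λ^{-1/2} U'`. Its rotation preserves lengths, and the
  -- diagonal factor stretches squared lengths by at most `c⁻¹`.
  refine ⟨Matrix.diagonal s * Uᵀ, ?_, ?_, fun y => ?_⟩
  · rw [isUnit_iff_ne_zero, Matrix.det_mul, Matrix.det_diagonal]
    refine mul_ne_zero (Finset.prod_ne_zero_iff.2 fun i _ => ?_) ?_
    · exact inv_ne_zero (Real.sqrt_pos.2 (hl0 i)).ne'
    · intro h0
      have := congrArg Matrix.det hUU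
      rw [Matrix.det_mul, h0, zero_mul, Matrix.det_one] at this
      exact zero_ne_one this
  · rw [hspec, Matrix.transpose_mul, Matrix.transpose_transpose, Matrix.diagonal_transpose]
    calc Matrix.diagonal s * Uᵀ * (U * Matrix.diagonal lam * Uᵀ) * (U * Matrix.diagonal s)
        = Matrix.diagonal s * (Uᵀ * U) * Matrix.diagonal lam * (Uᵀ * U) * Matrix.diagonal s := by
          simp only [Matrix.mul_assoc]
      _ = 1 := by
          rw [hUU, Matrix.mul_one, Matrix.mul_one, Matrix.diagonal_mul_diagonal,
            Matrix.diagonal_mul_diagonal, ← Matrix.diagonal_one]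
          congr 1
          ext i
          rw [mul_right_comm, hs2, inv_mul_cancel₀ (hl0 i).ne']
  · have h1 : (Uᵀ *ᵥ y) ⬝ᵥ (Uᵀ *ᵥ y) = y ⬝ᵥ y := by
      rw [Matrix.dotProduct_mulVec, Matrix.vecMul_transpose, Matrix.mulVec_mulVec, hUU',
        Matrix.one_mulVec]
    rw [← Matrix.mulVec_mulVec, ← h1, dotProduct, dotProduct, Finset.sum_div]
    refine Finset.sum_le_sum fun i _ => ?_
    rw [Matrix.mulVec_diagonal]
    have h2 : s i * (Uᵀ *ᵥ y) i * (s i * (Uᵀ *ᵥ y) i) =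
        (Uᵀ *ᵥ y) i * (Uᵀ *ᵥ y) i * (lam i)⁻¹ := by
      rw [← hs2 i]; ring
    rw [h2, div_eq_mul_inv]
    exact mul_le_mul_of_nonneg_left (inv_anti₀ hc (hl i)) (mul_self_nonneg _)

end Normalization

/-! ### Orthogonality to functions of a random element -/

section Orthogonality

variable {Ω : Type*}

/-- Expresses integrals against the positive part of `T` as integrals against a measure on `E`, to
which uniqueness theorems for measures apply. -/
lemma integral_map_withDensity [MeasurableSpace Ω] {μ : Measure Ω} {E : Type*} [MeasurableSpace E] {Z : Ω → E} (hZ : Measurable Z)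
    {T : Ω → ℝ} (hT : Measurable T) {φ : E → ℝ} (hφ : Measurable φ) :
    ∫ e, φ e ∂((μ.withDensity fun ω => ENNReal.ofReal (T ω)).map Z) =
      ∫ ω, max (T ω) 0 * φ (Z ω) ∂μ := by
  rw [integral_map hZ.aemeasurable hφ.aestronglyMeasurable,
    integral_withDensity_eq_integral_toReal_smul hT.ennreal_ofReal
      (ae_of_all _ fun _ => ENNReal.ofReal_lt_top)]
  simp [ENNReal.toReal_ofReal']

/-- A random variable orthogonal to all bounded continuous functions of `Z` is orthogonal to all
measurable functions of `Z`. -/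
lemma integral_mul_comp_eq_zero [MeasurableSpace Ω] {μ : Measure Ω} {E : Type*}
    [TopologicalSpace E] [MeasurableSpace E]
    [BorelSpace E] [HasOuterApproxClosed E] {Z : Ω → E} (hZ : Measurable Z) {T : Ω → ℝ}
    (hT : Measurable T) (hTi : Integrable T μ)
    (h : ∀ f : BoundedContinuousFunction E ℝ, ∫ ω, T ω * f (Z ω) ∂μ = 0) {φ : E → ℝ}
    (hφ : Measurable φ) (hi : Integrable (fun ω => T ω * φ (Z ω)) μ) :
    ∫ ω, T ω * φ (Z ω) ∂μ = 0 := by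
  have hpart : ∀ t : ℝ, max t 0 - max (-t) 0 = t := fun t => by
    rcases le_total t 0 with h0 | h0
    · rw [max_eq_right h0, max_eq_left (by linarith)]; ring
    · rw [max_eq_left h0, max_eq_right (by linarith)]; ring
  have habs : ∀ t : ℝ, |max t 0| ≤ |t| := fun t => by
    rw [abs_of_nonneg (le_max_right _ _)]
    exact max_le (le_abs_self t) (abs_nonneg t)
  have habs' : ∀ t : ℝ, |max (-t) 0| ≤ |t| := fun t => by simpa using habs (-t)
  have hsub : ∀ {ψ : E → ℝ}, Measurable ψ → Integrable (fun ω => T ω * ψ (Z ω)) μ →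
      ∫ ω, T ω * ψ (Z ω) ∂μ =
        ∫ ω, max (T ω) 0 * ψ (Z ω) ∂μ - ∫ ω, max (-T ω) 0 * ψ (Z ω) ∂μ := by
    intro ψ hψ hψi
    rw [← integral_sub]
    · refine integral_congr_ae (ae_of_all _ fun ω => ?_)
      dsimp only
      rw [← sub_mul, hpart]
    · refine hψi.mono ((hT.max measurable_const).mul (hψ.comp hZ)).aestronglyMeasurable
        (ae_of_all _ fun ω => ?_)
      rw [norm_mul, norm_mul]
      exact mul_le_mul_of_nonneg_right (habs _) (norm_nonneg _)
    · refine hψi.mono ((hT.neg.max measurable_const).mul (hψ.comp hZ)).aestronglyMeasurable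
        (ae_of_all _ fun ω => ?_)
      rw [norm_mul, norm_mul]
      exact mul_le_mul_of_nonneg_right (habs' _) (norm_nonneg _)
  have hfin : IsFiniteMeasure (μ.withDensity fun ω => ENNReal.ofReal (T ω)) :=
    isFiniteMeasure_withDensity_ofReal hTi.2
  have hfin' : IsFiniteMeasure (μ.withDensity fun ω => ENNReal.ofReal (-T ω)) :=
    isFiniteMeasure_withDensity_ofReal hTi.neg.2
  -- The positive and negative parts of `T` induce finite measures on `E` that integrate bounded
  -- continuous functions alike, hence coincide; all measurable functions then follow at once.
  have heq : (μ.withDensity fun ω => ENNReal.ofReal (T ω)).map Z =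
      (μ.withDensity fun ω => ENNReal.ofReal (-T ω)).map Z := by
    refine ext_of_forall_integral_eq_of_IsFiniteMeasure fun f => ?_
    have hf : Measurable f := f.continuous.measurable
    rw [integral_map_withDensity hZ hT hf, integral_map_withDensity (T := fun ω => -T ω) hZ hT.neg hf, ← sub_eq_zero,
      ← hsub hf, h f]
    refine hTi.mul_bdd (c := ‖f‖) (hf.comp hZ).aestronglyMeasurable (ae_of_all _ fun ω => ?_)
    exact f.norm_coe_le_norm _
  rw [hsub hφ hi, ← integral_map_withDensity hZ hT hφ, ← integral_map_withDensity (T := fun ω => -T ω) hZ hT.neg hφ,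
    heq, sub_self]

/-- Pulling a measurable factor out of a conditional expectation, integrated. -/
lemma integral_mul_condExp {m mΩ : MeasurableSpace Ω} {μ : Measure[mΩ] Ω} [IsFiniteMeasure μ]
    (hm : m ≤ mΩ) {f g : Ω → ℝ} (hf : StronglyMeasurable[m] f) (hfg : Integrable (fun ω => f ω * g ω) μ)
    (hg : Integrable g μ) : ∫ ω, f ω * (μ[g | m]) ω ∂μ = ∫ ω, f ω * g ω ∂μ := by
  have h := condExp_mul_of_stronglyMeasurable_left hf (μ := μ) (g := g) hfg hg
  rw [← integral_condExp hm (f := fun ω => f ω * g ω)]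
  exact (integral_congr_ae h).symm

end Orthogonality

/-! ### Multivariate central limit theorem -/

section CentralLimit

variable {Ω : Type*} [MeasurableSpace Ω] {μ : Measure Ω} [IsProbabilityMeasure μ]

/-- The one-dimensional central limit theorem in terms of characteristic functions. -/
lemma tendsto_charFun_sum {T : ℕ → Ω → ℝ} (hindep : iIndepFun T μ)
    (hident : ∀ i, IdentDistrib (T i) (T 0) μ μ) (hL2 : MemLp (T 0) 2 μ)
    (hmean : ∫ ω, T 0 ω ∂μ = 0) :
    Tendsto (fun n : ℕ => ∫ ω, Complex.exp (((√(n : ℝ))⁻¹ * ∑ i : Fin n, T i ω : ℝ) * Complex.I) ∂μ)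
      atTop (𝓝 (Complex.exp (-(∫ ω, T 0 ω ^ 2 ∂μ : ℝ) / 2))) := by
  have hvar : Var[T 0; μ] = ∫ ω, T 0 ω ^ 2 ∂μ := variance_of_integral_eq_zero hL2.1.aemeasurable hmean
  have hY : HasLaw (id : ℝ → ℝ) (gaussianReal 0 Var[T 0; μ].toNNReal)
      (gaussianReal 0 Var[T 0; μ].toNNReal) := ⟨aemeasurable_id, Measure.map_id⟩
  have hclt := tendstoInDistribution_inv_sqrt_mul_sum_sub hY hL2 hindep hident
  -- The argument `1` suffices: in the application the frequency vector is already absorbed in `T`.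
  have hchar := (ProbabilityMeasure.tendsto_iff_tendsto_charFun.1 hclt.tendsto) 1
  simp only [ProbabilityMeasure.coe_mk, Measure.map_id, charFun_gaussianReal] at hchar
  have hnn : 0 ≤ ∫ ω, T 0 ω ^ 2 ∂μ := integral_nonneg fun ω => sq_nonneg _
  have hlim : Complex.exp (↑(1 : ℝ) * ↑(0 : ℝ) * Complex.I -
      ↑(↑(Var[T 0; μ]).toNNReal : ℝ) * ↑(1 : ℝ) ^ 2 / 2) =
      Complex.exp (-(∫ ω, T 0 ω ^ 2 ∂μ : ℝ) / 2) := by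
    rw [hvar, Real.coe_toNNReal _ hnn]
    congr 1
    simp
    ring
  rw [hlim] at hchar
  refine hchar.congr fun n => ?_
  rw [charFun_apply, integral_map]
  · refine integral_congr_ae (ae_of_all _ fun ω => ?_)
    simp [hmean, Finset.sum_range]
  · exact ((Finset.aemeasurable_fun_sum _ fun i _ => (hident i).aemeasurable_fst).sub_const
      _).const_mul _
  · fun_prop

omit [IsProbabilityMeasure μ] in
lemma integral_inner_sq {q : ℕ} {X : Ω → Vec q} (hL2 : ∀ j, MemLp (fun ω => X ω j) 2 μ)
    {V : Matrix (Fin q) (Fin q) ℝ} (hV : ∀ j k, V j k = ∫ ω, X ω j * X ω k ∂μ) (t : Vec q) :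
    ∫ ω, inner ℝ (X ω) t ^ 2 ∂μ = t ⬝ᵥ V *ᵥ t := by
  have h1 : ∀ ω, inner ℝ (X ω) t ^ 2 = ∑ j, ∑ k, t j * t k * (X ω j * X ω k) := fun ω => by
    have hlin : inner ℝ (X ω) t = ∑ j, t j * X ω j := by simp [PiLp.inner_apply]
    rw [hlin, sq, Finset.sum_mul_sum]
    exact Finset.sum_congr rfl fun j _ => Finset.sum_congr rfl fun k _ => by ring
  have hint : ∀ j k, Integrable (fun ω => t j * t k * (X ω j * X ω k)) μ := fun j k =>
    ((hL2 j).integrable_mul (hL2 k)).const_mul _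
  simp_rw [h1]
  rw [integral_finsetSum _ fun j _ => integrable_finsetSum _ fun k _ => hint j k]
  simp only [dotProduct, mulVec, Finset.mul_sum]
  refine Finset.sum_congr rfl fun j _ => ?_
  rw [integral_finsetSum _ fun k _ => hint j k]
  refine Finset.sum_congr rfl fun k _ => ?_
  rw [integral_const_mul, hV]
  ring

/-- Multivariate central limit theorem for centered square integrable i.i.d. random vectors. -/
theorem tendstoInDistribution_multivariate {q : ℕ} {X : ℕ → Ω → Vec q}
    (hindep : iIndepFun X μ) (hident : ∀ i, IdentDistrib (X i) (X 0) μ μ)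
    (hL2 : ∀ j, MemLp (fun ω => X 0 ω j) 2 μ) (hmean : ∀ j, ∫ ω, X 0 ω j ∂μ = 0)
    {V : Matrix (Fin q) (Fin q) ℝ} (hV : ∀ j k, V j k = ∫ ω, X 0 ω j * X 0 ω k ∂μ) :
    TendstoInDistribution (fun (n : ℕ) ω => (√(n : ℝ))⁻¹ • ∑ i : Fin n, X i ω) atTop id
      (fun _ => μ) (multivariateGaussian 0 V) := by
  have hquad : ∀ t : Vec q, ∫ ω, inner ℝ (X 0 ω) t ^ 2 ∂μ = t ⬝ᵥ V *ᵥ t :=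
    integral_inner_sq (X := X 0) hL2 hV
  -- The formula for the Gaussian characteristic function requires this; it holds because `t'Vt` is
  -- the second moment of an inner product.
  have hVpsd : V.PosSemidef := by
    refine Matrix.PosSemidef.of_dotProduct_mulVec_nonneg ?_ fun t => ?_
    · ext j k
      simp only [Matrix.conjTranspose_apply, star_trivial, hV, mul_comm]
    · rw [star_trivial]
      exact (integral_nonneg fun ω => sq_nonneg _).trans_eq (hquad (WithLp.toLp 2 t))
  have hXm : ∀ i, AEMeasurable (X i) μ := fun i => (hident i).aemeasurable_fst
  have hsum : ∀ n : ℕ, AEMeasurable (fun ω => ∑ i : Fin n, X i ω) μ := fun n =>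
    Finset.aemeasurable_fun_sum (f := fun (i : Fin n) ω => X i ω) Finset.univ fun i _ => hXm i
  have hmeas : ∀ n : ℕ, AEMeasurable (fun ω => (√(n : ℝ))⁻¹ • ∑ i : Fin n, X i ω) μ := by
    intro n
    have := hsum n
    fun_prop
  refine ⟨hmeas, aemeasurable_id, ?_⟩
  refine ProbabilityMeasure.tendsto_iff_tendsto_charFun.2 fun t => ?_
  simp only [ProbabilityMeasure.coe_mk, Measure.map_id]
  rw [charFun_multivariateGaussian hVpsd]
  have hφ : Measurable fun x : Vec q => (inner ℝ x t : ℝ) := by fun_prop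
  have hL2t : MemLp (fun ω => (inner ℝ (X 0 ω) t : ℝ)) 2 μ := by
    simp only [PiLp.inner_apply]
    exact memLp_finsetSum _ fun j _ => by simpa using (hL2 j).const_mul (t j)
  have hmeant : ∫ ω, (inner ℝ (X 0 ω) t : ℝ) ∂μ = 0 := by
    simp only [PiLp.inner_apply, RCLike.inner_apply, conj_trivial]
    rw [integral_finsetSum _ fun j _ => ((hL2 j).integrable (by norm_num)).const_mul _]
    simp [integral_const_mul, hmean]
  -- Cramér–Wold: the characteristic function of the vector sum at `t` is that of the scalar sum of
  -- `⟨X_i, t⟩` at `1`.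
  have hlim := tendsto_charFun_sum (T := fun i ω => (inner ℝ (X i ω) t : ℝ))
    (hindep.comp (fun _ x => (inner ℝ x t : ℝ)) fun _ => hφ) (fun i => (hident i).comp hφ)
    hL2t hmeant
  rw [hquad t] at hlim
  have hexp : Complex.exp (-((t ⬝ᵥ V *ᵥ t : ℝ) : ℂ) / 2) =
      Complex.exp (((inner ℝ t (0 : Vec q) : ℝ) : ℂ) * Complex.I - ((t ⬝ᵥ V *ᵥ t : ℝ) : ℂ) / 2) := by
    rw [inner_zero_right]; congr 1; push_cast; ring
  rw [hexp] at hlim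
  refine hlim.congr fun n => ?_
  rw [charFun_apply, integral_map (hmeas n) (by fun_prop)]
  refine integral_congr_ae (ae_of_all _ fun ω => ?_)
  simp only [real_inner_smul_left, sum_inner]

end CentralLimit


/-! ### The population projection onto the varying coefficient class -/

section Projection

variable {Ω : Type*} [MeasurableSpace Ω] {μ : Measure Ω} {q d r : ℕ} {X : Ω → Vec d}
  {Z : Ω → Vec r}

lemma ae_mem_support_map [IsFiniteMeasure μ] {E : Type*} [TopologicalSpace E]
    [SecondCountableTopology E]
    [MeasurableSpace E] [OpensMeasurableSpace E] {T : Ω → E} (hT : AEMeasurable T μ) :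
    ∀ᵐ ω ∂μ, T ω ∈ (μ.map T).support :=
  ae_of_ae_map hT (Measure.support_mem_ae (μ := μ.map T))

lemma VaryingCoefClass.continuous {g : Vec d → Vec r → ℝ} (hg : g ∈ VaryingCoefClass μ X Z) :
    Continuous fun p : Vec d × Vec r => g p.1 p.2 := by
  obtain ⟨h, hc, hg, -⟩ := hg
  simp only [hg]
  have := hc
  fun_prop

lemma memLp_of_integrable_sq_mul_sq (hX : Measurable X) (hZ : Measurable Z) {h : Vec r → ℝ}
    (hh : Continuous h) {l : Fin d}
    (hi : Integrable (fun ω => (X ω l) ^ 2 * (h (Z ω)) ^ 2) μ) :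
    MemLp (fun ω => X ω l * h (Z ω)) 2 μ := by
  refine (memLp_two_iff_integrable_sq ?_).2 (hi.congr (ae_of_all _ fun ω => (mul_pow _ _ _).symm))
  have hXl : Measurable fun ω => X ω l := by fun_prop
  exact (hXl.mul (hh.measurable.comp hZ)).aestronglyMeasurable

lemma VaryingCoefClass.memLp (hX : Measurable X) (hZ : Measurable Z) {g : Vec d → Vec r → ℝ}
    (hg : g ∈ VaryingCoefClass μ X Z) : MemLp (fun ω => g (X ω) (Z ω)) 2 μ := by
  obtain ⟨h, hc, hg, hi⟩ := hg
  simp only [hg]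
  exact memLp_finsetSum _ fun l _ => memLp_of_integrable_sq_mul_sq hX hZ (hc l) (hi l)

lemma VaryingCoefClass.add_smul (hX : Measurable X) (hZ : Measurable Z)
    {g φ : Vec d → Vec r → ℝ} (hg : g ∈ VaryingCoefClass μ X Z)
    (hφ : φ ∈ VaryingCoefClass μ X Z) (t : ℝ) :
    (fun x z => g x z + t * φ x z) ∈ VaryingCoefClass μ X Z := by
  obtain ⟨h, hc, hg, hi⟩ := hg
  obtain ⟨f, fc, hf, fi⟩ := hφ
  refine ⟨fun l z => h l z + t * f l z, fun l => (hc l).add (continuous_const.mul (fc l)),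
    fun x z => ?_, fun l => ?_⟩
  · change g x z + t * φ x z = ∑ l, x l * (h l z + t * f l z)
    rw [hg, hf, Finset.mul_sum, ← Finset.sum_add_distrib]
    exact Finset.sum_congr rfl fun l _ => by ring
  · have h1 := (memLp_of_integrable_sq_mul_sq hX hZ (hc l) (hi l)).add
      ((memLp_of_integrable_sq_mul_sq hX hZ (fc l) (fi l)).const_mul t)
    refine h1.integrable_sq.congr (ae_of_all _ fun ω => ?_)
    simp only [Pi.add_apply]
    ring

/-- The projection residual is orthogonal to the varying coefficient class. -/
lemma IsVaryingCoefProjection.integral_mul_eq_zero (hX : Measurable X) (hZ : Measurable Z)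
    {F : Ω → Vec q} (hF : ∀ j, MemLp (fun ω => F ω j) 2 μ) {m : Vec d → Vec r → Vec q}
    (hm : IsVaryingCoefProjection μ X Z F m) {φ : Vec d → Vec r → ℝ}
    (hφ : φ ∈ VaryingCoefClass μ X Z) (j : Fin q) :
    ∫ ω, (F ω - m (X ω) (Z ω)) j * φ (X ω) (Z ω) ∂μ = 0 := by
  have hφ2 := VaryingCoefClass.memLp hX hZ hφ
  have he : MemLp (fun ω => (F ω - m (X ω) (Z ω)) j) 2 μ :=
    (hF j).sub (VaryingCoefClass.memLp hX hZ (hm.1 j))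
  refine eq_zero_of_forall_quadratic_nonneg (A := ∫ ω, φ (X ω) (Z ω) ^ 2 ∂μ)
    (integral_nonneg fun ω => sq_nonneg _) fun t => ?_
  -- Only the `j`-th component is perturbed, by `t φ`. The `j`-th diagonal entry of the positive
  -- semidefinite difference is then a nonnegative quadratic in `t` without constant term.
  have hpsd := hm.2 (fun x z => m x z + (t * φ x z) • EuclideanSpace.single j 1) fun l => ?_
  · have hd := hpsd.diag_nonneg (i := j)
    have hexp : ∀ ω, (F ω - (m (X ω) (Z ω) +
        (t * φ (X ω) (Z ω)) • EuclideanSpace.single j (1 : ℝ))) j *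
        (F ω - (m (X ω) (Z ω) + (t * φ (X ω) (Z ω)) • EuclideanSpace.single j (1 : ℝ))) j =
        (F ω - m (X ω) (Z ω)) j * (F ω - m (X ω) (Z ω)) j +
        (t * t * φ (X ω) (Z ω) ^ 2 -
          2 * t * ((F ω - m (X ω) (Z ω)) j * φ (X ω) (Z ω))) := by
      intro ω
      simp only [PiLp.sub_apply, PiLp.add_apply, PiLp.smul_apply, PiLp.single_apply, if_true,
        smul_eq_mul]
      ring
    simp only [momentMatrix, Matrix.sub_apply, Matrix.of_apply] at hd
    simp_rw [hexp] at hd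
    have hi1 : Integrable (fun ω => t * t * φ (X ω) (Z ω) ^ 2) μ :=
      hφ2.integrable_sq.const_mul _
    have hi2 : Integrable (fun ω => 2 * t * ((F ω - m (X ω) (Z ω)) j * φ (X ω) (Z ω))) μ :=
      (he.integrable_mul hφ2).const_mul _
    have hi0 : Integrable (fun ω => (F ω - m (X ω) (Z ω)) j * (F ω - m (X ω) (Z ω)) j) μ :=
      he.integrable_mul he
    have hi3 : Integrable (fun ω => t * t * φ (X ω) (Z ω) ^ 2 -
        2 * t * ((F ω - m (X ω) (Z ω)) j * φ (X ω) (Z ω))) μ := hi1.sub hi2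
    rw [integral_add hi0 hi3, integral_sub hi1 hi2,
      integral_const_mul, integral_const_mul, add_sub_cancel_left] at hd
    exact hd
  · by_cases hl : l = j
    · subst hl
      have := VaryingCoefClass.add_smul hX hZ (hm.1 l) hφ t
      simpa using this
    · have := hm.1 l
      simpa [hl] using this

/-- The projection residual is orthogonal to all measurable functions of the varying coefficient
form. -/
lemma IsVaryingCoefProjection.integral_mul_coord_eq_zero [IsFiniteMeasure μ] (hX : Measurable X)
    (hZ : Measurable Z) {F : Ω → Vec q} (hF : Measurable F) {m : Vec d → Vec r → Vec q}
    (hm : IsVaryingCoefProjection μ X Z F m) {C : ℝ}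
    (hFb : ∀ᵐ ω ∂μ, ‖F ω‖ ≤ C) (hXb : ∀ᵐ ω ∂μ, ‖X ω‖ ≤ C) (j : Fin q) (l : Fin d)
    {φ : Vec r → ℝ} (hφ : Measurable φ)
    (hi : Integrable (fun ω => (F ω - m (X ω) (Z ω)) j * (X ω l * φ (Z ω))) μ) :
    ∫ ω, (F ω - m (X ω) (Z ω)) j * (X ω l * φ (Z ω)) ∂μ = 0 := by
  have hF2 : ∀ j, MemLp (fun ω => F ω j) 2 μ := fun j => by
    refine MemLp.of_bound (C := C) (by fun_prop) ?_
    filter_upwards [hFb] with ω hω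
    exact (PiLp.norm_apply_le _ _).trans hω
  have hX2 : MemLp (fun ω => X ω l) 2 μ := by
    refine MemLp.of_bound (C := C) (by fun_prop) ?_
    filter_upwards [hXb] with ω hω
    exact (PiLp.norm_apply_le _ _).trans hω
  have hmj : Measurable fun ω => m (X ω) (Z ω) j :=
    (VaryingCoefClass.continuous (hm.1 j)).measurable.comp (hX.prodMk hZ)
  have he : MemLp (fun ω => (F ω - m (X ω) (Z ω)) j) 2 μ :=
    (hF2 j).sub (VaryingCoefClass.memLp hX hZ (hm.1 j))
  simp_rw [← mul_assoc] at hi ⊢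
  -- The factor `X_l` is moved into the variable `T`, so that only a function of `Z` remains to be
  -- extended from continuous to measurable.
  refine integral_mul_comp_eq_zero (T := fun ω => (F ω - m (X ω) (Z ω)) j * X ω l) hZ ?_
    (he.integrable_mul hX2) (fun f => ?_) hφ hi
  · simp only [PiLp.sub_apply]
    have h1 : Measurable fun ω => F ω j := by fun_prop
    have h2 : Measurable fun ω => X ω l := by fun_prop
    exact (h1.sub hmj).mul h2
  -- The function `x_l f(z)` belongs to the class, with `f` as its `l`-th coefficient function and
  -- all others zero.
  · have := hm.integral_mul_eq_zero hX hZ hF2 (φ := fun x z => x l * f z)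
      ⟨fun l' z => if l' = l then f z else 0, fun l' => ?_, fun x z => ?_, fun l' => ?_⟩ j
    · simpa only [mul_assoc] using this
    · by_cases h : l' = l
      · simpa [h] using f.continuous
      · simpa [h] using continuous_const
    · simp
    · by_cases h : l' = l
      · subst h
        simp only [if_true]
        have h1 : MemLp (fun ω => X ω l' * f (Z ω)) 2 μ := by
          refine hX2.of_le_mul (c := ‖f‖)
            (hX2.1.mul (f.continuous.measurable.comp hZ).aestronglyMeasurable)
            (ae_of_all _ fun ω => ?_)
          rw [norm_mul, mul_comm]
          exact mul_le_mul_of_nonneg_right (f.norm_coe_le_norm _) (norm_nonneg _)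
        exact h1.integrable_sq.congr (ae_of_all _ fun ω => mul_pow _ _ _)
      · simp [h]

end Projection

/-! ### Series terms, remainders and approximation rates -/

section Series

variable {d r : ℕ} {S : Set (Vec d × Vec r)}
  {p : (l : Fin d) → (κ : ℕ) → Fin κ → Vec r → ℝ} {k : ℕ → Fin d → ℕ}
  {B : (n : ℕ) → Matrix (SeriesIdx (k n)) (SeriesIdx (k n)) ℝ} {δ : Fin d → ℝ}

lemma measurable_mulVec_seriesVec (hp : ∀ l κ j, Measurable (p l κ j)) (κ : Fin d → ℕ)
    {ι : Type*} (A : Matrix ι (SeriesIdx κ) ℝ) (a : ι) :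
    Measurable fun xz : Vec d × Vec r => (A *ᵥ seriesVec p κ xz.1 xz.2) a := by
  simp only [Matrix.mulVec, dotProduct, seriesVec]
  refine Finset.measurable_fun_sum _ fun b _ => ?_
  have h1 : Measurable fun xz : Vec d × Vec r => xz.1 b.1 := by fun_prop
  exact ((h1.mul ((hp b.1 (κ b.1) b.2).comp measurable_snd))).const_mul _

lemma abs_apply_le_of_norm_toLp_le {ι : Type*} [Fintype ι] {y : ι → ℝ} {c : ℝ}
    (h : ‖WithLp.toLp 2 y‖ ≤ c) (a : ι) : |y a| ≤ c :=
  (PiLp.norm_apply_le (WithLp.toLp 2 y) a).trans h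

lemma abs_mulVec_le {ι κ : Type*} [Fintype κ] (A : Matrix ι κ ℝ) {y : κ → ℝ}
    {c : ℝ} (h : ∀ a, |y a| ≤ c) (i : ι) : |(A *ᵥ y) i| ≤ (∑ j, |A i j|) * c := by
  rw [Matrix.mulVec, dotProduct, Finset.sum_mul]
  refine (Finset.abs_sum_le_sum_abs _ _).trans (Finset.sum_le_sum fun j _ => ?_)
  rw [abs_mul]
  exact mul_le_mul_of_nonneg_left (h j) (abs_nonneg _)

/-- The assumed bound concerns `B p^K`; applying `B⁻¹` transfers it to `p^K`, with a constant
depending on the matrix. This serves integrability only, so the size of the constant is irrelevant.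
-/
lemma exists_abs_seriesVec_le {κ : Fin d → ℕ} {B : Matrix (SeriesIdx κ) (SeriesIdx κ) ℝ}
    (hB : IsUnit B.det) {c : ℝ}
    (hζ : ∀ xz ∈ S, ‖WithLp.toLp 2 (B *ᵥ seriesVec p κ xz.1 xz.2)‖ ≤ c) :
    ∃ c', ∀ xz ∈ S, ∀ a, |seriesVec p κ xz.1 xz.2 a| ≤ c' := by
  refine ⟨∑ a, |(∑ j, |B⁻¹ a j|) * c|, fun xz h a => ?_⟩
  have h1 := abs_mulVec_le B⁻¹ (abs_apply_le_of_norm_toLp_le (hζ xz h)) a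
  rw [Matrix.mulVec_mulVec, Matrix.nonsing_inv_mul _ hB, Matrix.one_mulVec] at h1
  exact h1.trans ((le_abs_self _).trans
    (Finset.single_le_sum (f := fun a => |(∑ j, |B⁻¹ a j|) * c|) (fun _ _ => abs_nonneg _)
      (Finset.mem_univ a)))

/-- A series approximation with remainder bounded at all sample sizes, whose decomposition holds
at all large sample sizes. -/
lemma HasSeriesApprox.exists_remainder {f : Vec d → Vec r → ℝ}
    (h : HasSeriesApprox S p k B δ f) (hp : ∀ l κ j, Measurable (p l κ j))
    (hf : Measurable fun xz : Vec d × Vec r => f xz.1 xz.2) :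
    ∃ (α : (n : ℕ) → SeriesIdx (k n) → ℝ) (v : ℕ → Vec d × Vec r → ℝ) (C : ℝ),
      0 ≤ C ∧ (∀ n, Measurable (v n)) ∧
      (∀ n, ∀ xz ∈ S, |v n xz| ≤ C * ∑ l, (k n l : ℝ) ^ (-δ l)) ∧
      (∀ᶠ n in atTop, ∀ xz : Vec d × Vec r,
        f xz.1 xz.2 = v n xz + (B n *ᵥ seriesVec p (k n) xz.1 xz.2) ⬝ᵥ α n) ∧
      ∀ n, v n = 0 ∨ ∀ xz : Vec d × Vec r,
        f xz.1 xz.2 = v n xz + (B n *ᵥ seriesVec p (k n) xz.1 xz.2) ⬝ᵥ α n := by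
  classical
  obtain ⟨α, C, hC⟩ := h
  obtain ⟨n₀, hn₀⟩ := eventually_atTop.1 hC
  -- The approximation rate holds only from `n₀` on. Setting the remainder to zero before makes its
  -- bound valid for every `n`, and the final alternative lets orthogonality hold for every `n` as
  -- well.
  refine ⟨α, fun n xz => if n₀ ≤ n then
    f xz.1 xz.2 - (B n *ᵥ seriesVec p (k n) xz.1 xz.2) ⬝ᵥ α n else 0, |C|, abs_nonneg _,
    fun n => ?_, fun n xz hxz => ?_, ?_, fun n => ?_⟩
  · by_cases hn : n₀ ≤ n
    · simp only [hn, if_true]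
      refine hf.sub ?_
      simp only [dotProduct]
      exact Finset.measurable_fun_sum _ fun a _ =>
        (measurable_mulVec_seriesVec hp (k n) (B n) a).mul_const _
    · simp [hn]
  · have h0 : 0 ≤ ∑ l, (k n l : ℝ) ^ (-δ l) :=
      Finset.sum_nonneg fun l _ => Real.rpow_nonneg (Nat.cast_nonneg _) _
    by_cases hn : n₀ ≤ n
    · simp only [hn, if_true]
      exact (hn₀ n hn xz hxz).trans (mul_le_mul_of_nonneg_right (le_abs_self C) h0)
    · simp only [hn, if_false, abs_zero]
      positivity
  · filter_upwards [eventually_ge_atTop n₀] with n hn xz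
    simp [hn]
  · by_cases hn : n₀ ≤ n
    · right; intro xz; simp [hn]
    · left; ext xz; simp [hn]

lemma tendsto_sum_rpow_neg (hδ : ∀ l, 0 < δ l)
    (hk : ∀ l, Tendsto (fun n => k n l) atTop atTop) :
    Tendsto (fun n => ∑ l, (k n l : ℝ) ^ (-δ l)) atTop (𝓝 0) := by
  have := tendsto_finsetSum (Finset.univ : Finset (Fin d)) fun l _ =>
    (tendsto_rpow_neg_atTop (hδ l)).comp
      ((tendsto_natCast_atTop_atTop (R := ℝ)).comp (hk l))
  simpa using this

/-- Cauchy–Schwarz over the `d` coefficient functions converts the assumed rate on `∑ k_l^{-2δ_l}`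
into one on the squared bias bound. -/
lemma sq_sum_rpow_neg_le (κ : Fin d → ℕ) :
    (∑ l, (κ l : ℝ) ^ (-δ l)) ^ 2 ≤ d * ∑ l, (κ l : ℝ) ^ (-(2 * δ l)) := by
  have h := sq_sum_le_card_mul_sum_sq (s := Finset.univ) (f := fun l => (κ l : ℝ) ^ (-δ l))
  rw [Finset.card_univ, Fintype.card_fin] at h
  refine h.trans_eq ?_
  congr 1
  refine Finset.sum_congr rfl fun l _ => ?_
  rw [← Real.rpow_natCast, ← Real.rpow_mul (Nat.cast_nonneg _)]
  congr 1
  push_cast; ring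

end Series


/-! ### Moments of the regression error by conditioning -/

section ErrorMoments

variable {Ω : Type*} [MeasurableSpace Ω] {μ : Measure Ω} [IsProbabilityMeasure μ]
  {E : Type*} [MeasurableSpace E] {V : Ω → E} {Y u : Ω → ℝ} {T : E → ℝ}

omit [IsProbabilityMeasure μ] in
lemma integrable_comp_mul_of_bdd (hV : Measurable V) (hT : Measurable T) {B : ℝ}
    (hB : ∀ᵐ ω ∂μ, |T (V ω)| ≤ B) {s : Ω → ℝ} (hs : Integrable s μ) :
    Integrable (fun ω => T (V ω) * s ω) μ :=
  hs.bdd_mul (c := B) (hT.comp hV).aestronglyMeasurable hB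

/-- Integrals of a bounded function of the regressors against a conditional expectation. -/
lemma integral_comp_mul_condExp (hV : Measurable V) (hT : Measurable T) {B : ℝ}
    (hB : ∀ᵐ ω ∂μ, |T (V ω)| ≤ B) {s : Ω → ℝ} (hs : Integrable s μ) :
    ∫ ω, T (V ω) * (μ[s | MeasurableSpace.comap V inferInstance]) ω ∂μ =
      ∫ ω, T (V ω) * s ω ∂μ :=
  integral_mul_condExp hV.comap_le (f := fun ω => T (V ω))
    (hT.comp (comap_measurable V)).stronglyMeasurable
    (integrable_comp_mul_of_bdd hV hT hB hs) hs

lemma integral_comp_mul_eq_zero (hV : Measurable V) (hT : Measurable T) {B : ℝ}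
    (hB : ∀ᵐ ω ∂μ, |T (V ω)| ≤ B) (hu : Integrable u μ)
    (h0 : μ[u | MeasurableSpace.comap V inferInstance] =ᵐ[μ] 0) :
    ∫ ω, T (V ω) * u ω ∂μ = 0 := by
  rw [← integral_comp_mul_condExp hV hT hB hu]
  refine integral_eq_zero_of_ae ?_
  filter_upwards [h0] with ω hω
  simp [hω]

/-- In a regression with bounded regression function, the conditional variance of the response is
the conditional second moment of the error. -/
lemma condVar_ae_eq_of_regression (hV : Measurable V) {ρ : E → ℝ} (hρ : Measurable ρ) {B : ℝ}
    (hB : ∀ᵐ ω ∂μ, |ρ (V ω)| ≤ B) (hY : ∀ ω, Y ω = ρ (V ω) + u ω) (hu : Integrable u μ)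
    (h0 : μ[u | MeasurableSpace.comap V inferInstance] =ᵐ[μ] 0) :
    Var[Y; μ | MeasurableSpace.comap V inferInstance] =ᵐ[μ]
      μ[fun ω => u ω ^ 2 | MeasurableSpace.comap V inferInstance] := by
  have hρi : Integrable (fun ω => ρ (V ω)) μ :=
    Integrable.of_bound (hρ.comp hV).aestronglyMeasurable B hB
  have hρm : μ[fun ω => ρ (V ω) | MeasurableSpace.comap V inferInstance] = fun ω => ρ (V ω) :=
    condExp_of_stronglyMeasurable hV.comap_le
      (hρ.comp (comap_measurable V)).stronglyMeasurable hρi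
  have hYe : Y = (fun ω => ρ (V ω)) + u := funext hY
  have hcY := condExp_add (μ := μ) hρi hu (MeasurableSpace.comap V inferInstance)
  rw [← hYe, hρm] at hcY
  refine condExp_congr_ae ?_
  filter_upwards [hcY, h0] with ω h1 h2
  simp only [Pi.add_apply, h2, Pi.zero_apply, add_zero] at h1
  simp only [Pi.pow_apply, Pi.sub_apply, h1, hY]
  ring

/-- Conditioning on the regressors replaces `u²` by its conditional mean, which is bounded although
`u` need not be. -/
lemma integral_comp_mul_sq_le (hV : Measurable V) (hT : Measurable T) {B : ℝ}
    (hB : ∀ᵐ ω ∂μ, |T (V ω)| ≤ B) (hu : Integrable (fun ω => u ω ^ 2) μ) {Cσ : ℝ}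
    (hσ : ∀ᵐ ω ∂μ, (μ[fun ω => u ω ^ 2 | MeasurableSpace.comap V inferInstance]) ω ≤ Cσ) :
    ∫ ω, (T (V ω) * u ω) ^ 2 ∂μ ≤ Cσ * ∫ ω, T (V ω) ^ 2 ∂μ := by
  have hB2 : ∀ᵐ ω ∂μ, |T (V ω) ^ 2| ≤ B ^ 2 := by
    filter_upwards [hB] with ω hω
    rw [abs_pow]
    exact pow_le_pow_left₀ (abs_nonneg _) hω 2
  simp_rw [mul_pow]
  rw [← integral_comp_mul_condExp (T := fun e => T e ^ 2) hV (hT.pow_const 2) hB2 hu,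
    ← integral_const_mul]
  refine integral_mono_ae (integrable_comp_mul_of_bdd (T := fun e => T e ^ 2) hV
    (hT.pow_const 2) hB2 integrable_condExp)
    ((Integrable.of_bound ((hT.pow_const 2).comp hV).aestronglyMeasurable _ hB2).const_mul _) ?_
  filter_upwards [hσ] with ω hω
  rw [mul_comm Cσ]
  exact mul_le_mul_of_nonneg_left hω (sq_nonneg _)

end ErrorMoments

/-! ### Orthogonality to series remainders -/

section SeriesOrthogonality

variable {Ω : Type*} [MeasurableSpace Ω] {μ : Measure Ω} {d r : ℕ} {X : Ω → Vec d}
  {Z : Ω → Vec r} {S : Set (Vec d × Vec r)}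
  {p : (l : Fin d) → (κ : ℕ) → Fin κ → Vec r → ℝ} {k : ℕ → Fin d → ℕ}
  {B : (n : ℕ) → Matrix (SeriesIdx (k n)) (SeriesIdx (k n)) ℝ} {δ : Fin d → ℝ} {e : Ω → ℝ}

lemma integral_mul_dotProduct_eq_zero {ι : Type*} [Fintype ι] {s : Ω → ι → ℝ}
    (hi : ∀ a, Integrable (fun ω => e ω * s ω a) μ) (h0 : ∀ a, ∫ ω, e ω * s ω a ∂μ = 0)
    (c : ι → ℝ) :
    Integrable (fun ω => e ω * (c ⬝ᵥ s ω)) μ ∧ ∫ ω, e ω * (c ⬝ᵥ s ω) ∂μ = 0 := by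
  have h1 : ∀ ω, e ω * (c ⬝ᵥ s ω) = ∑ a, c a * (e ω * s ω a) := fun ω => by
    rw [dotProduct, Finset.mul_sum]
    exact Finset.sum_congr rfl fun a _ => by ring
  simp_rw [h1]
  refine ⟨integrable_finsetSum _ fun a _ => (hi a).const_mul _, ?_⟩
  rw [integral_finsetSum _ fun a _ => (hi a).const_mul _]
  simp [integral_const_mul, h0]

/-- A variable orthogonal to all series terms is orthogonal to all functions with uniform series
approximations, and to the remainders. -/
lemma integral_mul_remainder_eq_zero (hX : Measurable X) (hZ : Measurable Z)
    (hS : ∀ᵐ ω ∂μ, (X ω, Z ω) ∈ S) (he : Integrable e μ)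
    (hi : ∀ n a, Integrable (fun ω => e ω * seriesVec p (k n) (X ω) (Z ω) a) μ)
    (h0 : ∀ n a, ∫ ω, e ω * seriesVec p (k n) (X ω) (Z ω) a ∂μ = 0)
    (hδ : ∀ l, 0 < δ l) (hk : ∀ l, Tendsto (fun n => k n l) atTop atTop)
    {f : Vec d → Vec r → ℝ} {α : (n : ℕ) → SeriesIdx (k n) → ℝ} {v : ℕ → Vec d × Vec r → ℝ}
    {C : ℝ} (hv : ∀ n, Measurable (v n))
    (hvb : ∀ n, ∀ xz ∈ S, |v n xz| ≤ C * ∑ l, (k n l : ℝ) ^ (-δ l))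
    (hvf : ∀ᶠ n in atTop, ∀ xz : Vec d × Vec r,
      f xz.1 xz.2 = v n xz + (B n *ᵥ seriesVec p (k n) xz.1 xz.2) ⬝ᵥ α n)
    (hv0 : ∀ n, v n = 0 ∨ ∀ xz : Vec d × Vec r,
      f xz.1 xz.2 = v n xz + (B n *ᵥ seriesVec p (k n) xz.1 xz.2) ⬝ᵥ α n) (n : ℕ) :
    ∫ ω, e ω * v n (X ω, Z ω) ∂μ = 0 := by
  have hvi : ∀ n, Integrable (fun ω => e ω * v n (X ω, Z ω)) μ := fun n => by
    refine he.mul_bdd (c := C * ∑ l, (k n l : ℝ) ^ (-δ l))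
      ((hv n).comp (hX.prodMk hZ)).aestronglyMeasurable ?_
    filter_upwards [hS] with ω hω using hvb n _ hω
  have hser : ∀ n ω, (B n *ᵥ seriesVec p (k n) (X ω) (Z ω)) ⬝ᵥ α n =
      (α n ᵥ* B n) ⬝ᵥ seriesVec p (k n) (X ω) (Z ω) := fun n ω => by
    rw [dotProduct_comm, Matrix.dotProduct_mulVec]
  have heq : ∀ n, (∀ xz : Vec d × Vec r,
      f xz.1 xz.2 = v n xz + (B n *ᵥ seriesVec p (k n) xz.1 xz.2) ⬝ᵥ α n) →
      ∫ ω, e ω * f (X ω) (Z ω) ∂μ = ∫ ω, e ω * v n (X ω, Z ω) ∂μ := fun n hn => by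
    obtain ⟨h1, h2⟩ := integral_mul_dotProduct_eq_zero (hi n) (h0 n) (α n ᵥ* B n)
    have h3 : ∀ ω, e ω * f (X ω) (Z ω) = e ω * v n (X ω, Z ω) +
        e ω * ((α n ᵥ* B n) ⬝ᵥ seriesVec p (k n) (X ω) (Z ω)) := fun ω => by
      rw [← hser, ← mul_add]
      exact congrArg _ (hn (X ω, Z ω))
    simp_rw [h3]
    rw [integral_add (hvi n) h1, h2, add_zero]
  -- For all large `n` this integral equals the one with the `n`-th remainder, which tends uniformly
  -- to zero. Once it is known to vanish, the same identity gives each single remainder integral.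
  have hf0 : ∫ ω, e ω * f (X ω) (Z ω) ∂μ = 0 := by
    have hlim : Tendsto (fun n => (C * ∑ l, (k n l : ℝ) ^ (-δ l)) * ∫ ω, |e ω| ∂μ) atTop
        (𝓝 0) := by
      simpa using ((tendsto_sum_rpow_neg hδ hk).const_mul C).mul_const (∫ ω, |e ω| ∂μ)
    have hle : ∀ᶠ n in atTop, ‖∫ ω, e ω * f (X ω) (Z ω) ∂μ‖ ≤
        (C * ∑ l, (k n l : ℝ) ^ (-δ l)) * ∫ ω, |e ω| ∂μ := by
      filter_upwards [hvf] with n hn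
      rw [heq n hn, ← integral_const_mul]
      refine norm_integral_le_of_norm_le (he.abs.const_mul _) ?_
      filter_upwards [hS] with ω hω
      rw [norm_mul, mul_comm]
      exact mul_le_mul_of_nonneg_right (hvb n _ hω) (norm_nonneg _)
    exact norm_le_zero_iff.1 (ge_of_tendsto hlim hle)
  rcases hv0 n with h | h
  · simp [h]
  · rw [← heq n h, hf0]

/-- Functions with uniform series approximations are bounded on the support. -/
lemma HasSeriesApprox.exists_abs_le {f : Vec d → Vec r → ℝ} (h : HasSeriesApprox S p k B δ f)
    {ζ : ℕ → ℝ}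
    (hζ : ∀ n, ∀ xz ∈ S, ‖WithLp.toLp 2 (B n *ᵥ seriesVec p (k n) xz.1 xz.2)‖ ≤ ζ n) :
    ∃ c, ∀ xz ∈ S, |f xz.1 xz.2| ≤ c := by
  obtain ⟨α, C, hC⟩ := h
  obtain ⟨n, hn⟩ := hC.exists
  refine ⟨C * ∑ l, (k n l : ℝ) ^ (-δ l) + ∑ a, ζ n * |α n a|, fun xz hxz => ?_⟩
  have h1 : |(B n *ᵥ seriesVec p (k n) xz.1 xz.2) ⬝ᵥ α n| ≤ ∑ a, ζ n * |α n a| := by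
    refine (Finset.abs_sum_le_sum_abs _ _).trans (Finset.sum_le_sum fun a _ => ?_)
    rw [abs_mul]
    exact mul_le_mul_of_nonneg_right (abs_apply_le_of_norm_toLp_le (hζ n xz hxz) a)
      (abs_nonneg _)
  have h2 := abs_add_le (f xz.1 xz.2 - (B n *ᵥ seriesVec p (k n) xz.1 xz.2) ⬝ᵥ α n)
    ((B n *ᵥ seriesVec p (k n) xz.1 xz.2) ⬝ᵥ α n)
  rw [sub_add_cancel] at h2
  linarith [hn xz hxz]

end SeriesOrthogonality

/-! ### Orthonormal series terms -/

section NormalizedSeries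

variable {Ω : Type*} [MeasurableSpace Ω] {μ : Measure Ω} [IsFiniteMeasure μ] {ι : Type*}
  [Fintype ι] [DecidableEq ι] {T : Ω → ι → ℝ}

omit [IsFiniteMeasure μ] [DecidableEq ι] in
/-- Second moments of a linear transformation of a random vector. -/
lemma integral_mulVec_mul_mulVec {κ : Type*} (A : Matrix κ ι ℝ)
    (hi : ∀ b b', Integrable (fun ω => T ω b * T ω b') μ) (a l : κ) :
    ∫ ω, (A *ᵥ T ω) a * (A *ᵥ T ω) l ∂μ =
      (A * (Matrix.of fun b b' => ∫ ω, T ω b * T ω b' ∂μ) * Aᵀ) a l := by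
  have h1 : ∀ ω, (A *ᵥ T ω) a * (A *ᵥ T ω) l =
      ∑ b, ∑ b', A a b * A l b' * (T ω b * T ω b') := fun ω => by
    simp only [Matrix.mulVec, dotProduct]
    rw [Finset.sum_mul_sum]
    exact Finset.sum_congr rfl fun b _ => Finset.sum_congr rfl fun b' _ => by ring
  simp_rw [h1]
  rw [integral_finsetSum _ fun b _ => integrable_finsetSum _ fun b' _ => (hi b b').const_mul _,
    Matrix.mul_assoc, Matrix.mul_apply]
  refine Finset.sum_congr rfl fun b _ => ?_
  rw [integral_finsetSum _ fun b' _ => (hi b b').const_mul _, Matrix.mul_apply, Finset.mul_sum]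
  refine Finset.sum_congr rfl fun b' _ => ?_
  rw [integral_const_mul, Matrix.of_apply, Matrix.transpose_apply]
  ring

/-- Normalization of a bounded random vector whose second moment matrix has its eigenvalues
bounded away from zero. -/
lemma exists_normalized (hT : ∀ a, AEStronglyMeasurable (fun ω => T ω a) μ) {ζ : ℝ}
    (hζ : ∀ᵐ ω ∂μ, ‖WithLp.toLp 2 (T ω)‖ ≤ ζ) {c : ℝ} (hc : 0 < c)
    (heig : ∀ t, Module.End.HasEigenvalue (Matrix.toLin' (Matrix.of fun a b =>
      ∫ ω, T ω a * T ω b ∂μ)) t → c ≤ t) :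
    ∃ A : Matrix ι ι ℝ, IsUnit A.det ∧
      (∀ a l, ∫ ω, (A *ᵥ T ω) a * (A *ᵥ T ω) l ∂μ = (1 : Matrix ι ι ℝ) a l) ∧
      ∀ y : ι → ℝ, ‖WithLp.toLp 2 y‖ ≤ ζ → ∑ a, (A *ᵥ y) a ^ 2 ≤ ζ ^ 2 / c := by
  obtain ⟨A, hA, hAV, hAy⟩ := exists_normalization (V := Matrix.of fun a b =>
    ∫ ω, T ω a * T ω b ∂μ) (by ext a b; simp [mul_comm]) hc heig
  refine ⟨A, hA, fun a l => ?_, fun y hy => ?_⟩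
  · rw [integral_mulVec_mul_mulVec, hAV]
    intro b b'
    refine Integrable.of_bound ((hT b).mul (hT b')) (ζ * ζ) ?_
    filter_upwards [hζ] with ω hω
    rw [norm_mul]
    have h1 := abs_apply_le_of_norm_toLp_le hω b
    have h2 := abs_apply_le_of_norm_toLp_le hω b'
    exact mul_le_mul h1 h2 (norm_nonneg _) ((abs_nonneg _).trans h1)
  · have h1 := hAy y
    have h2 : y ⬝ᵥ y ≤ ζ ^ 2 := by
      have h3 : ‖WithLp.toLp 2 y‖ ^ 2 = y ⬝ᵥ y := by
        rw [EuclideanSpace.norm_sq_eq]; simp [dotProduct, sq]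
      rw [← h3]
      exact pow_le_pow_left₀ (norm_nonneg _) hy 2
    calc ∑ a, (A *ᵥ y) a ^ 2 = (A *ᵥ y) ⬝ᵥ (A *ᵥ y) := by simp [dotProduct, sq]
      _ ≤ (y ⬝ᵥ y) / c := h1
      _ ≤ ζ ^ 2 / c := by gcongr

end NormalizedSeries


/-! ### The estimators in terms of partialled-out regressions -/

section Link

variable {n q : ℕ} {κ κ' : Type*} [Fintype κ]

/-- Least squares in a partially linear model as a partialled-out regression. -/
lemma IsLeastSquares.partialled {Y : Fin n → ℝ} {W : Matrix (Fin n) (Fin q) ℝ}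
    {P : Matrix (Fin n) κ ℝ} {G : Matrix κ κ ℝ} {g : Vec q} {a : κ → ℝ}
    (h : IsLeastSquares Y W P g a) {X : Partialled n q κ'} {γ : Vec q} {f : Fin n → ℝ}
    (hP : IsProjOnto X.M P) (hM : X.M = P * G * Pᵀ)
    (hY : ∀ i, Y i = (∑ j, W i j * γ j) + f i + X.u i)
    (hf : ∃ c, ∀ i, f i = X.g i + (P *ᵥ c) i)
    (hW : ∀ j, ∃ c, ∀ i, W i j = X.ε j i + X.v j i + (P *ᵥ c) i) (hh : ∀ j, X.h j = g j - γ j) :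
    (∀ j, ∑ k, (X.r j ⬝ᵥ X.r k) * X.h k = X.r j ⬝ᵥ (X.u + X.g)) ∧
    (∀ i, lsResidual Y W P g a i = X.uhat i) ∧
    ∀ i j, partialledOut W P G i j = X.r j i := by
  obtain ⟨c, hc⟩ := hf
  obtain ⟨h1, h2, h3⟩ := h.partialled_out hP (γ := γ) (e := fun j => X.ε j + X.v j)
    (f := P *ᵥ c) (s := X.u + X.g)
    (fun i => by rw [hY, hc, Pi.add_apply]; ring) ⟨c, rfl⟩ (fun j => by
      obtain ⟨cj, hcj⟩ := hW j
      exact ⟨cj, funext fun i => hcj i⟩)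
  refine ⟨fun j => ?_, fun i => ?_, fun i j => ?_⟩
  · simp only [hh]; exact h3 j
  · rw [h2 i]; simp only [Partialled.uhat, hh]; rfl
  · rw [partialledOut, ← hM]
    exact congrFun (h1 j) i

variable {X : Partialled n q κ'} {R : Matrix (Fin n) (Fin q) ℝ}

lemma PhiHat_eq_gramMatrix (hR : ∀ i j, R i j = X.r j i) :
    PhiHat R = PartialledLimits.gramMatrix X := by
  ext j k
  simp only [PhiHat, PartialledLimits.gramMatrix, Matrix.smul_apply, Matrix.sum_apply,
    Matrix.vecMulVec_apply, hR, Matrix.of_apply, dotProduct, smul_eq_mul, div_eq_inv_mul]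

/-- The weighted second moment matrix of the partialled-out regressors. -/
noncomputable def Partialled.omegaMatrix (X : Partialled n q κ') : Matrix (Fin q) (Fin q) ℝ :=
  Matrix.of fun j k => (∑ i, X.uhat i ^ 2 * (X.r j i * X.r k i)) / n

lemma OmegaHat_eq_omegaMatrix {e : Fin n → ℝ} (hR : ∀ i j, R i j = X.r j i)
    (he : ∀ i, e i = X.uhat i) : OmegaHat e R = X.omegaMatrix := by
  ext j k
  simp only [OmegaHat, Partialled.omegaMatrix, Matrix.smul_apply, Matrix.sum_apply,
    Matrix.vecMulVec_apply, hR, he, Matrix.of_apply, smul_eq_mul, div_eq_inv_mul]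

end Link

namespace PartialledLimits

variable {I : Type*} {L : Filter I} {q : ℕ} {N : I → ℕ} {κ : I → Type*} [∀ a, Fintype (κ a)]
  [∀ a, DecidableEq (κ a)] {X : (a : I) → Partialled (N a) q (κ a)} {C : ℝ} {b Z : I → ℝ}
  {s : ℝ} {Φ Om : Matrix (Fin q) (Fin q) ℝ}

/-- Consistency of the sandwich estimator. -/
theorem sandwich_tendsto (h : PartialledLimits L X C b Z s Φ Om) (hΦ : IsUnit Φ.det) :
    Tendsto (fun a => (gramMatrix (X a))⁻¹ * (X a).omegaMatrix * (gramMatrix (X a))⁻¹) L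
      (𝓝 (Φ⁻¹ * Om * Φ⁻¹)) := by
  have h1 : Tendsto (fun a => (gramMatrix (X a))⁻¹) L (𝓝 Φ⁻¹) :=
    (tendsto_matrix_inv (A := fun a => gramMatrix (X a)) h.gramMatrix_tendsto hΦ).2
  have h2 : Tendsto (fun a => (X a).omegaMatrix) L (𝓝 Om) :=
    tendsto_pi_nhds.2 fun j => tendsto_pi_nhds.2 fun k => h.omega_tendsto hΦ j k
  exact (h1.mul h2).mul h1

end PartialledLimits

/-! ### From asymptotic linearity to asymptotic normality -/

section Normality

variable {Ω : Type*} [MeasurableSpace Ω] {μ : Measure Ω} [IsProbabilityMeasure μ]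

/-- Asymptotically linear estimators are asymptotically normal. -/
theorem tendstoInDistribution_of_linear {q : ℕ} {θ : ℕ → Ω → Vec q}
    (hθ : ∀ n, AEMeasurable (θ n) μ) {X : ℕ → Ω → Vec q}
    (hindep : iIndepFun X μ) (hident : ∀ i, IdentDistrib (X i) (X 0) μ μ)
    (hL2 : ∀ j, MemLp (fun ω => X 0 ω j) 2 μ) (hmean : ∀ j, ∫ ω, X 0 ω j ∂μ = 0)
    {V : Matrix (Fin q) (Fin q) ℝ} (hV : ∀ j k, V j k = ∫ ω, X 0 ω j * X 0 ω k ∂μ)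
    (hlin : ∀ j, Tendsto (fun a : ℕ × Ω => θ a.1 a.2 j -
      (∑ i : Fin a.1, X i a.2 j) / √(a.1 : ℝ)) (probFilter μ) (𝓝 0)) :
    TendstoInDistribution θ atTop id (fun _ => μ) (multivariateGaussian 0 V) := by
  have hclt := tendstoInDistribution_multivariate hindep hident hL2 hmean hV
  refine tendstoInDistribution_of_tendstoInMeasure_sub θ id hclt ?_ hθ
  refine TendstoInMeasure.of_tendsto_probFilter
    (X := θ - fun (n : ℕ) ω => (√(n : ℝ))⁻¹ • ∑ i : Fin n, X i ω) (c := (0 : Vec q)) ?_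
  have h1 : Tendsto (fun a : ℕ × Ω => fun j => θ a.1 a.2 j -
      (∑ i : Fin a.1, X i a.2 j) / √(a.1 : ℝ)) (probFilter μ) (𝓝 (0 : Fin q → ℝ)) :=
    tendsto_pi_nhds.2 hlin
  have h2 := ((PiLp.continuous_toLp 2 (fun _ : Fin q => ℝ)).tendsto 0).comp h1
  rw [WithLp.toLp_zero] at h2
  refine h2.congr fun a => ?_
  ext j
  simp [div_eq_inv_mul]

end Normality


/-! ### Consequences of the rate conditions -/

section Rates

/-- If `K ≥ 1` then `Z/n ≤ ZK/n`, and `K ≤ Z` gives `(K/√n)² ≤ ZK/n`. The case `K = 0` is covered by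
the assumption that `Z` vanishes with `K`. -/
lemma tendsto_div_and_div_sqrt {K : ℕ → ℕ} {Z : ℕ → ℝ} (hKZ : ∀ n, (K n : ℝ) ≤ Z n)
    (hZ : ∀ n, K n = 0 → Z n = 0) (h : Tendsto (fun n : ℕ => Z n * K n / n) atTop (𝓝 0)) :
    Tendsto (fun n : ℕ => Z n / n) atTop (𝓝 0) ∧
      Tendsto (fun n : ℕ => (K n : ℝ) / √(n : ℝ)) atTop (𝓝 0) := by
  have hZ0 : ∀ n, 0 ≤ Z n := fun n => (Nat.cast_nonneg _).trans (hKZ n)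
  refine ⟨squeeze_zero (fun n => div_nonneg (hZ0 n) (Nat.cast_nonneg n)) (fun n => ?_) h,
    squeeze_zero (fun n => by positivity) (fun n => ?_)
      (by simpa using (Real.continuous_sqrt.tendsto 0).comp h)⟩
  · rcases Nat.eq_zero_or_pos (K n) with h0 | h0
    · simp [hZ n h0]
    · have : (1 : ℝ) ≤ K n := by exact_mod_cast h0
      exact div_le_div_of_nonneg_right (le_mul_of_one_le_right (hZ0 n) this) (Nat.cast_nonneg n)
  · refine Real.le_sqrt_of_sq_le ?_
    rw [div_pow, Real.sq_sqrt (Nat.cast_nonneg n), sq]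
    exact div_le_div_of_nonneg_right (mul_le_mul_of_nonneg_right (hKZ n) (Nat.cast_nonneg _))
      (Nat.cast_nonneg n)

/-- Trace identity: the number of orthonormal terms is the mean of their squared length. The uniform
bound thus controls the dimension. -/
lemma card_le_of_integral_mul_self_eq_one {Ω : Type*} [MeasurableSpace Ω] {μ : Measure Ω}
    [IsProbabilityMeasure μ] {ι : Type*} [Fintype ι] {ψ : Ω → ι → ℝ}
    (hψ : ∀ a, ∫ ω, ψ ω a * ψ ω a ∂μ = 1) {Z : ℝ} (hZ : ∀ᵐ ω ∂μ, ∑ a, ψ ω a ^ 2 ≤ Z) :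
    (Fintype.card ι : ℝ) ≤ Z := by
  have hi : ∀ a, Integrable (fun ω => ψ ω a ^ 2) μ := fun a => by
    -- A non-integrable square would have integral `0` by convention, not `1`.
    by_contra h
    have h1 := hψ a
    simp_rw [← sq] at h1
    rw [integral_undef h] at h1
    exact zero_ne_one h1
  have h1 : ∫ ω, ∑ a, ψ ω a ^ 2 ∂μ = Fintype.card ι := by
    rw [integral_finsetSum _ fun a _ => hi a]
    simp_rw [sq, hψ]
    simp
  rw [← h1]
  refine (integral_mono_ae (integrable_finsetSum _ fun a _ => hi a)
    (integrable_const Z) hZ).trans ?_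
  simp

lemma tendsto_sqrt_mul_sq_sum_rpow_neg {d : ℕ} {k : ℕ → Fin d → ℕ} {δ : Fin d → ℝ}
    (h : Tendsto (fun n : ℕ => √(n : ℝ) * ∑ l, (k n l : ℝ) ^ (-(2 * δ l))) atTop (𝓝 0))
    (C : ℝ) : Tendsto (fun n : ℕ => √(n : ℝ) * (C * ∑ l, (k n l : ℝ) ^ (-δ l)) ^ 2) atTop
      (𝓝 0) := by
  refine squeeze_zero (fun n => by positivity) (fun n => ?_)
    (by simpa using h.const_mul (C ^ 2 * d))
  rw [mul_pow]
  have := mul_le_mul_of_nonneg_left (sq_sum_rpow_neg_le (δ := δ) (k n))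
    (mul_nonneg (Real.sqrt_nonneg (n : ℝ)) (sq_nonneg C))
  linarith

end Rates

/-! ### One observation of the model: bounds and orthogonality -/

section Model

variable {Ω : Type*} [MeasurableSpace Ω] {μ : Measure Ω} {q d r : ℕ}

/-- The joint distribution of one observation of a partially linear varying coefficient model
and the properties of its series approximation. -/
structure SeriesModel (μ : Measure Ω) (Y : Ω → ℝ) (w : Ω → Vec q) (x : Ω → Vec d) (z : Ω → Vec r)
    (u : Ω → ℝ) (γ : Vec q) (β : Vec r → Vec d)
    (p : (l : Fin d) → (κ : ℕ) → Fin κ → Vec r → ℝ) (k : ℕ → Fin d → ℕ)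
    (B : (n : ℕ) → Matrix (SeriesIdx (k n)) (SeriesIdx (k n)) ℝ) (S : Set (Vec d × Vec r))
    (ζ : ℕ → ℝ) (m : Vec d → Vec r → Vec q) (δ : Fin d → ℝ) : Prop where
  hw : Measurable w
  hx : Measurable x
  hz : Measurable z
  hβ : Measurable β
  model : ∀ ω, Y ω = (∑ j, w ω j * γ j) + (∑ l, x ω l * β (z ω) l) + u ω
  memLp : MemLp Y 2 μ
  condExp_u : μ[u | MeasurableSpace.comap (fun ω => (w ω, x ω, z ω)) inferInstance] =ᵐ[μ] 0
  isCompact_support : IsCompact (μ.map (fun ω => (w ω, x ω, z ω))).support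
  condVar_le : ∃ C : ℝ, ∀ᵐ ω ∂μ,
      (Var[Y; μ | MeasurableSpace.comap (fun ω => (w ω, x ω, z ω)) inferInstance]) ω ≤ C
  hp : ∀ l κ j, Measurable (p l κ j)
  hB : ∀ n, IsUnit (B n).det
  hS : S = (μ.map (fun ω => (x ω, z ω))).support
  heig : ∃ c : ℝ, 0 < c ∧ ∀ (n : ℕ) (t : ℝ),
      Module.End.HasEigenvalue (Matrix.toLin' (Matrix.of fun a b =>
        ∫ ω, (B n *ᵥ seriesVec p (k n) (x ω) (z ω)) a *
          (B n *ᵥ seriesVec p (k n) (x ω) (z ω)) b ∂μ)) t → c ≤ t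
  hζ : ∀ n, ∀ xz ∈ S, ‖WithLp.toLp 2 (B n *ᵥ seriesVec p (k n) xz.1 xz.2)‖ ≤ ζ n
  hζK : Tendsto (fun n : ℕ => (ζ n) ^ 2 * ((∑ l, k n l : ℕ) : ℝ) / n) atTop (𝓝 0)
  proj : IsVaryingCoefProjection μ x z w m
  hδ : ∀ l, 0 < δ l
  approx_g : HasSeriesApprox S p k B δ (fun x z => ∑ l, x l * β z l)
  approx_m : ∀ j, HasSeriesApprox S p k B δ (fun x z => m x z j)
  hk : ∀ l, Tendsto (fun n => k n l) atTop atTop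
  rate : Tendsto (fun n : ℕ => √(n : ℝ) * ∑ l, (k n l : ℝ) ^ (-(2 * δ l))) atTop (𝓝 0)

namespace SeriesModel

variable {Y : Ω → ℝ} {w : Ω → Vec q} {x : Ω → Vec d} {z : Ω → Vec r}
  {u : Ω → ℝ} {γ : Vec q} {β : Vec r → Vec d}
  {p : (l : Fin d) → (κ : ℕ) → Fin κ → Vec r → ℝ} {k : ℕ → Fin d → ℕ}
  {B : (n : ℕ) → Matrix (SeriesIdx (k n)) (SeriesIdx (k n)) ℝ} {S : Set (Vec d × Vec r)}
  {ζ : ℕ → ℝ} {m : Vec d → Vec r → Vec q} {δ : Fin d → ℝ}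

section

variable (h : SeriesModel μ Y w x z u γ β p k B S ζ m δ)
include h

lemma measurable_regressors : Measurable fun ω => (w ω, x ω, z ω) :=
  h.hw.prodMk (h.hx.prodMk h.hz)

lemma ae_mem [IsFiniteMeasure μ] : ∀ᵐ ω ∂μ, (x ω, z ω) ∈ S := by
  rw [h.hS]
  exact ae_mem_support_map (h.hx.prodMk h.hz).aemeasurable

lemma ae_mem_regressors [IsFiniteMeasure μ] :
    ∀ᵐ ω ∂μ, (w ω, x ω, z ω) ∈ (μ.map (fun ω => (w ω, x ω, z ω))).support :=
  ae_mem_support_map h.measurable_regressors.aemeasurable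

lemma exists_norm_le : ∃ C : ℝ, ∀ e ∈ (μ.map (fun ω => (w ω, x ω, z ω))).support,
    ‖e.1‖ ≤ C ∧ ‖e.2.1‖ ≤ C := by
  obtain ⟨C, hC⟩ := h.isCompact_support.isBounded.exists_norm_le
  exact ⟨C, fun e he => ⟨(norm_fst_le e).trans (hC e he),
    (norm_fst_le e.2).trans ((norm_snd_le e).trans (hC e he))⟩⟩

lemma measurable_projection (j : Fin q) :
    Measurable fun xz : Vec d × Vec r => m xz.1 xz.2 j :=
  (VaryingCoefClass.continuous (h.proj.1 j)).measurable

lemma measurable_varying : Measurable fun xz : Vec d × Vec r => ∑ l, xz.1 l * β xz.2 l := by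
  refine Finset.measurable_fun_sum _ fun l _ => ?_
  have h1 : Measurable fun xz : Vec d × Vec r => xz.1 l := by fun_prop
  have h2 : Measurable fun xz : Vec d × Vec r => β xz.2 l := by
    have := h.hβ
    fun_prop
  exact h1.mul h2

lemma measurable_eps (j : Fin q) :
    Measurable fun e : Vec q × Vec d × Vec r => (e.1 - m e.2.1 e.2.2) j := by
  have h1 : Measurable fun e : Vec q × Vec d × Vec r => e.1 j := by fun_prop
  exact h1.sub ((h.measurable_projection j).comp measurable_snd)

/-- `w` is bounded by compactness of the support, and `m` is bounded on `S` because it is uniformly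
close to a bounded series. -/
lemma exists_abs_eps_le : ∃ C : ℝ, 0 ≤ C ∧
    ∀ e : Vec q × Vec d × Vec r, e ∈ (μ.map (fun ω => (w ω, x ω, z ω))).support → e.2 ∈ S →
      ∀ j, |e.1 j - m e.2.1 e.2.2 j| ≤ C := by
  obtain ⟨C, hC⟩ := h.exists_norm_le
  choose c hc using fun j => (h.approx_m j).exists_abs_le h.hζ
  refine ⟨|C| + ∑ j, |c j|, by positivity, fun e he heS j => ?_⟩
  have h1 : |e.1 j| ≤ C := (PiLp.norm_apply_le e.1 j).trans (hC e he).1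
  have h2 : |c j| ≤ ∑ j, |c j| :=
    Finset.single_le_sum (f := fun j => |c j|) (fun _ _ => abs_nonneg _) (Finset.mem_univ j)
  have h3 := abs_sub (e.1 j) (m e.2.1 e.2.2 j)
  have h4 : |m e.2.1 e.2.2 j| ≤ c j := hc j e.2 heS
  linarith [le_abs_self C, le_abs_self (c j)]

lemma exists_abs_regression_le : ∃ C : ℝ,
    ∀ e : Vec q × Vec d × Vec r, e ∈ (μ.map (fun ω => (w ω, x ω, z ω))).support → e.2 ∈ S →
      |(∑ j, e.1 j * γ j) + ∑ l, e.2.1 l * β e.2.2 l| ≤ C := by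
  obtain ⟨C, hC⟩ := h.exists_norm_le
  obtain ⟨c, hc⟩ := h.approx_g.exists_abs_le h.hζ
  refine ⟨(∑ j, C * |γ j|) + c, fun e he heS => (abs_add_le _ _).trans (add_le_add ?_ ?_)⟩
  · refine (Finset.abs_sum_le_sum_abs _ _).trans (Finset.sum_le_sum fun j _ => ?_)
    rw [abs_mul]
    exact mul_le_mul_of_nonneg_right ((PiLp.norm_apply_le e.1 j).trans (hC e he).1)
      (abs_nonneg _)
  · exact hc e.2 heS

lemma measurable_regression : Measurable fun e : Vec q × Vec d × Vec r =>
    (∑ j, e.1 j * γ j) + ∑ l, e.2.1 l * β e.2.2 l := by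
  refine Measurable.add ?_ (h.measurable_varying.comp measurable_snd)
  refine Finset.measurable_fun_sum _ fun j _ => ?_
  have h1 : Measurable fun e : Vec q × Vec d × Vec r => e.1 j := by fun_prop
  exact h1.mul_const _

variable [IsProbabilityMeasure μ]

lemma ae_abs_regression_le : ∃ C : ℝ,
    ∀ᵐ ω ∂μ, |(∑ j, w ω j * γ j) + ∑ l, x ω l * β (z ω) l| ≤ C := by
  obtain ⟨C, hC⟩ := h.exists_abs_regression_le
  refine ⟨C, ?_⟩
  filter_upwards [h.ae_mem, h.ae_mem_regressors] with ω h1 h2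
  exact hC _ h2 h1

lemma memLp_u : MemLp u 2 μ := by
  obtain ⟨C, hC⟩ := h.ae_abs_regression_le
  have h1 : MemLp (fun ω => (∑ j, w ω j * γ j) + ∑ l, x ω l * β (z ω) l) 2 μ :=
    MemLp.of_bound (h.measurable_regression.comp h.measurable_regressors).aestronglyMeasurable
      C hC
  refine (h.memLp.sub h1).ae_eq (ae_of_all _ fun ω => ?_)
  rw [Pi.sub_apply, h.model]
  ring

/-- The regression function is bounded, so the conditional second moment of `u` is the conditional
variance of `Y`. -/
lemma exists_condExp_u_sq_le : ∃ C : ℝ, 0 ≤ C ∧ ∀ᵐ ω ∂μ,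
    (μ[fun ω => u ω ^ 2 |
      MeasurableSpace.comap (fun ω => (w ω, x ω, z ω)) inferInstance]) ω ≤ C := by
  obtain ⟨c, hc⟩ := h.ae_abs_regression_le
  obtain ⟨C, hC⟩ := h.condVar_le
  refine ⟨max C 0, le_max_right _ _, ?_⟩
  filter_upwards [hC, condVar_ae_eq_of_regression (V := fun ω => (w ω, x ω, z ω))
    (ρ := fun e => (∑ j, e.1 j * γ j) + ∑ l, e.2.1 l * β e.2.2 l) h.measurable_regressors
    h.measurable_regression hc h.model (h.memLp_u.integrable one_le_two) h.condExp_u]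
    with ω h1 h2
  rw [← h2]
  exact h1.trans (le_max_left _ _)

/-- The basis functions are merely measurable, so this rests on the extension of orthogonality
beyond continuous coefficient functions. -/
lemma eps_mul_seriesVec (n : ℕ) (j : Fin q) (a : SeriesIdx (k n)) :
    Integrable (fun ω => (w ω - m (x ω) (z ω)) j * seriesVec p (k n) (x ω) (z ω) a) μ ∧
      ∫ ω, (w ω - m (x ω) (z ω)) j * seriesVec p (k n) (x ω) (z ω) a ∂μ = 0 := by
  obtain ⟨C, hC0, hC⟩ := h.exists_abs_eps_le
  obtain ⟨c, hc⟩ := exists_abs_seriesVec_le (h.hB n) (h.hζ n)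
  obtain ⟨C', hC'⟩ := h.exists_norm_le
  have hwj : Measurable fun ω => w ω j := by
    have := h.hw
    fun_prop
  have hxl : Measurable fun ω => x ω a.1 := by
    have := h.hx
    fun_prop
  have hem : Measurable fun ω => (w ω - m (x ω) (z ω)) j :=
    hwj.sub ((h.measurable_projection j).comp (h.hx.prodMk h.hz))
  have hsm : Measurable fun ω => seriesVec p (k n) (x ω) (z ω) a :=
    hxl.mul ((h.hp _ _ _).comp h.hz)
  have hi : Integrable (fun ω => (w ω - m (x ω) (z ω)) j *
      seriesVec p (k n) (x ω) (z ω) a) μ := by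
    refine Integrable.of_bound (hem.mul hsm).aestronglyMeasurable (C * c) ?_
    filter_upwards [h.ae_mem, h.ae_mem_regressors] with ω h1 h2
    rw [norm_mul]
    exact mul_le_mul (hC _ h2 h1 j) (hc _ h1 a) (norm_nonneg _) hC0
  refine ⟨hi, h.proj.integral_mul_coord_eq_zero h.hx h.hz h.hw (C := C') ?_ ?_ j a.1
    (h.hp a.1 (k n a.1) a.2) hi⟩
  · filter_upwards [h.ae_mem_regressors] with ω h2 using (hC' _ h2).1
  · filter_upwards [h.ae_mem_regressors] with ω h2 using (hC' _ h2).2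

/-- Normalized series terms with their uniform bound. -/
lemma exists_normalized_series {c : ℝ} (hc : 0 < c) (n : ℕ)
    (heig : ∀ t : ℝ, Module.End.HasEigenvalue (Matrix.toLin' (Matrix.of fun a b =>
        ∫ ω, (B n *ᵥ seriesVec p (k n) (x ω) (z ω)) a *
          (B n *ᵥ seriesVec p (k n) (x ω) (z ω)) b ∂μ)) t → c ≤ t) :
    ∃ A : Matrix (SeriesIdx (k n)) (SeriesIdx (k n)) ℝ, IsUnit A.det ∧
    (∀ a l, ∫ ω, (A *ᵥ seriesVec p (k n) (x ω) (z ω)) a *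
      (A *ᵥ seriesVec p (k n) (x ω) (z ω)) l ∂μ =
        (1 : Matrix (SeriesIdx (k n)) (SeriesIdx (k n)) ℝ) a l) ∧
    (∀ xz ∈ S, ∑ a, (A *ᵥ seriesVec p (k n) xz.1 xz.2) a ^ 2 ≤
      if ∑ l, k n l = 0 then 0 else ζ n ^ 2 / c) ∧
    ((∑ l, k n l : ℕ) : ℝ) ≤ if ∑ l, k n l = 0 then 0 else ζ n ^ 2 / c := by
  obtain ⟨A, hAd, hA1, hA2⟩ := exists_normalized
    (T := fun ω => B n *ᵥ seriesVec p (k n) (x ω) (z ω)) (μ := μ) (ζ := ζ n) (c := c)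
    (fun a => ((measurable_mulVec_seriesVec h.hp (k n) (B n) a).comp
      (h.hx.prodMk h.hz)).aestronglyMeasurable)
    (by filter_upwards [h.ae_mem] with ω hω using h.hζ n (x ω, z ω) hω) hc heig
  have hcard : Fintype.card (SeriesIdx (k n)) = ∑ l, k n l := by simp
  simp_rw [Matrix.mulVec_mulVec] at hA1
  -- Without series terms, as when `d = 0`, the rate condition says nothing about `ζ`. The bound is
  -- therefore set to zero in that case, where the sum is empty.
  have hle : ∀ xz ∈ S, ∑ a, ((A * B n) *ᵥ seriesVec p (k n) xz.1 xz.2) a ^ 2 ≤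
      if ∑ l, k n l = 0 then 0 else ζ n ^ 2 / c := fun xz hxz => by
    split_ifs with h0
    · have : IsEmpty (SeriesIdx (k n)) := Fintype.card_eq_zero_iff.1 (hcard.trans h0)
      simp
    · rw [← Matrix.mulVec_mulVec]
      exact hA2 (B n *ᵥ seriesVec p (k n) xz.1 xz.2) (h.hζ n xz hxz)
  refine ⟨A * B n, ?_, hA1, hle, ?_⟩
  · rw [Matrix.det_mul]
    exact hAd.mul (h.hB n)
  · rw [← hcard]
    refine card_le_of_integral_mul_self_eq_one (μ := μ)
      (ψ := fun ω => (A * B n) *ᵥ seriesVec p (k n) (x ω) (z ω))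
      (fun a => (hA1 a a).trans (Matrix.one_apply_eq a)) ?_
    filter_upwards [h.ae_mem] with ω hω
    rw [hcard]
    exact hle (x ω, z ω) hω

omit [IsProbabilityMeasure μ] in
lemma tendsto_sup_mul_dim (c : ℝ) : Tendsto (fun n : ℕ =>
    (if ∑ l, k n l = 0 then 0 else ζ n ^ 2 / c) * ((∑ l, k n l : ℕ) : ℝ) / n) atTop (𝓝 0) := by
  have := h.hζK.div_const c
  rw [zero_div] at this
  refine this.congr fun n => ?_
  split_ifs with h0
  · simp [h0]
  · ring

end

end SeriesModel

end Model


/-! ### Regularity of the population quantities -/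

namespace SeriesModel

variable {Ω : Type*} [MeasurableSpace Ω] {μ : Measure Ω} [IsProbabilityMeasure μ] {q d r : ℕ}
  {Y : Ω → ℝ} {w : Ω → Vec q} {x : Ω → Vec d} {z : Ω → Vec r}
  {u : Ω → ℝ} {γ : Vec q} {β : Vec r → Vec d}
  {p : (l : Fin d) → (κ : ℕ) → Fin κ → Vec r → ℝ} {k : ℕ → Fin d → ℕ}
  {B : (n : ℕ) → Matrix (SeriesIdx (k n)) (SeriesIdx (k n)) ℝ} {S : Set (Vec d × Vec r)}
  {ζ : ℕ → ℝ} {m : Vec d → Vec r → Vec q} {δ : Fin d → ℝ}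

/-- The partialled-out regression of a partially linear varying coefficient model, with series
terms `A n *ᵥ p^K` and approximation errors `v` and `g`. -/
def population (γ : Vec q) (β : Vec r → Vec d)
    (p : (l : Fin d) → (κ : ℕ) → Fin κ → Vec r → ℝ) (k : ℕ → Fin d → ℕ)
    (m : Vec d → Vec r → Vec q) (A : (n : ℕ) → Matrix (SeriesIdx (k n)) (SeriesIdx (k n)) ℝ)
    (v : Fin q → ℕ → Vec d × Vec r → ℝ) (g : ℕ → Vec d × Vec r → ℝ) :
    SeriesPopulation (ℝ × Vec q × Vec d × Vec r) q (fun n => SeriesIdx (k n)) where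
  eps j e := (e.2.1 - m e.2.2.1 e.2.2.2) j
  u e := e.1 - ((∑ j, e.2.1 j * γ j) + ∑ l, e.2.2.1 l * β e.2.2.2 l)
  v n j e := v j n e.2.2
  g n e := g n e.2.2
  ψ n a e := (A n *ᵥ seriesVec p (k n) e.2.2.1 e.2.2.2) a

/-- The set of observations with regressors in the support. -/
def regularSet (μ : Measure Ω) (w : Ω → Vec q) (x : Ω → Vec d) (z : Ω → Vec r)
    (S : Set (Vec d × Vec r)) : Set (ℝ × Vec q × Vec d × Vec r) :=
  {e | e.2 ∈ (μ.map (fun ω => (w ω, x ω, z ω))).support ∧ e.2.2 ∈ S}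

omit [IsProbabilityMeasure μ] in
lemma measurableSet_regularSet (h : SeriesModel μ Y w x z u γ β p k B S ζ m δ) :
    MeasurableSet (regularSet μ w x z S) := by
  have h1 : IsClosed S := h.hS ▸ Measure.isClosed_support
  have h2 : IsClosed (μ.map (fun ω => (w ω, x ω, z ω))).support := Measure.isClosed_support
  exact (measurable_snd h2.measurableSet).inter
    ((measurable_snd.comp measurable_snd) h1.measurableSet)

lemma ae_mem_regularSet (h : SeriesModel μ Y w x z u γ β p k B S ζ m δ) :
    ∀ᵐ ω ∂μ, (Y ω, w ω, x ω, z ω) ∈ regularSet μ w x z S := by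
  filter_upwards [h.ae_mem, h.ae_mem_regressors] with ω h1 h2 using ⟨h2, h1⟩

omit [IsProbabilityMeasure μ] in
-- The error is a function of the observation `(Y, w, x, z)`, so the i.i.d. assumption on
-- observations covers every statistic below.
lemma population_u (h : SeriesModel μ Y w x z u γ β p k B S ζ m δ)
    (A : (n : ℕ) → Matrix (SeriesIdx (k n)) (SeriesIdx (k n)) ℝ)
    (v : Fin q → ℕ → Vec d × Vec r → ℝ) (g : ℕ → Vec d × Vec r → ℝ) (ω : Ω) :
    (population γ β p k m A v g).u (Y ω, w ω, x ω, z ω) = u ω := by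
  simp only [population]
  rw [h.model]
  ring

/-- The population quantities of the model are regular. -/
theorem exists_regular (h : SeriesModel μ Y w x z u γ β p k B S ζ m δ) :
    ∃ (A : (n : ℕ) → Matrix (SeriesIdx (k n)) (SeriesIdx (k n)) ℝ)
      (v : Fin q → ℕ → Vec d × Vec r → ℝ) (g : ℕ → Vec d × Vec r → ℝ) (C Cσ : ℝ) (b Z : ℕ → ℝ),
      (population γ β p k m A v g).Regular μ (fun ω => (Y ω, w ω, x ω, z ω))
        (regularSet μ w x z S) C Cσ b Z ∧ (∀ n, IsUnit (A n).det) ∧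
      (∀ᶠ n in atTop, ∃ c : SeriesIdx (k n) → ℝ, ∀ xz : Vec d × Vec r,
        ∑ l, xz.1 l * β xz.2 l = g n xz + seriesVec p (k n) xz.1 xz.2 ⬝ᵥ c) ∧
      (∀ᶠ n in atTop, ∀ j, ∃ c : SeriesIdx (k n) → ℝ, ∀ xz : Vec d × Vec r,
        m xz.1 xz.2 j = v j n xz + seriesVec p (k n) xz.1 xz.2 ⬝ᵥ c) := by
  obtain ⟨c, hc, heig⟩ := h.heig
  choose A hAd hone hψle hKZ using fun n => h.exists_normalized_series hc n (heig n)
  obtain ⟨αg, g, Cg, hCg, hgm, hgb, hgf, hg0⟩ :=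
    h.approx_g.exists_remainder h.hp h.measurable_varying
  choose αm v Cm hCm hvm hvb hvf hv0 using fun j =>
    (h.approx_m j).exists_remainder h.hp (h.measurable_projection j)
  obtain ⟨C, hC0, hC⟩ := h.exists_abs_eps_le
  obtain ⟨Cσ, hCσ0, hCσ⟩ := h.exists_condExp_u_sq_le
  have hcard : ∀ n, Fintype.card (SeriesIdx (k n)) = ∑ l, k n l := fun n => by simp
  obtain ⟨hsup, hdim⟩ := tendsto_div_and_div_sqrt hKZ (fun n hn => by simp [hn])
    (h.tendsto_sup_mul_dim c)
  have hs0 : ∀ n, 0 ≤ ∑ l, (k n l : ℝ) ^ (-δ l) := fun n =>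
    Finset.sum_nonneg fun l _ => Real.rpow_nonneg (Nat.cast_nonneg _) _
  have hZ0 : ∀ n, 0 ≤ if ∑ l, k n l = 0 then 0 else ζ n ^ 2 / c := fun n =>
    (Nat.cast_nonneg _).trans (hKZ n)
  have hui : Integrable u μ := h.memLp_u.integrable one_le_two
  have hu2 : Integrable (fun ω => u ω ^ 2) μ := h.memLp_u.integrable_sq
  have hV := h.measurable_regressors
  have heps := h.measurable_eps
  have hepsi : ∀ j, Integrable (fun ω => (w ω - m (x ω) (z ω)) j) μ := fun j => by
    refine Integrable.of_bound ((heps j).comp hV).aestronglyMeasurable C ?_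
    filter_upwards [h.ae_mem, h.ae_mem_regressors] with ω h1 h2 using hC _ h2 h1 j
  have hψm : ∀ n a, Measurable fun e : Vec q × Vec d × Vec r =>
      (A n *ᵥ seriesVec p (k n) e.2.1 e.2.2) a := fun n a =>
    (measurable_mulVec_seriesVec h.hp (k n) (A n) a).comp measurable_snd
  have hψb : ∀ n a, ∀ᵐ ω ∂μ, |(A n *ᵥ seriesVec p (k n) (x ω) (z ω)) a| ≤
      √(if ∑ l, k n l = 0 then 0 else ζ n ^ 2 / c) := fun n a => by
    filter_upwards [h.ae_mem] with ω hω
    exact Real.abs_le_sqrt ((Finset.single_le_sum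
      (f := fun a => (A n *ᵥ seriesVec p (k n) (x ω) (z ω)) a ^ 2) (fun _ _ => sq_nonneg _)
      (Finset.mem_univ a)).trans (hψle n (x ω, z ω) hω))
  have hvbω : ∀ n j, ∀ᵐ ω ∂μ, |v j n (x ω, z ω)| ≤ Cm j * ∑ l, (k n l : ℝ) ^ (-δ l) :=
    fun n j => by filter_upwards [h.ae_mem] with ω hω using hvb j n _ hω
  have hvm' : ∀ n j, Measurable fun e : Vec q × Vec d × Vec r => v j n e.2 := fun n j =>
    (hvm j n).comp measurable_snd
  have hCle : ∀ j, Cm j ≤ Cg + ∑ j, Cm j := fun j =>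
    (Finset.single_le_sum (f := Cm) (fun j _ => hCm j) (Finset.mem_univ j)).trans
      (le_add_of_nonneg_left hCg)
  -- Adding the constants of all remainders gives one bias bound that serves `g` and every `v j`.
  refine ⟨A, v, g, C, Cσ, fun n => (Cg + ∑ j, Cm j) * ∑ l, (k n l : ℝ) ^ (-δ l),
    fun n => if ∑ l, k n l = 0 then 0 else ζ n ^ 2 / c, ?_, hAd, ?_, ?_⟩
  · refine
      { C_nonneg := hC0
        Cσ_nonneg := hCσ0
        Z_nonneg := hZ0
        mem_ae := h.ae_mem_regularSet
        eps_meas := fun j => (heps j).comp measurable_snd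
        u_meas := measurable_fst.sub (h.measurable_regression.comp measurable_snd)
        v_meas := fun n j => (hvm' n j).comp measurable_snd
        g_meas := fun n => (hgm n).comp (measurable_snd.comp measurable_snd)
        ψ_meas := fun n a => (hψm n a).comp measurable_snd
        u_memLp := ?_
        eps_le := fun j e he => hC e.2 he.1 he.2 j
        v_le := fun n j e he => (hvb j n e.2.2 he.2).trans
          (mul_le_mul_of_nonneg_right (hCle j) (hs0 n))
        g_le := fun n e he => (hgb n e.2.2 he.2).trans
          (mul_le_mul_of_nonneg_right
            (le_add_of_nonneg_right (Finset.sum_nonneg fun j _ => hCm j)) (hs0 n))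
        ψ_le := fun n e he => hψle n e.2.2 he.2
        eps_ψ := fun n j a => ?_
        u_ψ := fun n a => ?_
        eps_g := fun n j => ?_
        v_u := fun n j => ?_
        eps_u := fun j => ?_
        ψ_ψ := hone
        ψ_u_sq := fun n a => ?_
        v_u_sq := fun n j => ?_
        bias := tendsto_sqrt_mul_sq_sum_rpow_neg h.rate _
        sup := hsup
        dim := by simpa only [hcard] using hdim
        sup_dim := by simpa only [hcard] using h.tendsto_sup_mul_dim c }
    · simp_rw [h.population_u]
      exact h.memLp_u
    · have := (integral_mul_dotProduct_eq_zero (fun a => (h.eps_mul_seriesVec n j a).1)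
        (fun a => (h.eps_mul_seriesVec n j a).2) (A n a)).2
      rw [← this]
      refine integral_congr_ae (ae_of_all _ fun ω => mul_comm _ _)
    · simp_rw [h.population_u]
      exact integral_comp_mul_eq_zero (V := fun ω => (w ω, x ω, z ω))
        (T := fun e => (A n *ᵥ seriesVec p (k n) e.2.1 e.2.2) a) hV (hψm n a) (hψb n a) hui h.condExp_u
    -- `β` need not be continuous, so `x'β` need not lie in the varying coefficient class;
    -- orthogonality comes through its series approximations.
    · exact integral_mul_remainder_eq_zero (B := B) (α := αg)
        (f := fun x z => ∑ l, x l * β z l) h.hx h.hz h.ae_mem (hepsi j)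
        (fun n a => (h.eps_mul_seriesVec n j a).1) (fun n a => (h.eps_mul_seriesVec n j a).2)
        h.hδ h.hk hgm hgb hgf hg0 n
    · simp_rw [h.population_u]
      exact integral_comp_mul_eq_zero (V := fun ω => (w ω, x ω, z ω))
        (T := fun e => v j n e.2) hV (hvm' n j) (hvbω n j) hui h.condExp_u
    · simp_rw [h.population_u]
      refine integral_comp_mul_eq_zero (V := fun ω => (w ω, x ω, z ω)) (B := C)
        (T := fun e => (e.1 - m e.2.1 e.2.2) j) hV (heps j) ?_ hui h.condExp_u
      filter_upwards [h.ae_mem, h.ae_mem_regressors] with ω h1 h2 using hC _ h2 h1 j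
    · simp_rw [h.population_u]
      exact integral_comp_mul_sq_le hV (hψm n a) (hψb n a) hu2 hCσ
    · simp_rw [h.population_u]
      exact integral_comp_mul_sq_le hV (hvm' n j) (hvbω n j) hu2 hCσ
  · filter_upwards [hgf] with n hn
    refine ⟨αg n ᵥ* B n, fun xz => (hn xz).trans ?_⟩
    rw [dotProduct_comm, Matrix.dotProduct_mulVec, dotProduct_comm]
  · filter_upwards [eventually_all.2 hvf] with n hn j
    refine ⟨αm j n ᵥ* B n, fun xz => (hn j xz).trans ?_⟩
    rw [dotProduct_comm, Matrix.dotProduct_mulVec, dotProduct_comm]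

end SeriesModel


/-! ### Limit law of the linear coefficients -/

section Normality

variable {Ω : Type*} [MeasurableSpace Ω] {μ : Measure Ω} [IsProbabilityMeasure μ]
  {E : Type*} [MeasurableSpace E] {q : ℕ} {κ : ℕ → Type*} [∀ n, Fintype (κ n)]
  [∀ n, DecidableEq (κ n)] {D : SeriesPopulation E q κ} {ξ : ℕ → Ω → E} {S : Set E} {C Cσ : ℝ}
  {b Z : ℕ → ℝ}

/-- Asymptotic normality of the linear coefficients. -/
theorem SeriesPopulation.Regular.tendstoInDistribution (h : D.Regular μ (ξ 0) S C Cσ b Z)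
    (hindep : iIndepFun ξ μ) (hident : ∀ i, IdentDistrib (ξ i) (ξ 0) μ μ)
    (hξ : Measurable (ξ 0)) {Φ Om : Matrix (Fin q) (Fin q) ℝ} {s : ℝ}
    {M : (n : ℕ) → Ω → Matrix (Fin n) (Fin n) ℝ} {hh : ℕ → Ω → Fin q → ℝ}
    (hlim : PartialledLimits (N := fun a => a.1) (κ := fun a => κ a.1) (probFilter μ)
      (fun a => D.sample ξ M hh a) C (fun a => b a.1) (fun a => Z a.1) s Φ Om)
    (hΦ : IsUnit Φ.det) (hΦs : Φ.IsSymm)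
    (hOm : Om = Matrix.of fun j k => ∫ ω, (D.u (ξ 0 ω) * D.eps j (ξ 0 ω)) *
        (D.u (ξ 0 ω) * D.eps k (ξ 0 ω)) ∂μ)
    {θ : ℕ → Ω → Vec q} (hθm : ∀ n, AEMeasurable (θ n) μ)
    (hθ : ∀ n ω j, θ n ω j = √(n : ℝ) * hh n ω j) :
    TendstoInDistribution θ atTop id (fun _ => μ) (multivariateGaussian 0 (Φ⁻¹ * Om * Φ⁻¹)) := by
  set score : E → Fin q → ℝ := fun e j => D.u e * D.eps j e with hscore
  -- Influence function of the estimator; its second moment matrix is the sandwich.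
  set F : E → Vec q := fun e => WithLp.toLp 2 (Φ⁻¹ *ᵥ score e) with hF
  have hsm : ∀ j, Measurable fun e => score e j := fun j => h.u_meas.mul (h.eps_meas j)
  have hFj : ∀ j, Measurable fun e => (Φ⁻¹ *ᵥ score e) j := fun j => by
    simp only [Matrix.mulVec, dotProduct]
    exact Finset.measurable_fun_sum _ fun k _ => (hsm k).const_mul _
  have hFm : Measurable F :=
    (PiLp.continuous_toLp 2 (fun _ : Fin q => ℝ)).measurable.comp (measurable_pi_iff.2 hFj)
  have hs2 : ∀ j, MemLp (fun ω => score (ξ 0 ω) j) 2 μ := fun j =>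
    (h.memLp_eps_u hξ j).ae_eq (ae_of_all _ fun ω => mul_comm _ _)
  have hs0 : ∀ j, ∫ ω, score (ξ 0 ω) j ∂μ = 0 := fun j => by
    rw [← h.eps_u j]
    exact integral_congr_ae (ae_of_all _ fun ω => mul_comm _ _)
  have hF2 : ∀ j, MemLp (fun ω => F (ξ 0 ω) j) 2 μ := fun j => by
    simp only [hF, Matrix.mulVec, dotProduct]
    exact memLp_finsetSum _ fun k _ => (hs2 k).const_mul _
  have hF0 : ∀ j, ∫ ω, F (ξ 0 ω) j ∂μ = 0 := fun j => by
    simp only [hF, Matrix.mulVec, dotProduct]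
    rw [integral_finsetSum _ fun k _ => ((hs2 k).integrable one_le_two).const_mul _]
    simp only [integral_const_mul, hs0, mul_zero, Finset.sum_const_zero]
  -- The covariance of `F` is `Φ⁻¹ Ω (Φ⁻¹)'`; symmetry of `Φ` removes the transpose.
  have hinvs : (Φ⁻¹)ᵀ = Φ⁻¹ := by rw [Matrix.transpose_nonsing_inv, hΦs.eq]
  refine tendstoInDistribution_of_linear hθm (X := fun i ω => F (ξ i ω))
    (hindep.comp (fun _ => F) fun _ => hFm) (fun i => (hident i).comp hFm) hF2 hF0
    (fun j k => ?_) fun j => ?_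
  · have := integral_mulVec_mul_mulVec (T := fun ω => score (ξ 0 ω)) Φ⁻¹
      (fun b b' => (hs2 b).integrable_mul (hs2 b')) j k
    rw [hinvs] at this
    rw [hOm]
    exact this.symm
  · refine (hlim.linear_tendsto hΦ j).congr fun a => ?_
    rw [hθ]
    congr 1
    simp only [hF, hscore, Matrix.mulVec, dotProduct, SeriesPopulation.sample]
    rw [Finset.sum_comm, Finset.sum_div]
    refine Finset.sum_congr rfl fun k _ => ?_
    rw [← Finset.mul_sum, mul_div_assoc]
    congr 2
    exact Finset.sum_congr rfl fun i _ => mul_comm _ _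

end Normality

/-! ### The series least squares estimator as a sample regression -/

namespace SeriesModel

variable {Ω : Type*} {q d r : ℕ} {γ : Vec q} {β : Vec r → Vec d}
  {p : (l : Fin d) → (κ : ℕ) → Fin κ → Vec r → ℝ} {k : ℕ → Fin d → ℕ}
  {m : Vec d → Vec r → Vec q} {A : (n : ℕ) → Matrix (SeriesIdx (k n)) (SeriesIdx (k n)) ℝ}
  {v : Fin q → ℕ → Vec d × Vec r → ℝ} {g : ℕ → Vec d × Vec r → ℝ}
  {Y : ℕ → Ω → ℝ} {w : ℕ → Ω → Vec q} {x : ℕ → Ω → Vec d} {z : ℕ → Ω → Vec r}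
  {M : (n : ℕ) → Ω → Matrix (Fin n) (Fin n) ℝ} {hh : ℕ → Ω → Fin q → ℝ} {n : ℕ} {ω : Ω}
  {P : Matrix (Fin n) (SeriesIdx (k n)) ℝ}

/-- The limit of the second moments of the scores. -/
lemma weightedMomentMatrix_eq [MeasurableSpace Ω] {μ : Measure Ω} [IsProbabilityMeasure μ]
    {Y : Ω → ℝ} {w : Ω → Vec q} {x : Ω → Vec d} {z : Ω → Vec r} {u : Ω → ℝ}
    {B : (n : ℕ) → Matrix (SeriesIdx (k n)) (SeriesIdx (k n)) ℝ} {S : Set (Vec d × Vec r)}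
    {ζ : ℕ → ℝ} {δ : Fin d → ℝ} (h : SeriesModel μ Y w x z u γ β p k B S ζ m δ)
    {ε : Ω → Vec q} (hε : ∀ ω, ε ω = w ω - m (x ω) (z ω))
    (A : (n : ℕ) → Matrix (SeriesIdx (k n)) (SeriesIdx (k n)) ℝ)
    (v : Fin q → ℕ → Vec d × Vec r → ℝ) (g : ℕ → Vec d × Vec r → ℝ) :
    (Matrix.of fun i j => ∫ ω,
      ((population γ β p k m A v g).u (Y ω, w ω, x ω, z ω) *
        (population γ β p k m A v g).eps i (Y ω, w ω, x ω, z ω)) *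
      ((population γ β p k m A v g).u (Y ω, w ω, x ω, z ω) *
        (population γ β p k m A v g).eps j (Y ω, w ω, x ω, z ω)) ∂μ) =
      weightedMomentMatrix μ (μ[fun ω => u ω ^ 2 |
        MeasurableSpace.comap (fun ω => (w ω, x ω, z ω)) inferInstance]) ε := by
  ext i j
  obtain ⟨C, hC0, hC⟩ := h.exists_abs_eps_le
  have heps := h.measurable_eps
  have hb : ∀ᵐ ω ∂μ, |(w ω - m (x ω) (z ω)) i * (w ω - m (x ω) (z ω)) j| ≤ C * C := by
    filter_upwards [h.ae_mem, h.ae_mem_regressors] with ω h1 h2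
    rw [abs_mul]
    exact mul_le_mul (hC _ h2 h1 i) (hC _ h2 h1 j) (abs_nonneg _) hC0
  -- The product `ε_i ε_j` is a bounded function of the regressors, so `u²` may be replaced by its
  -- conditional mean.
  have h1 := integral_comp_mul_condExp (V := fun ω => (w ω, x ω, z ω))
    (T := fun e => (e.1 - m e.2.1 e.2.2) i * (e.1 - m e.2.1 e.2.2) j)
    h.measurable_regressors ((heps i).mul (heps j)) hb h.memLp_u.integrable_sq
  simp only [weightedMomentMatrix, Matrix.of_apply, h.population_u, hε]
  refine Eq.trans (integral_congr_ae (ae_of_all _ fun ω => ?_)) (h1.symm.trans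
    (integral_congr_ae (ae_of_all _ fun ω => mul_comm _ _)))
  simp only [population]
  ring

/-- Together with `IsProjOnto.mul_isUnit`, this identifies the projection on the normalized terms
with the one in the estimator. -/
lemma sample_Ψ (hP : P = seriesDesign n p (k n) (fun i => x i ω) (fun i => z i ω)) :
    ((population γ β p k m A v g).sample (fun i ω => (Y i ω, w i ω, x i ω, z i ω))
      M hh (n, ω)).Ψ = P * (A n)ᵀ := by
  subst hP
  ext i l
  simp only [SeriesPopulation.sample, population, Matrix.of_apply, Matrix.mulVec, dotProduct,
    Matrix.mul_apply, seriesDesign, Matrix.transpose_apply]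
  exact Finset.sum_congr rfl fun b _ => mul_comm _ _

/-- The series least squares estimator as a partialled-out regression. -/
lemma sample_partialled (hP : P = seriesDesign n p (k n) (fun i => x i ω) (fun i => z i ω))
    {W : Matrix (Fin n) (Fin q) ℝ} (hW : W = linearDesign n (fun i => w i ω))
    {G : Matrix (SeriesIdx (k n)) (SeriesIdx (k n)) ℝ} (hG : IsSymmGenInverse (Pᵀ * P) G)
    (hM : M n ω = P * G * Pᵀ) {c : Vec q} {a : SeriesIdx (k n) → ℝ}
    (hLS : IsLeastSquares (fun i => Y i ω) W P c a) (hh_eq : ∀ j, hh n ω j = c j - γ j)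
    (hg : ∃ c : SeriesIdx (k n) → ℝ, ∀ xz : Vec d × Vec r,
        ∑ l, xz.1 l * β xz.2 l = g n xz + seriesVec p (k n) xz.1 xz.2 ⬝ᵥ c)
    (hv : ∀ j, ∃ c : SeriesIdx (k n) → ℝ, ∀ xz : Vec d × Vec r,
        m xz.1 xz.2 j = v j n xz + seriesVec p (k n) xz.1 xz.2 ⬝ᵥ c)
    {X : Partialled n q (SeriesIdx (k n))}
    (hX : X = (population γ β p k m A v g).sample (fun i ω => (Y i ω, w i ω, x i ω, z i ω))
      M hh (n, ω)) :
    (∀ j, ∑ k, (X.r j ⬝ᵥ X.r k) * X.h k = X.r j ⬝ᵥ (X.u + X.g)) ∧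
    (∀ i, lsResidual (fun i => Y i ω) W P c a i = X.uhat i) ∧
    ∀ i j, partialledOut W P G i j = X.r j i := by
  have hMX : X.M = P * G * Pᵀ := by rw [hX]; exact hM
  refine hLS.partialled (γ := γ) (f := fun i => ∑ l, x i ω l * β (z i ω) l)
    (hMX ▸ hG.isProjOnto) hMX (fun i => ?_) ?_ (fun j => ?_) (fun j => ?_)
  · subst hX hW
    simp only [SeriesPopulation.sample, population, linearDesign, Matrix.of_apply]
    ring
  · obtain ⟨c, hc⟩ := hg
    subst hX hP
    exact ⟨c, fun i => hc (x i ω, z i ω)⟩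
  · obtain ⟨c, hc⟩ := hv j
    subst hX hP hW
    refine ⟨c, fun i => ?_⟩
    have := hc (x i ω, z i ω)
    simp only [SeriesPopulation.sample, population, linearDesign, Matrix.of_apply,
      PiLp.sub_apply, this, seriesDesign, Matrix.mulVec]
    ring
  · subst hX
    exact hh_eq j

end SeriesModel

end PLVC

/-! ### Assembly of the theorem -/

theorem theorem2p1 {Ω : Type*} [MeasurableSpace Ω] (μ : Measure Ω) [IsProbabilityMeasure μ]
    {q d r : ℕ}
    -- the model
    (Y : ℕ → Ω → ℝ) (w : ℕ → Ω → Vec q) (x : ℕ → Ω → Vec d) (z : ℕ → Ω → Vec r)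
    (u : ℕ → Ω → ℝ) (γ : Vec q) (β : Vec r → Vec d)
    (hY : ∀ i, Measurable (Y i)) (hw : ∀ i, Measurable (w i)) (hx : ∀ i, Measurable (x i))
    (hz : ∀ i, Measurable (z i)) (hβ : Measurable β)
    (hmodel : ∀ i ω, Y i ω = (∑ j, w i ω j * γ j) + (∑ l, x i ω l * β (z i ω) l) + u i ω)
    (hYL2 : MemLp (Y 0) 2 μ)
    (hu : ∀ i, μ[u i | MeasurableSpace.comap (fun ω => (w i ω, x i ω, z i ω)) inferInstance]
      =ᵐ[μ] 0)
    -- random sample, compact support, bounded conditional mean of `w` and variance of `Y`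
    (hindep : iIndepFun (fun i ω => (Y i ω, w i ω, x i ω, z i ω)) μ)
    (hident : ∀ i, IdentDistrib (fun ω => (Y i ω, w i ω, x i ω, z i ω))
      (fun ω => (Y 0 ω, w 0 ω, x 0 ω, z 0 ω)) μ μ)
    (hcompact : IsCompact (μ.map (fun ω => (w 0 ω, x 0 ω, z 0 ω))).support)
    (hθ : ∃ C : ℝ, ∀ᵐ ω ∂μ,
      ‖(μ[w 0 | MeasurableSpace.comap (fun ω => (x 0 ω, z 0 ω)) inferInstance]) ω‖ ≤ C)
    (hvar : ∃ C : ℝ, ∀ᵐ ω ∂μ,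
      (Var[Y 0; μ | MeasurableSpace.comap (fun ω => (w 0 ω, x 0 ω, z 0 ω)) inferInstance]) ω ≤ C)
    -- basis functions, numbers of series terms, normalization
    (p : (l : Fin d) → (κ : ℕ) → Fin κ → Vec r → ℝ) (hp : ∀ l κ j, Measurable (p l κ j))
    (k : ℕ → Fin d → ℕ)
    (B : (n : ℕ) → Matrix (SeriesIdx (k n)) (SeriesIdx (k n)) ℝ) (hB : ∀ n, IsUnit (B n).det)
    (S : Set (Vec d × Vec r)) (hS : S = (μ.map (fun ω => (x 0 ω, z 0 ω))).support)
    (heig : ∃ c : ℝ, 0 < c ∧ ∀ (n : ℕ) (t : ℝ),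
      Module.End.HasEigenvalue (Matrix.toLin' (Matrix.of fun a b =>
        ∫ ω, (B n *ᵥ seriesVec p (k n) (x 0 ω) (z 0 ω)) a *
          (B n *ᵥ seriesVec p (k n) (x 0 ω) (z 0 ω)) b ∂μ)) t → c ≤ t)
    (ζ : ℕ → ℝ)
    (hζ : ∀ n, ∀ xz ∈ S, ‖WithLp.toLp 2 (B n *ᵥ seriesVec p (k n) xz.1 xz.2)‖ ≤ ζ n)
    (hζK : Tendsto (fun n : ℕ => (ζ n) ^ 2 * ((∑ l, k n l : ℕ) : ℝ) / n) atTop (𝓝 0))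
    -- the projection `m = E_𝒢(w)` and the uniform approximation rates
    (m : Vec d → Vec r → Vec q) (hm : IsVaryingCoefProjection μ (x 0) (z 0) (w 0) m)
    (δ : Fin d → ℝ) (hδ : ∀ l, 0 < δ l)
    (happrox_g : HasSeriesApprox S p k B δ (fun x z => ∑ l, x l * β z l))
    (happrox_m : ∀ j, HasSeriesApprox S p k B δ (fun x z => m x z j))
    (hk : ∀ l, Tendsto (fun n => k n l) atTop atTop)
    (hrate : Tendsto (fun n : ℕ => √(n : ℝ) * ∑ l, (k n l : ℝ) ^ (-(2 * δ l))) atTop (𝓝 0))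
    -- `ε = w - m(x, z)`, `Φ = E[εε']`, `Ω = E[σ²(w,x,z) εε']`
    (ε : Ω → Vec q) (hε : ∀ ω, ε ω = w 0 ω - m (x 0 ω) (z 0 ω))
    (Φ Om : Matrix (Fin q) (Fin q) ℝ)
    (hΦ : Φ = momentMatrix μ ε) (hΦpos : Φ.PosDef)
    (hOm : Om = weightedMomentMatrix μ
      (μ[fun ω => (u 0 ω) ^ 2 |
        MeasurableSpace.comap (fun ω => (w 0 ω, x 0 ω, z 0 ω)) inferInstance]) ε)
    -- design matrices, least squares estimators, `W - W̃` and least squares residuals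
    (W : (n : ℕ) → Ω → Matrix (Fin n) (Fin q) ℝ)
    (hW : ∀ n ω, W n ω = linearDesign n (fun i => w i ω))
    (P : (n : ℕ) → Ω → Matrix (Fin n) (SeriesIdx (k n)) ℝ)
    (hP : ∀ n ω, P n ω = seriesDesign n p (k n) (fun i => x i ω) (fun i => z i ω))
    (γhat : ℕ → Ω → Vec q) (αhat : (n : ℕ) → Ω → SeriesIdx (k n) → ℝ)
    (hγhat : ∀ n, AEMeasurable (γhat n) μ)
    (hLS : ∀ n ω, IsLeastSquares (fun i => Y i ω) (W n ω) (P n ω) (γhat n ω) (αhat n ω))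
    (G : (n : ℕ) → Ω → Matrix (SeriesIdx (k n)) (SeriesIdx (k n)) ℝ)
    (hG : ∀ n ω, IsSymmGenInverse ((P n ω)ᵀ * P n ω) (G n ω))
    (R : (n : ℕ) → Ω → Matrix (Fin n) (Fin q) ℝ)
    (hR : ∀ n ω, R n ω = partialledOut (W n ω) (P n ω) (G n ω))
    (uhat : (n : ℕ) → Ω → Fin n → ℝ)
    (huhat : ∀ n ω, uhat n ω =
      lsResidual (fun i => Y i ω) (W n ω) (P n ω) (γhat n ω) (αhat n ω)) :
    -- (i) asymptotic normality
    TendstoInDistribution (fun (n : ℕ) ω => √(n : ℝ) • (γhat n ω - γ)) atTop id (fun _ => μ)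
      (multivariateGaussian 0 (Φ⁻¹ * Om * Φ⁻¹)) ∧
    -- (ii) consistency of the sandwich estimator, whose `Φ̂` is asymptotically nonsingular
    Tendsto (fun n => μ {ω | ¬ IsUnit (PhiHat (R n ω)).det}) atTop (𝓝 0) ∧
    ∀ a b, TendstoInMeasure μ (fun n ω => SigmaHat (uhat n ω) (R n ω) a b) atTop
      (fun _ => (Φ⁻¹ * Om * Φ⁻¹) a b) := by
  have hmod : SeriesModel μ (Y 0) (w 0) (x 0) (z 0) (u 0) γ β p k B S ζ m δ :=
    { hw := hw 0, hx := hx 0, hz := hz 0, hβ := hβ, model := hmodel 0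
      memLp := hYL2, condExp_u := hu 0, isCompact_support := hcompact, condVar_le := hvar
      hp := hp, hB := hB, hS := hS, heig := heig, hζ := hζ, hζK := hζK, proj := hm, hδ := hδ
      approx_g := happrox_g, approx_m := happrox_m, hk := hk, rate := hrate }
  obtain ⟨A, v, g, C, Cσ, b, Z, hreg, hA, hgdec, hmdec⟩ := hmod.exists_regular
  let D := SeriesModel.population γ β p k m A v g
  let ξ : ℕ → Ω → ℝ × Vec q × Vec d × Vec r := fun i ω => (Y i ω, w i ω, x i ω, z i ω)
  let M : (n : ℕ) → Ω → Matrix (Fin n) (Fin n) ℝ := fun n ω => P n ω * G n ω * (P n ω)ᵀ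
  let hh : ℕ → Ω → Fin q → ℝ := fun n ω j => γhat n ω j - γ j
  have hξ : Measurable (ξ 0) := (hY 0).prodMk ((hw 0).prodMk ((hx 0).prodMk (hz 0)))
  -- The set is measurable, being cut out by closed supports, so equality in law carries membership
  -- from the first observation to each of countably many.
  have hmem : ∀ᵐ ω ∂μ, ∀ i, ξ i ω ∈ SeriesModel.regularSet μ (w 0) (x 0) (z 0) S :=
    ae_all_iff.2 fun i => (hident i).symm.ae_snd hmod.measurableSet_regularSet
      hmod.ae_mem_regularSet
  have hproj : ∀ a : ℕ × Ω, IsProjOnto (M a.1 a.2) (D.sample ξ M hh a).Ψ := fun a => by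
    have h1 : (D.sample ξ M hh a).Ψ = P a.1 a.2 * (A a.1)ᵀ :=
      SeriesModel.sample_Ψ (n := a.1) (ω := a.2) (hP a.1 a.2)
    rw [h1]
    exact (hG a.1 a.2).isProjOnto.mul_isUnit (by rw [Matrix.det_transpose]; exact hA a.1)
  -- This holds only for large `n`, since the remainders were set to zero below the range of the
  -- approximation rates.
  have hlink : ∀ᶠ n in atTop, ∀ ω,
      (∀ j, ∑ l, ((D.sample ξ M hh (n, ω)).r j ⬝ᵥ (D.sample ξ M hh (n, ω)).r l) * hh n ω l =
        (D.sample ξ M hh (n, ω)).r j ⬝ᵥ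
          ((D.sample ξ M hh (n, ω)).u + (D.sample ξ M hh (n, ω)).g)) ∧
      (∀ i, uhat n ω i = (D.sample ξ M hh (n, ω)).uhat i) ∧
      ∀ i j, R n ω i j = (D.sample ξ M hh (n, ω)).r j i := by
    filter_upwards [hgdec, hmdec] with n h1 h2 ω
    rw [huhat, hR]
    exact SeriesModel.sample_partialled (hP n ω) (hW n ω) (hG n ω) rfl (hLS n ω)
      (fun _ => rfl) h1 h2 rfl
  have hlim := hreg.partialledLimits (ξ := ξ) hindep hident hξ hmem (M := M) (hh := hh) hproj
    (hlink.mono fun n hn ω => (hn ω).1)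
  have hΦ' : (Matrix.of fun j l => ∫ ω, D.eps j (ξ 0 ω) * D.eps l (ξ 0 ω) ∂μ) = Φ := by
    rw [hΦ]
    ext j l
    simp only [momentMatrix, hε]
    rfl
  have hOm' : (Matrix.of fun j l => ∫ ω, (D.u (ξ 0 ω) * D.eps j (ξ 0 ω)) *
      (D.u (ξ 0 ω) * D.eps l (ξ 0 ω)) ∂μ) = Om := by
    rw [hOm]
    exact hmod.weightedMomentMatrix_eq hε A v g
  have hdet : IsUnit Φ.det := hΦpos.det_pos.ne'.isUnit
  rw [hΦ', hOm'] at hlim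
  have hlink' : ∀ᶠ a : ℕ × Ω in probFilter μ,
      PhiHat (R a.1 a.2) = PartialledLimits.gramMatrix (D.sample ξ M hh a) ∧
      OmegaHat (uhat a.1 a.2) (R a.1 a.2) = (D.sample ξ M hh a).omegaMatrix := by
    filter_upwards [tendsto_fst_probFilter.eventually hlink] with a ha
    exact ⟨PhiHat_eq_gramMatrix (ha a.2).2.2,
      OmegaHat_eq_omegaMatrix (ha a.2).2.2 (ha a.2).2.1⟩
  refine ⟨?_, ?_, fun j l => ?_⟩
  · exact hreg.tendstoInDistribution (ξ := ξ) hindep hident hξ hlim hdet hΦpos.1 hOm'.symm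
      (fun n => ((hγhat n).sub_const γ).const_smul (√(n : ℝ))) (fun n ω j => rfl)
  · have h0 : ∀ᶠ a : ℕ × Ω in probFilter μ, IsUnit (PhiHat (R a.1 a.2)).det := by
      filter_upwards [(tendsto_matrix_inv hlim.gramMatrix_tendsto hdet).1, hlink'] with a h1 h2
      rw [h2.1]
      exact h1
    exact (eventually_probFilter (p := fun a => IsUnit (PhiHat (R a.1 a.2)).det)).1 h0
  · refine TendstoInMeasure.of_tendsto_probFilter
      (X := fun n ω => SigmaHat (uhat n ω) (R n ω) j l) ?_
    have h1 := tendsto_pi_nhds.1 (tendsto_pi_nhds.1 (hlim.sandwich_tendsto hdet) j) l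
    refine h1.congr' ?_
    filter_upwards [hlink'] with a h2
    rw [SigmaHat, h2.1, h2.2]
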